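/- **Setting.** Let $H=(h_{ij})_{i,j=1}^N$ be a random hermitian $N\times N$ matrix (real symmetric matrices are included) whose entries $h_{ij}$, $i\le j$, are independent, square integrable and satisfy $\mathbb E h_{ij}=0$. Put $\sigma_{ij}^2=\mathbb E|h_{ij}|^2$, $\Sigma=(\sigma_{ij}^2)_{i,j}$ and $M=1/\max_{i,j}\sigma_{ij}^2$. Let $\alpha,\beta,\delta_->0$ and $\delta_+\ge 0$, and assume: * $\sum_i\sigma_{ij}^2=1$ for every $j$; * $1$ is a simple eigenvalue of $\Sigma$ and $\operatorname{Spec}(\Sigma)\subset[-1+\delta_-,1-\delta_+]\cup\{1\}$; * $\mathbb P(|h_{ij}|>x^{\alpha}\sigma_{ij})\le\beta e^{-x}$ for all $i,j$ and all $x>0$. For $z=E+i\eta$ with $\eta>0$ let $\kappa=\big||E|-2\big|$, let $m_{sc}=m_{sc}(z)$ be the unique solution of $m_{sc}+\frac{1}{z+m_{sc}}=0$ with positive imaginary part, and let $$\theta(z)=\frac{1}{|1-m_{sc}^2|}+\frac{1}{\max\{\delta_+,\,|\operatorname{Re} m_{sc}^2-1|\}} .$$ Define the domain $$D^*=\Big\{z=E+i\eta:\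 |E|\le5,\ \tfrac1N\le\eta\le10,\ M\eta\ge(\log N)^{24+6\alpha}\,\theta(z)^4\,(\kappa+\eta)^{1/2}\Big\}.$$ For $1\le i\le N$ let $\mathbf a^i=(h_{ki})_{k}$ be the $i$-th column of $H$, let $H^{(i)}$ be the minor obtained by removing the $i$-th row and column, let $G^{(i)}=(H^{(i)}-z)^{-1}$, and define $$Z_i=\sum_{k,l\ne i}\Big[\overline{\mathbf a^i_k}\,G^{(i)}_{kl}\,\mathbf a^i_l-\mathbb E_{\mathbf a^i}\,\overline{\mathbf a^i_k}\,G^{(i)}_{kl}\,\mathbf a^i_l\Big],$$ where $\mathbb E_{\mathbf a^i}$ is the expectation with respect to the $i$-th column only (all entries outside the $i$-th row and column being kept fixed). Finally let $$X=X(z)=(\log N)^{10+2\alpha}\,\frac{(\kappa+\eta)^{1/4}}{\sqrt{M\eta}} .$$ **Lemma.** For every even number $p$ there is a constant $C_p>0$, depending only on $p$, such that for all $\alpha,\beta,\delta_->0$ there is an $N_0$ (depending on $p,\alpha,\beta,\delta_-$) with the following property. For every $N\ge N_0$, every $\delta_+\ge0$, every $H$ as above and every $z\in D^*$, the random variable $\big|\frac1N\sum_{i=1}^N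 Z_i\big|^p$ is integrable and $$\mathbb E\,\Big|\frac1N\sum_{i=1}^N Z_i\Big|^{p}\le C_p\Big((\log N)^{3+2\alpha}X^2\Big)^p .$$ -/

import Mathlib

open MeasureTheory ProbabilityTheory

noncomputable section

namespace UniversalWigner

/-- The Stieltjes transform of the semicircle law, `(-z + √(z² - 4)) / 2`. For `Im z > 0` the product
of principal square roots `√(z - 2) √(z + 2)` is the branch of `√(z² - 4)` with cut `[-2, 2]`
that is asymptotic to `z` at infinity (see `eq_msc_iff`). -/
def msc (z : ℂ) : ℂ :=
  (-z + (z - 2) ^ (1 / 2 : ℂ) * (z + 2) ^ (1 / 2 : ℂ)) / 2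

/-- The principal square root maps the upper half plane into the open first quadrant. -/
lemma sqrt_pos {w : ℂ} (hw : 0 < w.im) :
    0 < (w ^ (1 / 2 : ℂ)).re ∧ 0 < (w ^ (1 / 2 : ℂ)).im := by
  have hsq : (w ^ (1 / 2 : ℂ)) ^ 2 = w := by
    rw [← Complex.cpow_nat_mul]; norm_num
  have hre : 0 ≤ (w ^ (1 / 2 : ℂ)).re := by
    have h0 : w ≠ 0 := by rintro rfl; simp at hw
    rw [Complex.cpow_def_of_ne_zero h0, Complex.exp_re]
    apply mul_nonneg (Real.exp_pos _).le
    apply Real.cos_nonneg_of_mem_Icc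
    have him : (Complex.log w * (1 / 2)).im = w.arg / 2 := by
      have : Complex.log w * (1 / 2) = Complex.log w / ((2 : ℝ) : ℂ) := by push_cast; ring
      rw [this, Complex.div_ofReal_im, Complex.log_im]
    rw [him]
    constructor <;> linarith [Complex.neg_pi_lt_arg w, Complex.arg_le_pi w]
  set s := w ^ (1 / 2 : ℂ)
  have him : 2 * s.re * s.im = w.im := by
    rw [← hsq, pow_two, Complex.mul_im]; ring
  have hre' : 0 < s.re := by
    rcases hre.lt_or_eq with h | h
    · exact h
    · rw [← h] at him; linarith
  refine ⟨hre', ?_⟩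
  by_contra hneg
  push Not at hneg
  nlinarith

/-- `msc z` is the unique solution of `m + 1 / (z + m) = 0` with positive imaginary part. -/
lemma eq_msc_iff {z : ℂ} (hz : 0 < z.im) (m : ℂ) :
    m = msc z ↔ m + 1 / (z + m) = 0 ∧ 0 < m.im := by
  have ha := sqrt_pos (w := z + 2) (by simpa using hz)
  have hb := sqrt_pos (w := z - 2) (by simpa using hz)
  have hasq : ((z + 2) ^ (1 / 2 : ℂ)) ^ 2 = z + 2 := by
    rw [← Complex.cpow_nat_mul]; norm_num
  have hbsq : ((z - 2) ^ (1 / 2 : ℂ)) ^ 2 = z - 2 := by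
    rw [← Complex.cpow_nat_mul]; norm_num
  have hmsc : msc z = (-z + (z - 2) ^ (1 / 2 : ℂ) * (z + 2) ^ (1 / 2 : ℂ)) / 2 := rfl
  set a := (z + 2) ^ (1 / 2 : ℂ)
  set b := (z - 2) ^ (1 / 2 : ℂ)
  have hq : msc z * (z + msc z) = -1 := by
    rw [hmsc]
    linear_combination (1 / 4) * b ^ 2 * hasq + (1 / 4) * (z + 2) * hbsq
  have hpos : 0 < (msc z).im := by
    have h4 : msc z * (a + b) ^ 2 = -4 := by
      rw [hmsc]
      linear_combination (-z + b * a) / 2 * (hasq + hbsq) + b ^ 2 * hasq + (z + 2) * hbsq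
    have hne : (a + b) ^ 2 ≠ 0 := by
      intro h; rw [h] at h4; norm_num at h4
    have hm : msc z = (((-4 : ℝ) : ℂ)) * ((a + b) ^ 2)⁻¹ := by
      rw [eq_mul_inv_iff_mul_eq₀ hne, h4]; push_cast; rfl
    have him : 0 < ((a + b) ^ 2).im := by
      rw [pow_two, Complex.mul_im, Complex.add_re, Complex.add_im]
      have := mul_pos (add_pos ha.1 hb.1) (add_pos ha.2 hb.2)
      linarith
    rw [hm, Complex.im_ofReal_mul, Complex.inv_im]
    have hn : 0 < Complex.normSq ((a + b) ^ 2) := Complex.normSq_pos.mpr hne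
    have := div_pos him hn
    have e : -((a + b) ^ 2).im / Complex.normSq ((a + b) ^ 2)
      = -(((a + b) ^ 2).im / Complex.normSq ((a + b) ^ 2)) := by ring
    rw [e]; linarith
  have key : ∀ m : ℂ, 0 < m.im → (m + 1 / (z + m) = 0 ↔ m * (z + m) = -1) := by
    intro m hm
    have hne : z + m ≠ 0 := by
      intro h
      have := congrArg Complex.im h
      simp at this; linarith
    constructor
    · intro h
      field_simp at h
      linear_combination h
    · intro h
      field_simp
      linear_combination h
  constructor
  · rintro rfl
    exact ⟨(key _ hpos).2 hq, hpos⟩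
  · rintro ⟨h, hm⟩
    have h1 := (key m hm).1 h
    have h2 : (m - msc z) * (z + m + msc z) = 0 := by linear_combination h1 - hq
    rcases mul_eq_zero.mp h2 with h3 | h3
    · exact sub_eq_zero.mp h3
    · have := congrArg Complex.im h3
      simp at this; linarith

/-- `κ = ||E| - 2|` for `z = E + iη`. -/
def kappa (z : ℂ) : ℝ := |(|z.re| - 2)|

/-- The control function
`θ(z) = 1 / |1 - m_sc(z)²| + 1 / max {δ₊, |Re m_sc(z)² - 1|}`. -/
def theta (δp : ℝ) (z : ℂ) : ℝ :=
  1 / ‖1 - msc z ^ 2‖ + 1 / max δp |(msc z ^ 2).re - 1|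

section RandomMatrix

variable {Ω : Type*} [MeasurableSpace Ω] {N : ℕ}

/-- The matrix `Σ` of the variances `σ_ij² = 𝔼 |h_ij|²` (of centred entries). -/
def varMatrix (P : Measure Ω) (H : Ω → Matrix (Fin N) (Fin N) ℂ) : Matrix (Fin N) (Fin N) ℝ :=
  Matrix.of fun i j => ∫ ω, ‖H ω i j‖ ^ 2 ∂P

/-- `M = 1 / max_{ij} σ_ij²`. -/
def bandParam (P : Measure Ω) (H : Ω → Matrix (Fin N) (Fin N) ℂ) : ℝ :=
  1 / ⨆ q : Fin N × Fin N, varMatrix P H q.1 q.2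

/-- `H` is a universal Wigner matrix: a random hermitian matrix with independent centred entries on
and above the diagonal, whose matrix of variances is doubly stochastic with simple eigenvalue `1` and
remaining spectrum in `[-1 + δ₋, 1 - δ₊]`, and whose entries have uniform subexponential decay
with parameters `α`, `β`. Real symmetric matrices are included. -/
structure IsUniversalWigner (P : Measure Ω) (H : Ω → Matrix (Fin N) (Fin N) ℂ)
    (α β δm δp : ℝ) : Prop where
  hermitian : ∀ ω, (H ω).IsHermitian
  measurable : ∀ i j, Measurable fun ω => H ω i j
  memLp_two : ∀ i j, MemLp (fun ω => H ω i j) 2 P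
  centred : ∀ i j, ∫ ω, H ω i j ∂P = 0
  indep : iIndepFun
    (fun (q : {q : Fin N × Fin N // q.1 ≤ q.2}) (ω : Ω) => H ω q.1.1 q.1.2) P
  sum_var : ∀ j, ∑ i, varMatrix P H i j = 1
  simple_one :
    Module.finrank ℝ (Module.End.eigenspace (Matrix.toLin' (varMatrix P H)) 1) = 1
  spectrum_subset : spectrum ℝ (varMatrix P H) ⊆ Set.Icc (-1 + δm) (1 - δp) ∪ {1}
  /-- For `σ_ij > 0` this is equivalent to the form with `≤` inside the event, and for `σ_ij = 0` it
  holds for every `β ≥ 0`, as `h_ij = 0` almost surely. -/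
  subexp : ∀ i j, ∀ x : ℝ, 0 < x →
    P.real {ω | x ^ α * √(varMatrix P H i j) < ‖H ω i j‖} ≤ β * Real.exp (-x)

/-- The resolvent `G^(T) = (A^(T) - z)⁻¹` of the minor `A^(T)` that is left after removing the rows
and columns with index in `T`. -/
def greenMinor (A : Matrix (Fin N) (Fin N) ℂ) (z : ℂ) (T : Finset (Fin N)) :
    Matrix {k // k ∉ T} {k // k ∉ T} ℂ :=
  (A.submatrix Subtype.val Subtype.val - z • 1)⁻¹

/-- `Z_ij^(T) = ∑_{k, l ∉ T} conj (a^i_k) G^(T)_kl a^j_l`, where `a^i` is the `i`-th column. -/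
def quadForm (z : ℂ) (T : Finset (Fin N)) (i j : Fin N) (A : Matrix (Fin N) (Fin N) ℂ) : ℂ :=
  ∑ k : {k // k ∉ T}, ∑ l : {k // k ∉ T},
    (starRingEnd ℂ) (A k.1 i) * greenMinor A z T k l * A l.1 j

/-- The matrix with the entries of `B` in the `i`-th row and column, and those of `A` elsewhere. -/
def replaceCol (i : Fin N) (A B : Matrix (Fin N) (Fin N) ℂ) : Matrix (Fin N) (Fin N) ℂ :=
  Matrix.of fun k l => if k = i ∨ l = i then B k l else A k l

/-- `(𝔼_{a^i} F)(A)`: the expectation of `F` with respect to the `i`-th column `a^i` of the random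
hermitian matrix `H` (which determines its `i`-th row), with all other entries fixed at their
values in `A`. -/
def colExp (P : Measure Ω) (H : Ω → Matrix (Fin N) (Fin N) ℂ) (i : Fin N)
    (F : Matrix (Fin N) (Fin N) ℂ → ℂ) (A : Matrix (Fin N) (Fin N) ℂ) : ℂ :=
  ∫ ω', F (replaceCol i A (H ω')) ∂P

/-- `Z_i = Z_ii^(i) - 𝔼_{a^i} Z_ii^(i)`. -/
def fluct (P : Measure Ω) (H : Ω → Matrix (Fin N) (Fin N) ℂ) (z : ℂ) (i : Fin N) (ω : Ω) : ℂ :=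
  quadForm z {i} i i (H ω) - colExp P H i (quadForm z {i} i i) (H ω)

/-- The domain `D*`. -/
def domainDStar (P : Measure Ω) (H : Ω → Matrix (Fin N) (Fin N) ℂ) (α δp : ℝ) : Set ℂ :=
  {z | |z.re| ≤ 5 ∧ 1 / (N : ℝ) ≤ z.im ∧ z.im ≤ 10 ∧
    Real.log N ^ (24 + 6 * α) * theta δp z ^ 4 * (kappa z + z.im) ^ (1 / 2 : ℝ)
      ≤ bandParam P H * z.im}

/-- `X(z) = (log N)^(10 + 2α) (κ + η)^(1/4) / √(M η)`. -/
def controlX (P : Measure Ω) (H : Ω → Matrix (Fin N) (Fin N) ℂ) (α : ℝ) (z : ℂ) : ℝ :=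
  Real.log N ^ (10 + 2 * α) * ((kappa z + z.im) ^ (1 / 4 : ℝ) / √(bandParam P H * z.im))

end RandomMatrix

end UniversalWigner

end

/-! The average of the `Z_i` is smaller than a single `Z_i` because the `Z_i` are almost
independent: `Z_i` sees the column `j` only through a resolvent that changes little when `j` is
removed. Let `B = (κ + η)^(1/4) (M η)^(-1/2)`, let `K` be the constant of the large deviation
estimates, and `ψ = log N * K * B`; on an overwhelmingly likely event `ψ` bounds the off-diagonal
resolvent entries and each `Z_i`.

Fluctuation averaging. Expand the `p`-th moment into expectations of `∏_s Z_{i_s}`, half of the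
factors conjugated, and let `I` be the set of indices that occur. Each factor is split by `1 = ∏_{v
∈ I} (𝔼_v + (1 - 𝔼_v))` into parts that fluctuate in a set `A_s ⊆ I` and are averaged over the rest.
A product of parts has nonzero mean only if `i_s ∈ A_s` (since `𝔼_{i_s} Z_{i_s} = 0`) and every `v ∈
I` lies in at least two of the `A_s`; hence `∑ |A_s| ≥ 2 |I|`. If the part fluctuating in `A` is
`O(ψ^|A|)` in `L^p`, every term is `O(ψ^(2|I|))`, and summing over the index tuples gives `(N
ψ²)^p`, because `N ψ² ≥ 1`. This is `integral_norm_average_pow_le`.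

The gain `ψ^|A|`. The operator `1 - 𝔼_v` kills whatever does not depend on column `v`, so the
quadratic form in `Z_i` may be replaced by its alternating sum over the minors that omit subsets of
`A \ {i}` (`fluctPart_fluctCoord`). By the Schur complement this is an iterated difference of `-1 /
G_ii^(T)` in `T`. The first difference produces two off-diagonal entries and every further one at
least one more (`isSmall_green`, `norm_altDiff_quadForm_le`).

The resolvent bounds. Linear and quadratic forms in one column have moments of order `2n` with
constants polynomial in `n` (`integral_norm_linear_pow_le`, `integral_norm_quadratic_pow_le`); with
`n` of order `log N` the conditional Chebyshev inequality makes all required large deviation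
estimates hold outside an event of probability a large negative power of `N`. On the good event the
rest is deterministic: `G_ii - m` solves an approximate linear equation with operator `1 - m² Σ`,
whose inverse has maximum norm at most `C log N θ` (`IsGappedStochastic.norm_le`), and a bootstrap
from height `10` down a fine grid reaches `z` (`ScaleData.weak_local_law`,
`ScaleData.entrywise_bounds`). The condition defining `D*` is what closes the bootstrap. On the bad
event a crude polynomial moment bound suffices.

Logarithms. Since `K ≤ (log N)^(5 + 2α)`, the result is a constant times `(log N)^(12 + 4α) B²` per
power, while the target is `(log N)^(23 + 6α) B²`; the surplus absorbs every constant, so `C = 1`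
works for large `N`. -/

set_option linter.unusedSectionVars false

namespace UniversalWigner

/-! ### Averaging over sets of coordinates of a product measure -/

section Resampling

variable {ι : Type*} [Fintype ι] [DecidableEq ι]

/-- A measure on configurations that is invariant under resampling any set of coordinates from an
independent copy (a product measure), and all of whose moments are finite. -/
class ResamplingMeasure (μ : Measure (ι → ℂ)) : Prop where
  piecewise : ∀ S : Finset ι, MeasurePreserving
    (fun q : (ι → ℂ) × (ι → ℂ) => S.piecewise q.2 q.1) (μ.prod μ) μ
  moment : ∀ m : ℕ, Integrable (fun x : ι → ℂ => (1 + ‖x‖) ^ m) μ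

lemma measurable_piecewise_prod (S : Finset ι) :
    Measurable (fun q : (ι → ℂ) × (ι → ℂ) => S.piecewise q.2 q.1) := by
  refine measurable_pi_lambda _ fun i => ?_
  by_cases h : i ∈ S
  · simp only [Finset.piecewise, h, if_true]; fun_prop
  · simp only [Finset.piecewise, h, if_false]; fun_prop

/-- It suffices to test boxes: the preimage of a box is a product of two boxes, and each coordinate
is constrained in exactly one of the two copies. -/
lemma measurePreserving_piecewise_pi (ν : ι → Measure ℂ) [∀ i, IsProbabilityMeasure (ν i)]
    (S : Finset ι) :
    MeasurePreserving (fun q : (ι → ℂ) × (ι → ℂ) => S.piecewise q.2 q.1)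
      ((Measure.pi ν).prod (Measure.pi ν)) (Measure.pi ν) := by
  refine ⟨measurable_piecewise_prod S, ?_⟩
  symm
  refine Measure.pi_eq fun s hs => ?_
  rw [Measure.map_apply (measurable_piecewise_prod S) (MeasurableSet.univ_pi hs)]
  have : (fun q : (ι → ℂ) × (ι → ℂ) => S.piecewise q.2 q.1) ⁻¹' (Set.univ.pi s)
      = (Set.univ.pi fun i => if i ∈ S then Set.univ else s i) ×ˢ
        (Set.univ.pi fun i => if i ∈ S then s i else Set.univ) := by
    ext q
    simp only [Set.mem_preimage, Set.mem_univ_pi, Set.mem_prod, Finset.piecewise]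
    constructor
    · intro h
      refine ⟨fun i => ?_, fun i => ?_⟩ <;> by_cases hi : i ∈ S <;> have := h i <;> simp_all
    · rintro ⟨h1, h2⟩ i
      have h1 := h1 i
      have h2 := h2 i
      by_cases hi : i ∈ S <;> simp_all
  rw [this, Measure.prod_prod, Measure.pi_pi, Measure.pi_pi, ← Finset.prod_mul_distrib]
  refine Finset.prod_congr rfl fun i _ => ?_
  by_cases hi : i ∈ S <;> simp [hi]

/-- Measurable functions of polynomial growth. -/
def Tame (F : (ι → ℂ) → ℂ) : Prop :=
  Measurable F ∧ ∃ K : ℝ, ∃ m : ℕ, 0 ≤ K ∧ ∀ x, ‖F x‖ ≤ K * (1 + ‖x‖) ^ m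

lemma Tame.const (c : ℂ) : Tame (fun _ : ι → ℂ => c) :=
  ⟨measurable_const, ‖c‖, 0, norm_nonneg _, by simp⟩

lemma Tame.of_bounded {F : (ι → ℂ) → ℂ} (hF : Measurable F) (K : ℝ) (h : ∀ x, ‖F x‖ ≤ K) :
    Tame F :=
  ⟨hF, max K 0, 0, le_max_right _ _, fun x => by simpa using Or.inl (h x)⟩

lemma Tame.add {F G : (ι → ℂ) → ℂ} (hF : Tame F) (hG : Tame G) : Tame (fun x => F x + G x) := by
  obtain ⟨hF, K, m, hK, h⟩ := hF
  obtain ⟨hG, K', m', hK', h'⟩ := hG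
  refine ⟨hF.add hG, K + K', m + m', by positivity, fun x => ?_⟩
  have h1 : (1 : ℝ) ≤ 1 + ‖x‖ := by linarith [norm_nonneg x]
  calc ‖F x + G x‖ ≤ K * (1 + ‖x‖) ^ m + K' * (1 + ‖x‖) ^ m' :=
        (norm_add_le _ _).trans (add_le_add (h x) (h' x))
    _ ≤ K * (1 + ‖x‖) ^ (m + m') + K' * (1 + ‖x‖) ^ (m + m') := by
        gcongr <;> first | exact h1 | omega
    _ = _ := by ring

lemma Tame.mul {F G : (ι → ℂ) → ℂ} (hF : Tame F) (hG : Tame G) : Tame (fun x => F x * G x) := by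
  obtain ⟨hF, K, m, hK, h⟩ := hF
  obtain ⟨hG, K', m', hK', h'⟩ := hG
  refine ⟨hF.mul hG, K * K', m + m', by positivity, fun x => ?_⟩
  calc ‖F x * G x‖ ≤ (K * (1 + ‖x‖) ^ m) * (K' * (1 + ‖x‖) ^ m') := by
        rw [norm_mul]
        exact mul_le_mul (h x) (h' x) (norm_nonneg _) ((norm_nonneg _).trans (h x))
    _ = _ := by ring

lemma Tame.const_mul {F : (ι → ℂ) → ℂ} (c : ℂ) (hF : Tame F) : Tame (fun x => c * F x) :=
  (Tame.const c).mul hF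

lemma Tame.neg {F : (ι → ℂ) → ℂ} (hF : Tame F) : Tame (fun x => - F x) := by
  simpa using hF.const_mul (-1)

lemma Tame.sub {F G : (ι → ℂ) → ℂ} (hF : Tame F) (hG : Tame G) : Tame (fun x => F x - G x) := by
  simpa [sub_eq_add_neg] using hF.add hG.neg

lemma Tame.conj {F : (ι → ℂ) → ℂ} (hF : Tame F) :
    Tame (fun x => (starRingEnd ℂ) (F x)) := by
  obtain ⟨hF, K, m, hK, h⟩ := hF
  exact ⟨Complex.continuous_conj.measurable.comp hF, K, m, hK, fun x => by simpa using h x⟩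

lemma Tame.ofReal_norm {F : (ι → ℂ) → ℂ} (hF : Tame F) :
    Tame (fun x => ((‖F x‖ : ℝ) : ℂ)) := by
  obtain ⟨hF, K, m, hK, h⟩ := hF
  exact ⟨Complex.measurable_ofReal.comp hF.norm, K, m, hK, fun x => by simpa using h x⟩

lemma Tame.pow {F : (ι → ℂ) → ℂ} (hF : Tame F) (n : ℕ) : Tame (fun x => F x ^ n) := by
  induction n with
  | zero => simpa using Tame.const 1
  | succ n ih => simpa [pow_succ] using ih.mul hF

lemma Tame.sum {κ : Type*} (s : Finset κ) {F : κ → (ι → ℂ) → ℂ} (hF : ∀ k ∈ s, Tame (F k)) :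
    Tame (fun x => ∑ k ∈ s, F k x) := by
  classical
  induction s using Finset.induction_on with
  | empty => simpa using Tame.const 0
  | insert a s ha ih =>
    simp only [Finset.sum_insert ha]
    exact (hF a (by simp)).add (ih fun k hk => hF k (by simp [hk]))

lemma Tame.prod {κ : Type*} (s : Finset κ) {F : κ → (ι → ℂ) → ℂ} (hF : ∀ k ∈ s, Tame (F k)) :
    Tame (fun x => ∏ k ∈ s, F k x) := by
  classical
  induction s using Finset.induction_on with
  | empty => simpa using Tame.const 1
  | insert a s ha ih =>
    simp only [Finset.prod_insert ha]
    exact (hF a (by simp)).mul (ih fun k hk => hF k (by simp [hk]))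

lemma norm_piecewise_le (S : Finset ι) (x y : ι → ℂ) : ‖S.piecewise y x‖ ≤ ‖x‖ + ‖y‖ := by
  refine (pi_norm_le_iff_of_nonneg (by positivity)).2 fun i => ?_
  by_cases h : i ∈ S
  · simp only [Finset.piecewise, h, if_true]
    linarith [norm_le_pi_norm y i, norm_nonneg x]
  · simp only [Finset.piecewise, h, if_false]
    linarith [norm_le_pi_norm x i, norm_nonneg y]

lemma one_add_norm_piecewise_pow_le (S : Finset ι) (x y : ι → ℂ) (m : ℕ) :
    (1 + ‖S.piecewise y x‖) ^ m ≤ (1 + ‖x‖) ^ m * (1 + ‖y‖) ^ m := by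
  rw [← mul_pow]
  refine pow_le_pow_left₀ (by positivity) ?_ m
  nlinarith [norm_piecewise_le S x y, norm_nonneg x, norm_nonneg y,
    mul_nonneg (norm_nonneg x) (norm_nonneg y)]

lemma Tame.piecewise {F : (ι → ℂ) → ℂ} (hF : Tame F) (S : Finset ι) (x : ι → ℂ) :
    Tame (fun y => F (S.piecewise y x)) := by
  obtain ⟨hF, K, m, hK, h⟩ := hF
  refine ⟨hF.comp ((measurable_piecewise_prod S).comp measurable_prodMk_left),
    K * (1 + ‖x‖) ^ m, m, by positivity, fun y => (h _).trans ?_⟩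
  rw [mul_assoc]
  exact mul_le_mul_of_nonneg_left (one_add_norm_piecewise_pow_le S x y m) hK

variable {μ : Measure (ι → ℂ)} [IsProbabilityMeasure μ] [ResamplingMeasure μ]

lemma Tame.integrable {F : (ι → ℂ) → ℂ} (hF : Tame F) : Integrable F μ := by
  obtain ⟨hF, K, m, hK, h⟩ := hF
  refine ((ResamplingMeasure.moment (μ := μ) m).const_mul K).mono' hF.aestronglyMeasurable ?_
  exact Filter.Eventually.of_forall h

lemma Tame.integrable_norm_pow {F : (ι → ℂ) → ℂ} (hF : Tame F) (n : ℕ) :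
    Integrable (fun x => ‖F x‖ ^ n) μ := by
  have := (hF.pow n).integrable (μ := μ) |>.norm
  simpa using this

/-- Integration over the coordinates in `S`. -/
noncomputable def avg (μ : Measure (ι → ℂ)) (S : Finset ι) (F : (ι → ℂ) → ℂ) (x : ι → ℂ) : ℂ :=
  ∫ y, F (S.piecewise y x) ∂μ

lemma Tame.avg {F : (ι → ℂ) → ℂ} (hF : Tame F) (S : Finset ι) : Tame (avg μ S F) := by
  obtain ⟨hF, K, m, hK, h⟩ := hF
  refine ⟨?_, K * ∫ y, (1 + ‖y‖) ^ m ∂μ, m, ?_, fun x => ?_⟩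
  · have h1 : StronglyMeasurable
        (fun q : (ι → ℂ) × (ι → ℂ) => F (S.piecewise q.2 q.1)) :=
      (hF.comp (measurable_piecewise_prod S)).stronglyMeasurable
    exact (h1.integral_prod_right' (ν := μ)).measurable
  · exact mul_nonneg hK (integral_nonneg fun y => by positivity)
  · calc ‖UniversalWigner.avg μ S F x‖ ≤ ∫ y, K * ((1 + ‖x‖) ^ m * (1 + ‖y‖) ^ m) ∂μ := by
          refine norm_integral_le_of_norm_le
            (((ResamplingMeasure.moment (μ := μ) m).const_mul _).const_mul _) ?_
          refine Filter.Eventually.of_forall fun y => (h _).trans ?_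
          exact mul_le_mul_of_nonneg_left (one_add_norm_piecewise_pow_le S x y m) hK
      _ = _ := by rw [integral_const_mul, integral_const_mul]; ring

lemma Tame.integrable_prod {F : (ι → ℂ) → ℂ} (hF : Tame F) (S : Finset ι) :
    Integrable (fun q : (ι → ℂ) × (ι → ℂ) => F (S.piecewise q.2 q.1)) (μ.prod μ) :=
  (ResamplingMeasure.piecewise (μ := μ) S).integrable_comp_of_integrable hF.integrable

lemma integral_piecewise {F : (ι → ℂ) → ℂ} (hF : Tame F) (S : Finset ι) :
    ∫ q : (ι → ℂ) × (ι → ℂ), F (S.piecewise q.2 q.1) ∂μ.prod μ = ∫ x, F x ∂μ := by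
  have h := ResamplingMeasure.piecewise (μ := μ) S
  conv_rhs => rw [← h.map_eq]
  exact (integral_map h.measurable.aemeasurable hF.1.aestronglyMeasurable).symm

lemma integral_avg {F : (ι → ℂ) → ℂ} (hF : Tame F) (S : Finset ι) :
    ∫ x, avg μ S F x ∂μ = ∫ x, F x ∂μ := by
  have h1 := integral_prod _ (hF.integrable_prod (μ := μ) S)
  rw [integral_piecewise hF] at h1
  exact h1.symm

/-- Two successive resamplings amount to one resampling of the union, from a configuration spliced
from the two copies, and the spliced configuration again has law `μ`. -/
lemma avg_avg {F : (ι → ℂ) → ℂ} (hF : Tame F) (S T : Finset ι) (x : ι → ℂ) :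
    avg μ S (avg μ T F) x = avg μ (S ∪ T) F x := by
  have key : ∀ y y' : ι → ℂ, T.piecewise y' (S.piecewise y x)
      = (S ∪ T).piecewise (T.piecewise y' y) x := by
    intro y y'
    ext e
    by_cases h1 : e ∈ S <;> by_cases h2 : e ∈ T <;> simp [Finset.piecewise, h1, h2]
  have h2 := integral_prod _ ((hF.piecewise (S ∪ T) x).integrable_prod (μ := μ) T)
  rw [integral_piecewise (hF.piecewise (S ∪ T) x)] at h2
  rw [avg, avg, h2]
  simp only [avg, key]

lemma avg_empty (F : (ι → ℂ) → ℂ) (x : ι → ℂ) : avg μ ∅ F x = F x := by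
  simp [avg]

lemma avg_of_dependsOn {F : (ι → ℂ) → ℂ} {S : Finset ι} (hF : DependsOn F (S : Set ι)ᶜ) :
    avg μ S F = F := by
  ext x
  have : ∀ y, F (S.piecewise y x) = F x := fun y => hF fun e he => by
    have : e ∉ S := by simpa using he
    simp [Finset.piecewise, this]
  simp [avg, this]

lemma dependsOn_avg (F : (ι → ℂ) → ℂ) (S : Finset ι) :
    DependsOn (avg μ S F) (S : Set ι)ᶜ := by
  intro x x' h
  refine integral_congr_ae (Filter.Eventually.of_forall fun y => ?_)
  have : S.piecewise y x = S.piecewise y x' := by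
    ext e
    by_cases he : e ∈ S
    · simp [Finset.piecewise, he]
    · simpa [Finset.piecewise, he] using h e (by simpa using he)
  simp only [this]

lemma avg_mul_of_dependsOn (F : (ι → ℂ) → ℂ) {V : (ι → ℂ) → ℂ} {S : Finset ι}
    (hV : DependsOn V (S : Set ι)ᶜ) (x : ι → ℂ) :
    avg μ S (fun x => F x * V x) x = avg μ S F x * V x := by
  have : ∀ y, V (S.piecewise y x) = V x := fun y => hV fun e he => by
    have : e ∉ S := by simpa using he
    simp [Finset.piecewise, this]
  simp only [avg, this, integral_mul_const]

/-- Tame functions of disjoint sets of coordinates are independent. -/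
lemma integral_mul_of_dependsOn {F G : (ι → ℂ) → ℂ} (hF : Tame F) (hG : Tame G) {S : Finset ι}
    (hFS : DependsOn F (S : Set ι)) (hGS : DependsOn G (S : Set ι)ᶜ) :
    ∫ x, F x * G x ∂μ = (∫ x, F x ∂μ) * ∫ x, G x ∂μ := by
  rw [← integral_avg (hF.mul hG) S]
  have h1 : ∀ x, avg μ S F x = ∫ y, F y ∂μ := fun x => by
    refine integral_congr_ae (Filter.Eventually.of_forall fun y => hFS fun e he => ?_)
    have : e ∈ S := by simpa using he
    simp [Finset.piecewise, this]
  simp only [avg_mul_of_dependsOn F hGS, h1, integral_const_mul]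

lemma integral_norm_mul_pow_of_dependsOn {F G : (ι → ℂ) → ℂ} (hF : Tame F) (hG : Tame G)
    {S : Finset ι} (hFS : DependsOn F (S : Set ι)) (hGS : DependsOn G (S : Set ι)ᶜ) (n : ℕ) :
    ∫ x, ‖F x * G x‖ ^ n ∂μ = (∫ x, ‖F x‖ ^ n ∂μ) * ∫ x, ‖G x‖ ^ n ∂μ := by
  have h := integral_mul_of_dependsOn (μ := μ) (hF.ofReal_norm.pow n) (hG.ofReal_norm.pow n) (S := S)
    (fun x y h => by simp only [hFS h]) (fun x y h => by simp only [hGS h])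
  rw [← Complex.ofReal_inj]
  push_cast
  rw [← integral_complex_ofReal, ← integral_complex_ofReal, ← integral_complex_ofReal]
  push_cast
  rw [← h]
  simp [mul_pow]

/-- Averaging contracts the moments. -/
lemma integral_norm_avg_pow_le {F : (ι → ℂ) → ℂ} (hF : Tame F) (S : Finset ι) (n : ℕ) :
    ∫ x, ‖avg μ S F x‖ ^ n ∂μ ≤ ∫ x, ‖F x‖ ^ n ∂μ := by
  have h1 : ∀ x, ‖avg μ S F x‖ ^ n ≤ ∫ y, ‖F (S.piecewise y x)‖ ^ n ∂μ := by
    intro x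
    have ht := hF.piecewise S x
    have h2 : ‖avg μ S F x‖ ≤ ∫ y, ‖F (S.piecewise y x)‖ ∂μ := norm_integral_le_integral_norm _
    refine (pow_le_pow_left₀ (norm_nonneg _) h2 n).trans ?_
    -- Jensen's inequality for the conditional average.
    exact (convexOn_pow n).map_integral_le (f := fun y => ‖F (S.piecewise y x)‖)
      (continuous_pow n).continuousOn isClosed_Ici
      (Filter.Eventually.of_forall fun y => by simp) ht.integrable.norm
      (ht.integrable_norm_pow n)
  have h3 : Tame (fun x => (((‖F x‖ ^ n : ℝ)) : ℂ)) := by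
    have := hF.ofReal_norm.pow n
    simpa using this
  have h4 : ∫ x, ∫ y, ‖F (S.piecewise y x)‖ ^ n ∂μ ∂μ = ∫ x, ‖F x‖ ^ n ∂μ := by
    have := integral_avg (μ := μ) h3 S
    simp only [avg, integral_complex_ofReal] at this
    exact_mod_cast this
  rw [← h4]
  refine integral_mono ((hF.avg S).integrable_norm_pow n) ?_ h1
  have := (h3.avg (μ := μ) S).integrable (μ := μ) |>.re
  simpa only [avg, integral_complex_ofReal, Complex.ofReal_re, RCLike.re_to_complex] using this

end Resampling

/-! ### Hoeffding decomposition and the abstract fluctuation averaging bound -/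

section FluctuationAveraging

variable {ι : Type*} [Fintype ι] [DecidableEq ι]
variable {V : Type*} [DecidableEq V]

/-- A map from sets of vertices to the sets of coordinates that belong to them. -/
structure IsIncidence (E : Finset V → Finset ι) : Prop where
  empty : E ∅ = ∅
  union : ∀ A B, E (A ∪ B) = E A ∪ E B

/-- `∏_{v ∈ A} (1 - 𝔼_v) F`, where `𝔼_v` is the average over the coordinates of `v`. -/
noncomputable def fluctPart (μ : Measure (ι → ℂ)) (E : Finset V → Finset ι) (A : Finset V)
    (F : (ι → ℂ) → ℂ) (x : ι → ℂ) : ℂ :=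
  ∑ B ∈ A.powerset, (-1) ^ B.card * avg μ (E B) F x

variable {μ : Measure (ι → ℂ)} [IsProbabilityMeasure μ] [ResamplingMeasure μ]
variable {E : Finset V → Finset ι}

lemma Tame.fluctPart {F : (ι → ℂ) → ℂ} (hF : Tame F) (A : Finset V) :
    Tame (fluctPart μ E A F) :=
  Tame.sum _ fun _ _ => (hF.avg _).const_mul _

lemma avg_fluctPart (hE : IsIncidence E) {F : (ι → ℂ) → ℂ} (hF : Tame F) (A C : Finset V)
    (x : ι → ℂ) :
    avg μ (E C) (fluctPart μ E A F) x
      = ∑ B ∈ A.powerset, (-1) ^ B.card * avg μ (E (C ∪ B)) F x := by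
  have h1 : ∀ B ∈ A.powerset, Integrable
      (fun y => (-1 : ℂ) ^ B.card * avg μ (E B) F ((E C).piecewise y x)) μ := fun B _ =>
    (((hF.avg (μ := μ) (E B)).piecewise (E C) x).const_mul _).integrable
  calc avg μ (E C) (fluctPart μ E A F) x
      = ∑ B ∈ A.powerset, (-1) ^ B.card * avg μ (E C) (avg μ (E B) F) x := by
        simp only [avg, fluctPart] at h1 ⊢
        rw [integral_finsetSum _ h1]
        simp only [integral_const_mul]
    _ = _ := by simp only [avg_avg hF, hE.union]

/-- This is `∏_{v ∈ I} (𝔼_v + (1 - 𝔼_v)) = 1` expanded, with `φ C` in the role of `𝔼_C`. In the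
induction the term of `A` cancels the half of the term of `insert v A` in which `v ∈ B`. -/
lemma sum_alternating_union (I : Finset V) (φ : Finset V → ℂ) :
    ∑ A ∈ I.powerset, ∑ B ∈ A.powerset, (-1) ^ B.card * φ ((I \ A) ∪ B) = φ ∅ := by
  induction I using Finset.induction_on generalizing φ with
  | empty => simp
  | insert v I hv ih =>
    rw [Finset.sum_powerset_insert hv, ← Finset.sum_add_distrib, ← ih φ]
    refine Finset.sum_congr rfl fun A hA => ?_
    rw [Finset.mem_powerset] at hA
    have hvA : v ∉ A := fun h => hv (hA h)
    rw [Finset.sum_powerset_insert hvA, add_comm, add_assoc, ← Finset.sum_add_distrib]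
    have h1 : insert v I \ insert v A = I \ A := by
      ext a; by_cases h : a = v <;> simp [h, hv]
    rw [h1]
    have h2 : insert v I \ A = insert v (I \ A) := Finset.insert_sdiff_of_notMem _ hvA
    rw [h2]
    simp only [add_eq_left]
    refine Finset.sum_eq_zero fun B hB => ?_
    rw [Finset.mem_powerset] at hB
    have hvB : v ∉ B := fun h => hvA (hB h)
    rw [Finset.card_insert_of_notMem hvB, Finset.insert_union, Finset.union_insert]
    ring

/-- The Hoeffding decomposition over the vertices in `I`. -/
lemma sum_avg_fluctPart (hE : IsIncidence E) {F : (ι → ℂ) → ℂ} (hF : Tame F) (I : Finset V)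
    (x : ι → ℂ) :
    ∑ A ∈ I.powerset, avg μ (E (I \ A)) (fluctPart μ E A F) x = F x := by
  simp only [avg_fluctPart hE hF]
  rw [sum_alternating_union I fun C => avg μ (E C) F x, hE.empty, avg_empty]

/-- Since `𝔼_v` is idempotent it kills the factor `1 - 𝔼_v`: once `v` is averaged, `B` and `insert v
B` contribute the same average with opposite signs. -/
lemma avg_avg_fluctPart_of_mem (hE : IsIncidence E) {F : (ι → ℂ) → ℂ} (hF : Tame F)
    {A : Finset V} (C : Finset V) {v : V} (hv : v ∈ A) (x : ι → ℂ) :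
    avg μ (E {v}) (avg μ (E C) (fluctPart μ E A F)) x = 0 := by
  rw [avg_avg (hF.fluctPart A), ← hE.union, avg_fluctPart hE hF]
  obtain ⟨A', hA', rfl⟩ : ∃ A', v ∉ A' ∧ A = insert v A' :=
    ⟨A.erase v, by simp, (Finset.insert_erase hv).symm⟩
  rw [Finset.sum_powerset_insert hA', ← Finset.sum_add_distrib]
  refine Finset.sum_eq_zero fun B hB => ?_
  rw [Finset.mem_powerset] at hB
  have hvB : v ∉ B := fun h => hA' (hB h)
  have : {v} ∪ C ∪ insert v B = {v} ∪ C ∪ B := by ext a; simp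
  rw [this, Finset.card_insert_of_notMem hvB]
  ring

lemma avg_of_avg_eq_zero (hE : IsIncidence E) {F : (ι → ℂ) → ℂ} (hF : Tame F) {v : V}
    (h0 : ∀ x, avg μ (E {v}) F x = 0) {C : Finset V} (hv : v ∈ C) (x : ι → ℂ) :
    avg μ (E C) F x = 0 := by
  have : C = C ∪ {v} := by ext a; simp; rintro rfl; exact hv
  rw [this, hE.union, ← avg_avg hF]
  simp only [avg] at h0 ⊢
  simp [h0]

lemma dependsOn_avg_of_mem (hE : IsIncidence E) (F : (ι → ℂ) → ℂ) {v : V} {C : Finset V}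
    (hv : v ∈ C) : DependsOn (avg μ (E C) F) (E {v} : Set ι)ᶜ := by
  intro x y h
  refine dependsOn_avg F (E C) fun e he => h e ?_
  have : C = C ∪ {v} := by ext a; simp; rintro rfl; exact hv
  rw [this, hE.union] at he
  simp at he ⊢
  exact he.2

lemma dependsOn_finset_prod {κ : Type*} (s : Finset κ) {F : κ → (ι → ℂ) → ℂ} {U : Set ι}
    (h : ∀ k ∈ s, DependsOn (F k) U) : DependsOn (fun x => ∏ k ∈ s, F k x) U :=
  fun _ _ hxy => Finset.prod_congr rfl fun k hk => h k hk hxy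

/-- All factors other than `s₀` have already been averaged over `v`, so integrating over `v` acts on
the factor `s₀` alone and annihilates it. A vertex that fluctuates in only one factor thus makes the
expectation vanish. -/
lemma integral_prod_avg_fluctPart_eq_zero (hE : IsIncidence E) {κ : Type*} [Fintype κ]
    [DecidableEq κ] {Y : κ → (ι → ℂ) → ℂ} (hY : ∀ s, Tame (Y s)) {I : Finset V} {A : κ → Finset V}
    {v : V} (hvI : v ∈ I) {s₀ : κ} (h₀ : v ∈ A s₀) (h : ∀ t, t ≠ s₀ → v ∉ A t) :
    ∫ x, ∏ s, avg μ (E (I \ A s)) (fluctPart μ E (A s) (Y s)) x ∂μ = 0 := by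
  have ht : ∀ s, Tame (avg μ (E (I \ A s)) (fluctPart μ E (A s) (Y s))) := fun s =>
    ((hY s).fluctPart _).avg _
  have e : ∀ x, ∏ s, avg μ (E (I \ A s)) (fluctPart μ E (A s) (Y s)) x
      = avg μ (E (I \ A s₀)) (fluctPart μ E (A s₀) (Y s₀)) x *
        ∏ s ∈ Finset.univ.erase s₀, avg μ (E (I \ A s)) (fluctPart μ E (A s) (Y s)) x := fun x =>
    (Finset.mul_prod_erase _ _ (Finset.mem_univ s₀)).symm
  simp only [e]
  rw [← integral_avg ((ht s₀).mul (Tame.prod _ fun s _ => ht s)) (E {v})]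
  have hd : DependsOn (fun x => ∏ s ∈ Finset.univ.erase s₀,
      avg μ (E (I \ A s)) (fluctPart μ E (A s) (Y s)) x) (E {v} : Set ι)ᶜ := by
    refine dependsOn_finset_prod _ fun s hs => dependsOn_avg_of_mem hE _ ?_
    simp only [Finset.mem_erase, Finset.mem_univ, and_true] at hs
    simp [hvI, h s hs]
  simp only [avg_mul_of_dependsOn _ hd, avg_avg_fluctPart_of_mem hE (hY s₀) _ h₀]
  simp

/-- After normalising by `c` the product is at most the corresponding power of the largest factor,
hence at most the sum of all these powers. -/
lemma prod_le_mul_sum_div_pow {κ : Type*} [Fintype κ] [Nonempty κ] (w c : κ → ℝ)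
    (hw : ∀ s, 0 ≤ w s) (hc : ∀ s, 0 < c s) :
    ∏ s, w s ≤ (∏ s, c s) * ∑ s, (w s / c s) ^ Fintype.card κ := by
  obtain ⟨t, ht⟩ := Finite.exists_max fun s => w s / c s
  have h0 : ∀ s, 0 ≤ w s / c s := fun s => div_nonneg (hw s) (hc s).le
  calc ∏ s, w s = (∏ s, c s) * ∏ s, (w s / c s) := by
        rw [← Finset.prod_mul_distrib]
        exact Finset.prod_congr rfl fun s _ => by field_simp [(hc s).ne']
    _ ≤ (∏ s, c s) * ∏ _s : κ, (w t / c t) := by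
        refine mul_le_mul_of_nonneg_left ?_ (Finset.prod_nonneg fun s _ => (hc s).le)
        exact Finset.prod_le_prod (fun s _ => h0 s) fun s _ => ht s
    _ = (∏ s, c s) * (w t / c t) ^ Fintype.card κ := by
        rw [Finset.prod_const, Finset.card_univ]
    _ ≤ _ := by
        refine mul_le_mul_of_nonneg_left ?_ (Finset.prod_nonneg fun s _ => (hc s).le)
        exact Finset.single_le_sum (f := fun s => (w s / c s) ^ Fintype.card κ)
          (fun s _ => pow_nonneg (h0 s) _) (Finset.mem_univ t)

/-- Hölder's inequality for several functions, up to the harmless factor `Fintype.card κ`. -/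
lemma norm_integral_prod_le {κ : Type*} [Fintype κ] [Nonempty κ] {U : κ → (ι → ℂ) → ℂ}
    (hU : ∀ s, Tame (U s)) {c : κ → ℝ} (hc : ∀ s, 0 < c s)
    (h : ∀ s, ∫ x, ‖U s x‖ ^ Fintype.card κ ∂μ ≤ c s ^ Fintype.card κ) :
    ‖∫ x, ∏ s, U s x ∂μ‖ ≤ (∏ s, c s) * Fintype.card κ := by
  set n := Fintype.card κ with hn
  have hi : ∀ s, Integrable (fun x => (‖U s x‖ / c s) ^ n) μ := fun s => by
    have := ((hU s).integrable_norm_pow (μ := μ) n).div_const (c s ^ n)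
    simpa [div_pow] using this
  calc ‖∫ x, ∏ s, U s x ∂μ‖ ≤ ∫ x, (∏ s, c s) * ∑ s, (‖U s x‖ / c s) ^ n ∂μ := by
        refine norm_integral_le_of_norm_le ((integrable_finsetSum _ fun s _ => hi s).const_mul _) ?_
        refine Filter.Eventually.of_forall fun x => ?_
        rw [norm_prod]
        exact prod_le_mul_sum_div_pow _ _ (fun s => norm_nonneg _) hc
    _ = (∏ s, c s) * ∑ s, (∫ x, ‖U s x‖ ^ n ∂μ) / c s ^ n := by
        rw [integral_const_mul, integral_finsetSum _ fun s _ => hi s]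
        simp only [div_pow, integral_div]
    _ ≤ (∏ s, c s) * ∑ _s : κ, (1 : ℝ) := by
        refine mul_le_mul_of_nonneg_left (Finset.sum_le_sum fun s _ => ?_)
          (Finset.prod_nonneg fun s _ => (hc s).le)
        rw [div_le_one (pow_pos (hc s) _)]
        exact h s
    _ = _ := by simp [hn]

/-- Double counting of the pairs `(v, s)` with `v ∈ A s`. -/
lemma two_mul_card_le_sum_card {κ : Type*} [Fintype κ] [DecidableEq κ] {I : Finset V}
    {A : κ → Finset V} (h : ∀ v ∈ I, ∃ s t, s ≠ t ∧ v ∈ A s ∧ v ∈ A t) :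
    2 * I.card ≤ ∑ s, (A s).card := by
  calc 2 * I.card = ∑ v ∈ I, 2 := by simp [mul_comm]
    _ ≤ ∑ v ∈ I, ∑ s, if v ∈ A s then 1 else 0 := by
        refine Finset.sum_le_sum fun v hv => ?_
        obtain ⟨s, t, hst, hs, ht⟩ := h v hv
        have : ∑ u ∈ {s, t}, (if v ∈ A u then 1 else 0) ≤ ∑ u, if v ∈ A u then 1 else 0 :=
          Finset.sum_le_sum_of_subset (Finset.subset_univ _)
        rw [Finset.sum_pair hst] at this
        simpa [hs, ht] using this
    _ = ∑ s, ∑ v ∈ I, if v ∈ A s then 1 else 0 := Finset.sum_comm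
    _ ≤ _ := by
        refine Finset.sum_le_sum fun s _ => ?_
        rw [← Finset.sum_filter, Finset.sum_const, smul_eq_mul, mul_one]
        exact Finset.card_le_card fun v hv => (Finset.mem_filter.1 hv).2

/-- Choose the entries of the tuple one at a time. An entry already in the image costs nothing but
has at most `p` choices; a new one costs `t`. Together they give at most `p + |V| t ≤ (p + 1) |V|
t`, which is where `1 ≤ |V| t` enters. -/
lemma sum_pow_card_image_le [Fintype V] {t : ℝ} (ht : 0 ≤ t) (hV : 1 ≤ Fintype.card V * t)
    (p : ℕ) : ∑ i : Fin p → V, t ^ (Finset.univ.image i).card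
      ≤ p.factorial * (Fintype.card V * t) ^ p := by
  induction p with
  | zero => simp
  | succ p ih =>
    have e : ∑ i : Fin (p + 1) → V, t ^ (Finset.univ.image i).card
        = ∑ i : Fin p → V, ∑ v, t ^ (insert v (Finset.univ.image i)).card := by
      rw [← (Fin.consEquiv fun _ => V).sum_comp, Fintype.sum_prod_type, Finset.sum_comm]
      refine Finset.sum_congr rfl fun i _ => Finset.sum_congr rfl fun v _ => ?_
      congr 2
      ext a
      simp [Fin.consEquiv, Fin.exists_fin_succ, eq_comm]
    have h1 : ∀ i : Fin p → V, ∑ v, t ^ (insert v (Finset.univ.image i)).card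
        ≤ t ^ (Finset.univ.image i).card * ((p + 1) * (Fintype.card V * t)) := by
      intro i
      set J := Finset.univ.image i with hJ
      have hc : (J.card : ℝ) ≤ p := by
        have := Finset.card_image_le (s := (Finset.univ : Finset (Fin p))) (f := i)
        simp only [Finset.card_univ, Fintype.card_fin] at this
        exact_mod_cast this
      calc ∑ v, t ^ (insert v J).card
          ≤ ∑ v, ((if v ∈ J then t ^ J.card else 0) + t ^ J.card * t) := by
            refine Finset.sum_le_sum fun v _ => ?_
            by_cases hv : v ∈ J
            · simp only [hv, if_true, Finset.insert_eq_of_mem]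
              linarith [mul_nonneg (pow_nonneg ht J.card) ht]
            · simp [hv, Finset.card_insert_of_notMem, pow_succ]
        _ = t ^ J.card * (J.card + Fintype.card V * t) := by
            rw [Finset.sum_add_distrib, ← Finset.sum_filter]
            simp
            ring
        _ ≤ _ := by
            refine mul_le_mul_of_nonneg_left ?_ (pow_nonneg ht _)
            nlinarith [Nat.cast_nonneg (α := ℝ) p]
    rw [e]
    refine (Finset.sum_le_sum fun i _ => h1 i).trans ?_
    rw [← Finset.sum_mul]
    calc _ ≤ (p.factorial * (Fintype.card V * t) ^ p) * ((p + 1) * (Fintype.card V * t)) :=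
          mul_le_mul_of_nonneg_right ih (by positivity)
      _ = _ := by rw [Nat.factorial_succ]; push_cast; ring

/-- The core of fluctuation averaging. There are at most `2^p` choices of each `A s`, and every
surviving choice has size at most `p K^p ψ^(2|I|)`; the sum over the tuples is then
`sum_pow_card_image_le` with `t = ψ²`. The family `W` depends on the factor `s` so that some factors
can be complex conjugates. -/
lemma norm_integral_prod_sum_le [Fintype V] (hE : IsIncidence E) {p : ℕ} (hp : 0 < p)
    {W : Fin p → V → (ι → ℂ) → ℂ} (hW : ∀ s v, Tame (W s v))
    (h0 : ∀ s v x, avg μ (E {v}) (W s v) x = 0) {K ψ : ℝ} (hK : 0 < K) (hψ : 0 < ψ) (hψ1 : ψ ≤ 1)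
    (hV : 1 ≤ Fintype.card V * ψ ^ 2)
    (h : ∀ s v (A : Finset V), A.card ≤ p →
      ∫ x, ‖fluctPart μ E A (W s v) x‖ ^ p ∂μ ≤ (K * ψ ^ A.card) ^ p) :
    ‖∫ x, ∏ s, ∑ v, W s v x ∂μ‖
      ≤ (p * ((2 ^ p) ^ p * p.factorial) : ℕ) * (K * (Fintype.card V * ψ ^ 2)) ^ p := by
  have : Nonempty (Fin p) := ⟨⟨0, hp⟩⟩
  have hcI : ∀ i : Fin p → V, (Finset.univ.image i).card ≤ p := fun i => by
    simpa using Finset.card_image_le (s := (Finset.univ : Finset (Fin p))) (f := i)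
  have key : ∀ i : Fin p → V, ‖∫ x, ∏ s, W s (i s) x ∂μ‖
      ≤ (p * (2 ^ p) ^ p : ℕ) * K ^ p * (ψ ^ 2) ^ (Finset.univ.image i).card := by
    intro i
    set I := Finset.univ.image i with hI
    have hiI : ∀ s, i s ∈ I := fun s => Finset.mem_image_of_mem i (Finset.mem_univ s)
    have hT : ∀ (A : Fin p → Finset V) s,
        Tame (avg μ (E (I \ A s)) (fluctPart μ E (A s) (W s (i s)))) := fun A s =>
      ((hW s (i s)).fluctPart _).avg _
    have e : ∫ x, ∏ s, W s (i s) x ∂μ = ∑ A ∈ Fintype.piFinset fun _ : Fin p => I.powerset,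
        ∫ x, ∏ s, avg μ (E (I \ A s)) (fluctPart μ E (A s) (W s (i s))) x ∂μ := by
      rw [← integral_finsetSum _ fun A _ => (Tame.prod _ fun s _ => hT A s).integrable]
      refine integral_congr_ae (Filter.Eventually.of_forall fun x => ?_)
      simp only
      rw [← Finset.prod_univ_sum (t := fun _ => I.powerset)
        (f := fun s B => avg μ (E (I \ B)) (fluctPart μ E B (W s (i s))) x)]
      exact Finset.prod_congr rfl fun s _ => (sum_avg_fluctPart hE (hW s (i s)) I x).symm
    have hterm : ∀ A ∈ Fintype.piFinset fun _ : Fin p => I.powerset,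
        ‖∫ x, ∏ s, avg μ (E (I \ A s)) (fluctPart μ E (A s) (W s (i s))) x ∂μ‖
          ≤ K ^ p * (ψ ^ 2) ^ I.card * p := by
      intro A hA
      have hAI : ∀ s, A s ⊆ I := fun s => Finset.mem_powerset.1 (Fintype.mem_piFinset.1 hA s)
      have hnn : 0 ≤ K ^ p * (ψ ^ 2) ^ I.card * p := by positivity
      -- Three cases. If some `i s ∉ A s`, that factor is averaged over its own vertex and vanishes
      -- by `h0`; if some vertex is in only one `A s`, the expectation vanishes; otherwise `∑ |A s|
      -- ≥ 2 |I|` and Hölder's inequality applies.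
      by_cases hmem : ∀ s, i s ∈ A s
      · by_cases h2 : ∀ v ∈ I, ∃ s t, s ≠ t ∧ v ∈ A s ∧ v ∈ A t
        · have h3 := norm_integral_prod_le (μ := μ) (hT A) (c := fun s => K * ψ ^ (A s).card)
            (fun s => by positivity) fun s => by
              rw [Fintype.card_fin]
              exact (integral_norm_avg_pow_le ((hW s (i s)).fluctPart _) _ p).trans
                (h s (i s) (A s) ((Finset.card_le_card (hAI s)).trans (hcI i)))
          refine h3.trans ?_
          rw [Fintype.card_fin]
          refine mul_le_mul_of_nonneg_right ?_ (by positivity)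
          rw [Finset.prod_mul_distrib, Finset.prod_const, Finset.card_univ, Fintype.card_fin,
            Finset.prod_pow_eq_pow_sum, ← pow_mul]
          exact mul_le_mul_of_nonneg_left
            (pow_le_pow_of_le_one hψ.le hψ1 (two_mul_card_le_sum_card h2)) (by positivity)
        · push Not at h2
          obtain ⟨v, hv, h2⟩ := h2
          obtain ⟨s, -, hs⟩ := Finset.mem_image.1 hv
          have hs' : v ∈ A s := hs ▸ hmem s
          rw [integral_prod_avg_fluctPart_eq_zero hE (fun s => hW s (i s)) hv hs'
            fun t ht => h2 s t ht.symm hs', norm_zero]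
          exact hnn
      · push Not at hmem
        obtain ⟨s, hs⟩ := hmem
        have hz : ∀ x, avg μ (E (I \ A s)) (fluctPart μ E (A s) (W s (i s))) x = 0 := by
          intro x
          rw [avg_fluctPart hE (hW s (i s))]
          refine Finset.sum_eq_zero fun B _ => ?_
          rw [avg_of_avg_eq_zero hE (hW s (i s)) (h0 s (i s)) (by simp [hiI s, hs]), mul_zero]
        have : ∀ x, ∏ s, avg μ (E (I \ A s)) (fluctPart μ E (A s) (W s (i s))) x = 0 := fun x =>
          Finset.prod_eq_zero (Finset.mem_univ s) (hz x)
        simp only [this, integral_zero, norm_zero]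
        exact hnn
    rw [e]
    refine (norm_sum_le _ _).trans ((Finset.sum_le_sum hterm).trans ?_)
    rw [Finset.sum_const, Fintype.card_piFinset, nsmul_eq_mul]
    simp only [Finset.card_powerset, Finset.prod_const, Finset.card_univ, Fintype.card_fin]
    have : ((2 ^ I.card : ℕ) : ℝ) ^ p ≤ (2 ^ p) ^ p := by
      push_cast
      gcongr
      · norm_num
      · exact hcI i
    push_cast at this ⊢
    calc _ ≤ ((2 : ℝ) ^ p) ^ p * (K ^ p * (ψ ^ 2) ^ I.card * p) :=
          mul_le_mul_of_nonneg_right this (by positivity)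
      _ = _ := by ring
  have e : ∫ x, ∏ s, ∑ v, W s v x ∂μ = ∑ i : Fin p → V, ∫ x, ∏ s, W s (i s) x ∂μ := by
    rw [← integral_finsetSum _ fun i _ => (Tame.prod _ fun s _ => hW s (i s)).integrable]
    refine integral_congr_ae (Filter.Eventually.of_forall fun x => ?_)
    simp only
    rw [Finset.prod_univ_sum, Fintype.piFinset_univ]
  rw [e]
  refine (norm_sum_le _ _).trans ((Finset.sum_le_sum fun i _ => key i).trans ?_)
  rw [← Finset.mul_sum]
  refine (mul_le_mul_of_nonneg_left (sum_pow_card_image_le (by positivity) hV p)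
    (by positivity)).trans (le_of_eq ?_)
  push_cast
  ring

lemma avg_conj (S : Finset ι) (F : (ι → ℂ) → ℂ) (x : ι → ℂ) :
    avg μ S (fun x => (starRingEnd ℂ) (F x)) x = (starRingEnd ℂ) (avg μ S F x) :=
  integral_conj

lemma fluctPart_conj (A : Finset V) (F : (ι → ℂ) → ℂ) (x : ι → ℂ) :
    fluctPart μ E A (fun x => (starRingEnd ℂ) (F x)) x
      = (starRingEnd ℂ) (fluctPart μ E A F x) := by
  simp [fluctPart, avg_conj]

/-- Fluctuation averaging for functions whose partial fluctuations in a set `A` of vertices are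
of order `ψ ^ |A|`. -/
theorem integral_norm_average_pow_le [Fintype V] (hE : IsIncidence E) {p : ℕ} (hp : 0 < p)
    (hpe : Even p) {Y : V → (ι → ℂ) → ℂ} (hY : ∀ v, Tame (Y v))
    (h0 : ∀ v x, avg μ (E {v}) (Y v) x = 0) {K ψ : ℝ} (hK : 0 < K) (hψ : 0 < ψ) (hψ1 : ψ ≤ 1)
    (hV : 1 ≤ Fintype.card V * ψ ^ 2)
    (h : ∀ v (A : Finset V), A.card ≤ p →
      ∫ x, ‖fluctPart μ E A (Y v) x‖ ^ p ∂μ ≤ (K * ψ ^ A.card) ^ p) :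
    ∫ x, ‖∑ v, Y v x‖ ^ p ∂μ
      ≤ (p * ((2 ^ p) ^ p * p.factorial) : ℕ) * (K * (Fintype.card V * ψ ^ 2)) ^ p := by
  obtain ⟨r, hr⟩ := hpe
  set W : Fin p → V → (ι → ℂ) → ℂ := fun s v x =>
    if (s : ℕ) < r then Y v x else (starRingEnd ℂ) (Y v x) with hWdef
  have hcases : ∀ s v, W s v = Y v ∨ W s v = fun x => (starRingEnd ℂ) (Y v x) := fun s v => by
    by_cases hs : (s : ℕ) < r
    · left; ext x; simp [hWdef, hs]
    · right; ext x; simp [hWdef, hs]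
  have hmain := norm_integral_prod_sum_le (μ := μ) hE hp (W := W) (fun s v => by
    rcases hcases s v with h | h <;> rw [h]
    exacts [hY v, (hY v).conj]) (fun s v x => by
    rcases hcases s v with h | h <;> rw [h]
    · exact h0 v x
    · rw [avg_conj, h0, map_zero]) hK hψ hψ1 hV (fun s v A hA => by
    rcases hcases s v with h' | h' <;> rw [h']
    · exact h v A hA
    · simp only [fluctPart_conj, RCLike.norm_conj]
      exact h v A hA)
  have e : ∀ x, ∏ s, ∑ v, W s v x = ((‖∑ v, Y v x‖ ^ p : ℝ) : ℂ) := by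
    intro x
    have h1 : ∀ s : Fin p, ∑ v, W s v x = if (s : ℕ) < r then ∑ v, Y v x
        else (starRingEnd ℂ) (∑ v, Y v x) := fun s => by
      by_cases hs : (s : ℕ) < r <;> simp [hWdef, hs]
    simp only [h1]
    rw [Fin.prod_univ_eq_prod_range
      (fun s => if s < r then ∑ v, Y v x else (starRingEnd ℂ) (∑ v, Y v x)) p, hr,
      Finset.prod_range_add]
    rw [Finset.prod_congr rfl fun s hs => if_pos (Finset.mem_range.1 hs)]
    simp only [Nat.not_lt.2 (Nat.le_add_right r _), if_false, Finset.prod_const,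
      Finset.card_range]
    rw [← mul_pow, Complex.mul_conj, Complex.normSq_eq_norm_sq]
    push_cast
    ring
  simp only [e, integral_complex_ofReal] at hmain
  rw [Complex.norm_real, Real.norm_of_nonneg (integral_nonneg fun x => by positivity)] at hmain
  exact hmain

end FluctuationAveraging

/-! ### Moments and conditional tails of linear and quadratic forms -/

section MomentInequalities

/-- The part of `(q + c)^n` odd in `c` dominates its linear term. The bound on the even part is
carried along because the two parts satisfy a coupled recursion. -/
lemma two_mul_mul_pow_le_sub {q c : ℝ} (hc : 0 ≤ c) (hq : c ≤ q) (n : ℕ) :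
    2 * n * c * q ^ (n - 1) ≤ (q + c) ^ n - (q - c) ^ n ∧
      2 * q ^ n ≤ (q + c) ^ n + (q - c) ^ n := by
  have hq0 : 0 ≤ q := hc.trans hq
  induction n with
  | zero => simp; norm_num
  | succ n ih =>
    obtain ⟨h1, h2⟩ := ih
    have h3 : 0 ≤ (q + c) ^ n - (q - c) ^ n :=
      le_trans (by positivity) h1
    have e1 : (q + c) ^ (n + 1) - (q - c) ^ (n + 1)
        = q * ((q + c) ^ n - (q - c) ^ n) + c * ((q + c) ^ n + (q - c) ^ n) := by ring
    have e2 : (q + c) ^ (n + 1) + (q - c) ^ (n + 1)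
        = q * ((q + c) ^ n + (q - c) ^ n) + c * ((q + c) ^ n - (q - c) ^ n) := by ring
    rw [e1, e2]
    constructor
    · have h4 : 2 * n * c * q ^ n ≤ q * ((q + c) ^ n - (q - c) ^ n) := by
        cases n with
        | zero => simp
        | succ m =>
          calc _ = q * (2 * ((m + 1 : ℕ) : ℝ) * c * q ^ (m + 1 - 1)) := by
                rw [Nat.add_sub_cancel]; ring
            _ ≤ _ := mul_le_mul_of_nonneg_left h1 hq0
      have h5 := mul_le_mul_of_nonneg_left h2 hc
      push_cast
      nlinarith
    · have h5 := mul_le_mul_of_nonneg_left h2 hq0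
      have h6 := mul_nonneg hc h3
      rw [pow_succ]
      nlinarith

/-- With `a = ‖s‖`, `b = ‖x‖` and `r` the real part of the scalar product, `‖s + x‖²` and `(a + b)²`
lie symmetrically around `q = a² + b² + ab + r`, at distance `ab - r`. As `q ≥ a²`, the previous
inequality compares their `n`-th powers. The point is to isolate the term linear in `x`, whose mean
will vanish. -/
lemma norm_add_pow_le (s x : ℂ) (n : ℕ) :
    ‖s + x‖ ^ (2 * n) ≤ ((‖s‖ + ‖x‖) ^ (2 * n) - 2 * n * (‖s‖ ^ (2 * n - 1) * ‖x‖))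
      + 2 * n * (‖s‖ ^ (2 * n - 2) * ((starRingEnd ℂ) s * x).re) := by
  rcases Nat.eq_zero_or_pos n with rfl | hn
  · simp
  set r := ((starRingEnd ℂ) s * x).re with hr
  set a := ‖s‖ with ha
  set b := ‖x‖ with hb
  have ha0 : 0 ≤ a := norm_nonneg _
  have hb0 : 0 ≤ b := norm_nonneg _
  have hrab : |r| ≤ a * b := by
    have := Complex.abs_re_le_norm ((starRingEnd ℂ) s * x)
    simpa [ha, hb, hr] using this
  obtain ⟨hr1, hr2⟩ := abs_le.1 hrab
  have hsq : ‖s + x‖ ^ 2 = a ^ 2 + b ^ 2 + 2 * r := by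
    rw [ha, hb, hr, ← Complex.normSq_eq_norm_sq, ← Complex.normSq_eq_norm_sq,
      ← Complex.normSq_eq_norm_sq]
    simp [Complex.normSq_apply]
    ring
  have h := (two_mul_mul_pow_le_sub (q := a ^ 2 + b ^ 2 + a * b + r) (c := a * b - r)
    (by linarith) (by nlinarith) n).1
  have e1 : a ^ 2 + b ^ 2 + a * b + r + (a * b - r) = (a + b) ^ 2 := by ring
  have e2 : a ^ 2 + b ^ 2 + a * b + r - (a * b - r) = ‖s + x‖ ^ 2 := by rw [hsq]; ring
  rw [e1, e2, ← pow_mul, ← pow_mul] at h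
  have h2 : a ^ (2 * n - 2) ≤ (a ^ 2 + b ^ 2 + a * b + r) ^ (n - 1) := by
    have : 2 * n - 2 = 2 * (n - 1) := by omega
    rw [this, pow_mul]
    exact pow_le_pow_left₀ (by positivity) (by nlinarith) _
  have h3 : a ^ (2 * n - 1) = a ^ (2 * n - 2) * a := by
    rw [← pow_succ]; congr 1; omega
  rw [h3]
  have h4 := mul_le_mul_of_nonneg_left h2
    (show 0 ≤ 2 * (n : ℝ) * (a * b - r) from mul_nonneg (by positivity) (by linarith))
  nlinarith

/-- For `2nt ≤ 1` the left side is at most `1 + (2nt)²` by the exponential bound, and Bernoulli's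
inequality suffices. For `2nt > 1` the linear term is itself quadratic, `t ≤ 2nt²`, and already `(1
+ t)² ≤ 1 + 16n²t²`. -/
lemma one_add_pow_sub_le {t : ℝ} (ht : 0 ≤ t) {n : ℕ} (hn : 1 ≤ n) :
    (1 + t) ^ (2 * n) - 2 * n * t ≤ (1 + 16 * n ^ 2 * t ^ 2) ^ n := by
  have hn' : (1 : ℝ) ≤ n := by exact_mod_cast hn
  by_cases h : 2 * n * t ≤ 1
  · have h1 : (1 + t) ^ (2 * n) ≤ Real.exp (2 * n * t) := by
      have := pow_le_pow_left₀ (by positivity) (Real.add_one_le_exp t) (2 * n)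
      rw [← Real.exp_nat_mul] at this
      push_cast at this
      rwa [add_comm t 1] at this
    have h2 := Real.abs_exp_sub_one_sub_id_le (x := 2 * n * t)
      (by rw [abs_of_nonneg (by positivity)]; exact h)
    have h3 := (abs_le.1 h2).2
    have h4 := one_add_mul_le_pow (a := 16 * (n : ℝ) ^ 2 * t ^ 2)
      (by have : 0 ≤ 16 * (n : ℝ) ^ 2 * t ^ 2 := by positivity
          linarith) n
    have h5 : 0 ≤ (n : ℝ) ^ 2 * t ^ 2 := by positivity
    nlinarith
  · push Not at h
    rw [pow_mul]
    have h1 : (1 + t) ^ 2 ≤ 1 + 16 * n ^ 2 * t ^ 2 := by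
      have h2 : t ≤ 2 * n * t * t := by nlinarith
      have h3 : n * t ^ 2 ≤ (n : ℝ) ^ 2 * t ^ 2 := by nlinarith [sq_nonneg t]
      have h4 : t ^ 2 ≤ n * t ^ 2 := by nlinarith [sq_nonneg t]
      nlinarith
    have := pow_le_pow_left₀ (by positivity) h1 n
    have h5 : 0 ≤ 2 * n * t := by positivity
    linarith

lemma add_pow_sub_le {α β : ℝ} (hα : 0 < α) (hβ : 0 ≤ β) {n : ℕ} (hn : 1 ≤ n) :
    (α + β) ^ (2 * n) - 2 * n * (α ^ (2 * n - 1) * β) ≤ (α ^ 2 + 16 * n ^ 2 * β ^ 2) ^ n := by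
  have h := one_add_pow_sub_le (t := β / α) (by positivity) hn
  have h1 := mul_le_mul_of_nonneg_left h (pow_nonneg hα.le (2 * n))
  have e1 : α ^ (2 * n) * (1 + β / α) ^ (2 * n) = (α + β) ^ (2 * n) := by
    rw [← mul_pow]; congr 1; field_simp
  have e2 : α ^ (2 * n) * (1 + 16 * n ^ 2 * (β / α) ^ 2) ^ n
      = (α ^ 2 + 16 * n ^ 2 * β ^ 2) ^ n := by
    rw [pow_mul, ← mul_pow]; congr 1; field_simp
  have e3 : α ^ (2 * n) * (2 * n * (β / α)) = 2 * n * (α ^ (2 * n - 1) * β) := by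
    have : α ^ (2 * n) = α ^ (2 * n - 1) * α := by rw [← pow_succ]; congr 1; omega
    rw [this]; field_simp
  rw [mul_sub, e1, e2, e3] at h1
  exact h1

lemma pow_mul_pow_le_weighted {t u : ℝ} (ht : 0 ≤ t) (hu : 0 ≤ u) {k N : ℕ} (hk : k ≤ N)
    (hN : 0 < N) :
    t ^ (N - k) * u ^ k ≤ ((N - k : ℕ) / N : ℝ) * t ^ N + (k / N : ℝ) * u ^ N := by
  have hN' : (0 : ℝ) < N := by exact_mod_cast hN
  have h := Real.geom_mean_le_arith_mean2_weighted (w₁ := ((N - k : ℕ) / N : ℝ))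
    (w₂ := (k / N : ℝ)) (p₁ := t ^ N) (p₂ := u ^ N) (by positivity) (by positivity)
    (by positivity) (by positivity) (by rw [Nat.cast_sub hk]; field_simp; ring)
  refine le_trans (le_of_eq ?_) h
  rw [← Real.rpow_natCast t N, ← Real.rpow_natCast u N, ← Real.rpow_mul ht, ← Real.rpow_mul hu,
    mul_div_cancel₀ _ hN'.ne', mul_div_cancel₀ _ hN'.ne', Real.rpow_natCast, Real.rpow_natCast]

variable {ι : Type*} [Fintype ι] [DecidableEq ι]
variable {μ : Measure (ι → ℂ)} [IsProbabilityMeasure μ] [ResamplingMeasure μ]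

/-- Hölder's inequality for mixed moments, obtained from Young's inequality for the normalised
variables. -/
lemma integral_mixed_moment_le {S X : (ι → ℂ) → ℂ} (hS : Tame S) (hX : Tame X) {N k : ℕ}
    (hk : k ≤ N) (hN : 0 < N) {α β : ℝ} (hα : 0 < α) (hβ : 0 < β)
    (h1 : ∫ x, ‖S x‖ ^ N ∂μ ≤ α ^ N) (h2 : ∫ x, ‖X x‖ ^ N ∂μ ≤ β ^ N) :
    ∫ x, ‖S x‖ ^ (N - k) * ‖X x‖ ^ k ∂μ ≤ α ^ (N - k) * β ^ k := by
  have hN' : (0 : ℝ) < N := by exact_mod_cast hN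
  have i1 := (hS.integrable_norm_pow (μ := μ) N).div_const (α ^ N)
  have i2 := (hX.integrable_norm_pow (μ := μ) N).div_const (β ^ N)
  calc ∫ x, ‖S x‖ ^ (N - k) * ‖X x‖ ^ k ∂μ
      ≤ ∫ x, α ^ (N - k) * β ^ k * (((N - k : ℕ) / N : ℝ) * (‖S x‖ ^ N / α ^ N)
          + (k / N : ℝ) * (‖X x‖ ^ N / β ^ N)) ∂μ := by
        refine integral_mono_of_nonneg (Filter.Eventually.of_forall fun x => by positivity)
          (((i1.const_mul _).add (i2.const_mul _)).const_mul _)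
          (Filter.Eventually.of_forall fun x => ?_)
        have h := pow_mul_pow_le_weighted (t := ‖S x‖ / α) (u := ‖X x‖ / β) (by positivity)
          (by positivity) hk hN
        have h' := mul_le_mul_of_nonneg_left h
          (show 0 ≤ α ^ (N - k) * β ^ k by positivity)
        simp only [div_pow] at h'
        refine le_trans (le_of_eq ?_) h'
        field_simp
    _ = α ^ (N - k) * β ^ k * (((N - k : ℕ) / N : ℝ) * ((∫ x, ‖S x‖ ^ N ∂μ) / α ^ N)
          + (k / N : ℝ) * ((∫ x, ‖X x‖ ^ N ∂μ) / β ^ N)) := by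
        rw [integral_const_mul, integral_add (i1.const_mul _) (i2.const_mul _),
          integral_const_mul, integral_const_mul, integral_div, integral_div]
    _ ≤ α ^ (N - k) * β ^ k * (((N - k : ℕ) / N : ℝ) * 1 + (k / N : ℝ) * 1) := by
        gcongr
        · exact (div_le_one (by positivity)).2 h1
        · exact (div_le_one (by positivity)).2 h2
    _ = _ := by rw [Nat.cast_sub hk]; field_simp; ring

/-- Without its linear term the binomial expansion still has nonnegative coefficients, so bounds on
mixed moments can be inserted term by term. -/
lemma add_pow_eq_sum_add (a b : ℝ) {N : ℕ} (hN : 1 ≤ N) :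
    (a + b) ^ N - N * (a ^ (N - 1) * b)
      = ∑ k ∈ (Finset.range (N + 1)).erase 1, N.choose k * (a ^ (N - k) * b ^ k) := by
  rw [add_comm a b, add_pow]
  rw [← Finset.add_sum_erase _ _ (show 1 ∈ Finset.range (N + 1) by simp; omega)]
  rw [Nat.choose_one_right]
  have : ∀ k, b ^ k * a ^ (N - k) * (N.choose k : ℝ) = N.choose k * (a ^ (N - k) * b ^ k) :=
    fun k => by ring
  simp only [this]
  ring

/-- The linear term integrates to zero by `hlin`. The other binomial terms are bounded by mixed
moments and resummed into `(α + β)^(2n)` without its linear term. -/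
lemma integral_norm_add_pow_le_of_pos {S X : (ι → ℂ) → ℂ} (hS : Tame S) (hX : Tame X) {n : ℕ}
    (hn : 1 ≤ n) {α β : ℝ} (hα : 0 < α) (hβ : 0 < β)
    (h1 : ∫ x, ‖S x‖ ^ (2 * n) ∂μ ≤ α ^ (2 * n)) (h2 : ∫ x, ‖X x‖ ^ (2 * n) ∂μ ≤ β ^ (2 * n))
    (hlin : ∫ x, ((‖S x‖ : ℝ) : ℂ) ^ (2 * n - 2) * ((starRingEnd ℂ) (S x) * X x) ∂μ = 0) :
    ∫ x, ‖S x + X x‖ ^ (2 * n) ∂μ ≤ (α ^ 2 + 16 * n ^ 2 * β ^ 2) ^ n := by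
  have ht := (hS.ofReal_norm.pow (2 * n - 2)).mul (hS.conj.mul hX)
  have hre : ∀ x, (((‖S x‖ : ℝ) : ℂ) ^ (2 * n - 2) * ((starRingEnd ℂ) (S x) * X x)).re
      = ‖S x‖ ^ (2 * n - 2) * ((starRingEnd ℂ) (S x) * X x).re := fun x => by
    rw [← Complex.ofReal_pow, Complex.re_ofReal_mul]
  have i1 : Integrable (fun x => ‖S x‖ ^ (2 * n - 2) * ((starRingEnd ℂ) (S x) * X x).re) μ := by
    have := (ht.integrable (μ := μ)).re
    simpa only [RCLike.re_to_complex, hre] using this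
  have hlin' : ∫ x, ‖S x‖ ^ (2 * n - 2) * ((starRingEnd ℂ) (S x) * X x).re ∂μ = 0 := by
    have := integral_re (ht.integrable (μ := μ))
    simp only [RCLike.re_to_complex, hre, hlin] at this
    simpa using this
  have i2 : ∀ k, Integrable (fun x => ‖S x‖ ^ (2 * n - k) * ‖X x‖ ^ k) μ := fun k => by
    have := ((hS.pow (2 * n - k)).mul (hX.pow k)).integrable (μ := μ) |>.norm
    simpa using this
  have i3 := integrable_finsetSum ((Finset.range (2 * n + 1)).erase 1) fun k _ =>
    (i2 k).const_mul ((2 * n).choose k : ℝ)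
  calc ∫ x, ‖S x + X x‖ ^ (2 * n) ∂μ
      ≤ ∫ x, ((∑ k ∈ (Finset.range (2 * n + 1)).erase 1,
          ((2 * n).choose k : ℝ) * (‖S x‖ ^ (2 * n - k) * ‖X x‖ ^ k))
          + 2 * n * (‖S x‖ ^ (2 * n - 2) * ((starRingEnd ℂ) (S x) * X x).re)) ∂μ := by
        refine integral_mono ((hS.add hX).integrable_norm_pow _) (i3.add (i1.const_mul _))
          fun x => ?_
        simp only
        rw [← add_pow_eq_sum_add _ _ (by omega)]
        have := norm_add_pow_le (S x) (X x) n
        push_cast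
        exact this
    _ = ∑ k ∈ (Finset.range (2 * n + 1)).erase 1,
          ((2 * n).choose k : ℝ) * ∫ x, ‖S x‖ ^ (2 * n - k) * ‖X x‖ ^ k ∂μ := by
        rw [integral_add i3 (i1.const_mul _), integral_const_mul, hlin', mul_zero, add_zero,
          integral_finsetSum _ fun k _ => (i2 k).const_mul _]
        simp only [integral_const_mul]
    _ ≤ ∑ k ∈ (Finset.range (2 * n + 1)).erase 1,
          ((2 * n).choose k : ℝ) * (α ^ (2 * n - k) * β ^ k) := by
        refine Finset.sum_le_sum fun k hk => mul_le_mul_of_nonneg_left ?_ (by positivity)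
        have hk' : k ≤ 2 * n := by
          have := (Finset.mem_erase.1 hk).2
          rw [Finset.mem_range] at this
          omega
        exact integral_mixed_moment_le hS hX hk' (by omega) hα hβ h1 h2
    _ ≤ _ := by
        rw [← add_pow_eq_sum_add _ _ (by omega)]
        push_cast
        exact add_pow_sub_le hα hβ.le hn

/-- The 2-smoothness of `L^{2n}`: adding a fluctuation that is conditionally centred increases the
square of the norm at most by a multiple of the square of the norm of the fluctuation. -/
lemma integral_norm_add_pow_le {S X : (ι → ℂ) → ℂ} (hS : Tame S) (hX : Tame X) {n : ℕ}
    (hn : 1 ≤ n) {A B : ℝ} (hA : 0 ≤ A) (hB : 0 ≤ B)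
    (h1 : ∫ x, ‖S x‖ ^ (2 * n) ∂μ ≤ A ^ n) (h2 : ∫ x, ‖X x‖ ^ (2 * n) ∂μ ≤ B ^ n)
    (hlin : ∫ x, ((‖S x‖ : ℝ) : ℂ) ^ (2 * n - 2) * ((starRingEnd ℂ) (S x) * X x) ∂μ = 0) :
    ∫ x, ‖S x + X x‖ ^ (2 * n) ∂μ ≤ (A + 16 * n ^ 2 * B) ^ n := by
  -- The preceding bound divides by the norms, so it is applied with `A + ε` and `B + ε` to cover
  -- vanishing moments.
  have hlim : Filter.Tendsto (fun ε : ℝ => (A + ε + 16 * n ^ 2 * (B + ε)) ^ n)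
      (nhdsWithin 0 (Set.Ioi 0)) (nhds ((A + 16 * n ^ 2 * B) ^ n)) := by
    have : Continuous fun ε : ℝ => (A + ε + 16 * (n : ℝ) ^ 2 * (B + ε)) ^ n := by fun_prop
    have h := this.tendsto 0
    simp only [add_zero] at h
    exact h.mono_left nhdsWithin_le_nhds
  refine ge_of_tendsto hlim ?_
  filter_upwards [self_mem_nhdsWithin] with ε hε
  have hε : 0 < ε := hε
  have h := integral_norm_add_pow_le_of_pos hS hX hn (α := √(A + ε)) (β := √(B + ε))
    (by positivity) (by positivity)
    (h1.trans (by rw [pow_mul, Real.sq_sqrt (by positivity)]; gcongr; linarith))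
    (h2.trans (by rw [pow_mul, Real.sq_sqrt (by positivity)]; gcongr; linarith)) hlin
  rwa [Real.sq_sqrt (by positivity), Real.sq_sqrt (by positivity)] at h

lemma dependsOn_const_mul {F : (ι → ℂ) → ℂ} {U : Set ι} (hF : DependsOn F U) (c : ℂ) :
    DependsOn (fun x => c * F x) U := fun _ _ h => by simp only [hF h]

lemma dependsOn_finset_sum {κ : Type*} (s : Finset κ) {F : κ → (ι → ℂ) → ℂ} {U : Set ι}
    (h : ∀ k ∈ s, DependsOn (F k) U) : DependsOn (fun x => ∑ k ∈ s, F k x) U :=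
  fun _ _ hxy => Finset.sum_congr rfl fun k hk => h k hk hxy

lemma dependsOn_compl_of_ne {κ : Type*} {ξ : κ → (ι → ℂ) → ℂ} {e : κ → ι}
    (he : Function.Injective e) (hd : ∀ k, DependsOn (ξ k) {e k}) {a k : κ} (h : k ≠ a) :
    DependsOn (ξ k) (({e a} : Finset ι) : Set ι)ᶜ :=
  fun x y hxy => hd k fun i hi => hxy i (by
    rw [Set.mem_singleton_iff] at hi
    subst hi
    simpa using fun h' => h (he h'))

variable {κ : Type*} [DecidableEq κ]

/-- Moments of linear forms in independent centred variables. -/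
lemma integral_norm_linear_pow_le {ξ : κ → (ι → ℂ) → ℂ} (hξ : ∀ k, Tame (ξ k)) {e : κ → ι}
    (he : Function.Injective e) (hd : ∀ k, DependsOn (ξ k) {e k}) {n : ℕ} (hn : 1 ≤ n)
    {b : ℝ} (hb : 0 ≤ b) {v : κ → ℝ} (hv : ∀ k, 0 ≤ v k) (s : Finset κ)
    (h0 : ∀ k ∈ s, ∫ x, ξ k x ∂μ = 0)
    (hm : ∀ k ∈ s, ∫ x, ‖ξ k x‖ ^ (2 * n) ∂μ ≤ (b * v k) ^ n) (c : κ → ℂ) :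
    ∫ x, ‖∑ k ∈ s, c k * ξ k x‖ ^ (2 * n) ∂μ
      ≤ (16 * n ^ 2 * b * ∑ k ∈ s, ‖c k‖ ^ 2 * v k) ^ n := by
  induction s using Finset.induction_on with
  | empty => simp [show n ≠ 0 by omega]
  | insert a s ha ih =>
    have ih := ih (fun k hk => h0 k (by simp [hk])) fun k hk => hm k (by simp [hk])
    have hS : Tame fun x => ∑ k ∈ s, c k * ξ k x := Tame.sum _ fun k _ => (hξ k).const_mul _
    have hdS : DependsOn (fun x => ∑ k ∈ s, c k * ξ k x) (({e a} : Finset ι) : Set ι)ᶜ :=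
      dependsOn_finset_sum _ fun k hk => dependsOn_const_mul
        (dependsOn_compl_of_ne he hd (show k ≠ a from fun h => ha (h ▸ hk))) _
    have h := integral_norm_add_pow_le (μ := μ) hS ((hξ a).const_mul (c a)) hn
      (A := 16 * n ^ 2 * b * ∑ k ∈ s, ‖c k‖ ^ 2 * v k) (B := b * (‖c a‖ ^ 2 * v a))
      (by have := Finset.sum_nonneg fun k (_ : k ∈ s) => mul_nonneg (sq_nonneg ‖c k‖) (hv k)
          positivity)
      (by have := hv a; positivity) ih
      (by
        simp only [norm_mul, mul_pow, integral_const_mul]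
        calc ‖c a‖ ^ (2 * n) * ∫ x, ‖ξ a x‖ ^ (2 * n) ∂μ
            ≤ ‖c a‖ ^ (2 * n) * (b * v a) ^ n :=
              mul_le_mul_of_nonneg_left (hm a (by simp)) (by positivity)
          _ = _ := by rw [pow_mul]; ring)
      (by
        have := integral_mul_of_dependsOn (μ := μ) (hξ a)
          (((hS.ofReal_norm.pow (2 * n - 2)).mul hS.conj).const_mul (c a)) (S := {e a})
          (by simpa using hd a) (fun x y hxy => by simp only [hdS hxy])
        rw [h0 a (by simp), zero_mul] at this
        rw [← this]
        refine integral_congr_ae (Filter.Eventually.of_forall fun x => ?_)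
        simp only
        ring)
    simp only [Finset.sum_insert ha]
    convert h using 2
    · ext x; rw [add_comm]
    · ring

lemma norm_add_three_pow_le (x y z : ℂ) (n : ℕ) :
    ‖x + y + z‖ ^ (2 * n) ≤ 9 ^ n * (‖x‖ ^ (2 * n) + ‖y‖ ^ (2 * n) + ‖z‖ ^ (2 * n)) := by
  obtain ⟨m, hm, h1, h2, h3⟩ : ∃ m : ℝ, (m = ‖x‖ ∨ m = ‖y‖ ∨ m = ‖z‖) ∧ ‖x‖ ≤ m ∧ ‖y‖ ≤ m ∧
      ‖z‖ ≤ m := by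
    refine ⟨max (max ‖x‖ ‖y‖) ‖z‖, ?_, by simp, by simp, by simp⟩
    rcases max_choice (max ‖x‖ ‖y‖) ‖z‖ with h | h <;> rw [h]
    · rcases max_choice ‖x‖ ‖y‖ with h | h <;> rw [h] <;> simp
    · simp
  have h4 : ‖x + y + z‖ ≤ 3 * m := by
    have := norm_add₃_le (a := x) (b := y) (c := z)
    linarith
  have hx := pow_nonneg (norm_nonneg x) (2 * n)
  have hy := pow_nonneg (norm_nonneg y) (2 * n)
  have hz := pow_nonneg (norm_nonneg z) (2 * n)
  calc ‖x + y + z‖ ^ (2 * n) ≤ (3 * m) ^ (2 * n) := pow_le_pow_left₀ (norm_nonneg _) h4 _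
    _ = 9 ^ n * m ^ (2 * n) := by rw [mul_pow, pow_mul]; norm_num
    _ ≤ _ := by
        refine mul_le_mul_of_nonneg_left ?_ (by positivity)
        rcases hm with rfl | rfl | rfl <;> linarith

lemma integral_norm_add_three_pow_le {X Y Z : (ι → ℂ) → ℂ} (hX : Tame X) (hY : Tame Y)
    (hZ : Tame Z) {n : ℕ} (hn : 1 ≤ n) {A B C : ℝ} (hA : 0 ≤ A) (hB : 0 ≤ B) (hC : 0 ≤ C)
    (h1 : ∫ x, ‖X x‖ ^ (2 * n) ∂μ ≤ A ^ n) (h2 : ∫ x, ‖Y x‖ ^ (2 * n) ∂μ ≤ B ^ n)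
    (h3 : ∫ x, ‖Z x‖ ^ (2 * n) ∂μ ≤ C ^ n) :
    ∫ x, ‖X x + Y x + Z x‖ ^ (2 * n) ∂μ ≤ (9 * (A + B + C)) ^ n := by
  have i1 := hX.integrable_norm_pow (μ := μ) (2 * n)
  have i2 := hY.integrable_norm_pow (μ := μ) (2 * n)
  have i3 := hZ.integrable_norm_pow (μ := μ) (2 * n)
  calc ∫ x, ‖X x + Y x + Z x‖ ^ (2 * n) ∂μ
      ≤ ∫ x, 9 ^ n * (‖X x‖ ^ (2 * n) + ‖Y x‖ ^ (2 * n) + ‖Z x‖ ^ (2 * n)) ∂μ :=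
        integral_mono (((hX.add hY).add hZ).integrable_norm_pow _)
          (((i1.add i2).add i3).const_mul _) fun x => norm_add_three_pow_le _ _ _ n
    _ = 9 ^ n * ((∫ x, ‖X x‖ ^ (2 * n) ∂μ) + (∫ x, ‖Y x‖ ^ (2 * n) ∂μ)
          + ∫ x, ‖Z x‖ ^ (2 * n) ∂μ) := by
        have := integral_add (μ := μ) (i1.add i2) i3
        simp only [Pi.add_apply] at this
        rw [integral_const_mul, this, integral_add i1 i2]
    _ ≤ 9 ^ n * (A ^ n + B ^ n + C ^ n) := by gcongr
    _ ≤ _ := by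
        rw [mul_pow]
        refine mul_le_mul_of_nonneg_left ?_ (by positivity)
        have := pow_add_pow_le hA hB (show n ≠ 0 by omega)
        have := pow_add_pow_le (add_nonneg hA hB) hC (show n ≠ 0 by omega)
        linarith

/-- Moments of centred quadratic forms in independent centred variables. -/
lemma integral_norm_quadratic_pow_le {ξ : κ → (ι → ℂ) → ℂ} (hξ : ∀ k, Tame (ξ k)) {e : κ → ι}
    (he : Function.Injective e) (hd : ∀ k, DependsOn (ξ k) {e k}) {n : ℕ} (hn : 1 ≤ n)
    {b : ℝ} (hb : 1 ≤ b) {v : κ → ℝ} (hv : ∀ k, 0 ≤ v k) (s : Finset κ)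
    (h0 : ∀ k ∈ s, ∫ x, ξ k x ∂μ = 0) (hvar : ∀ k ∈ s, ∫ x, ‖ξ k x‖ ^ 2 ∂μ = v k)
    (hm : ∀ k ∈ s, ∫ x, ‖ξ k x‖ ^ (2 * n) ∂μ ≤ (b * v k) ^ n)
    (hm' : ∀ k ∈ s, ∫ x, ‖ξ k x‖ ^ (4 * n) ∂μ ≤ (b * v k) ^ (2 * n)) (c : κ → κ → ℂ) :
    ∫ x, ‖∑ k ∈ s, ∑ l ∈ s, c k l * ((starRingEnd ℂ) (ξ k x) * ξ l x) - ∑ k ∈ s, c k k * v k‖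
        ^ (2 * n) ∂μ
      ≤ (2304 * n ^ 4 * b ^ 2 * ∑ k ∈ s, ∑ l ∈ s, ‖c k l‖ ^ 2 * (v k * v l)) ^ n := by
  have hb0 : 0 ≤ b := zero_le_one.trans hb
  have hn' : (1 : ℝ) ≤ n := by exact_mod_cast hn
  induction s using Finset.induction_on with
  | empty => simp [show n ≠ 0 by omega]
  | insert a s ha ih =>
    have ih := ih (fun k hk => h0 k (by simp [hk])) (fun k hk => hvar k (by simp [hk]))
      (fun k hk => hm k (by simp [hk])) fun k hk => hm' k (by simp [hk])
    have hva := hv a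
    -- Adding the index `a` adds `conj ξ_a * P + ξ_a * R + c_aa * D`, where `P` and `R` are linear
    -- forms in the earlier variables and `D` is the centred square of `ξ_a`. Each term is centred
    -- given the earlier variables, so the increment is a martingale difference.
    set S : (ι → ℂ) → ℂ := fun x =>
      ∑ k ∈ s, ∑ l ∈ s, c k l * ((starRingEnd ℂ) (ξ k x) * ξ l x) - ∑ k ∈ s, c k k * v k with hSdef
    set P : (ι → ℂ) → ℂ := fun x => ∑ l ∈ s, c a l * ξ l x with hPdef
    set R : (ι → ℂ) → ℂ := fun x => ∑ k ∈ s, c k a * (starRingEnd ℂ) (ξ k x) with hRdef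
    have hcompl : ∀ k ∈ s, DependsOn (ξ k) (({e a} : Finset ι) : Set ι)ᶜ := fun k hk =>
      dependsOn_compl_of_ne he hd (show k ≠ a from fun h => ha (h ▸ hk))
    have hda : DependsOn (ξ a) (({e a} : Finset ι) : Set ι) := by simpa using hd a
    have hS : Tame S := (Tame.sum _ fun k _ => Tame.sum _ fun l _ =>
      ((hξ k).conj.mul (hξ l)).const_mul _).sub (Tame.const _)
    have hP : Tame P := Tame.sum _ fun k _ => (hξ k).const_mul _
    have hR : Tame R := Tame.sum _ fun k _ => (hξ k).conj.const_mul _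
    have hSd : DependsOn S (({e a} : Finset ι) : Set ι)ᶜ := fun x y hxy => by
      simp only [hSdef]
      congr 1
      exact Finset.sum_congr rfl fun k hk => Finset.sum_congr rfl fun l hl => by
        rw [hcompl k hk hxy, hcompl l hl hxy]
    have hPd : DependsOn P (({e a} : Finset ι) : Set ι)ᶜ := fun x y hxy =>
      Finset.sum_congr rfl fun k hk => by rw [hcompl k hk hxy]
    have hRd : DependsOn R (({e a} : Finset ι) : Set ι)ᶜ := fun x y hxy =>
      Finset.sum_congr rfl fun k hk => by rw [hcompl k hk hxy]
    set D : (ι → ℂ) → ℂ := fun x => (starRingEnd ℂ) (ξ a x) * ξ a x - v a with hDdef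
    have hD : Tame D := ((hξ a).conj.mul (hξ a)).sub (Tame.const _)
    have hD0 : ∫ x, D x ∂μ = 0 := by
      simp only [hDdef]
      rw [integral_sub ((hξ a).conj.mul (hξ a)).integrable (integrable_const _)]
      have : ∀ x, (starRingEnd ℂ) (ξ a x) * ξ a x = ((‖ξ a x‖ ^ 2 : ℝ) : ℂ) := fun x => by
        rw [mul_comm, Complex.mul_conj, Complex.normSq_eq_norm_sq]
      simp only [this, integral_complex_ofReal, hvar a (by simp)]
      simp
    have hconj0 : ∫ x, (starRingEnd ℂ) (ξ a x) ∂μ = 0 := by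
      rw [integral_conj, h0 a (by simp), map_zero]
    set TP := ∑ l ∈ s, ‖c a l‖ ^ 2 * v l with hTP
    set TR := ∑ k ∈ s, ‖c k a‖ ^ 2 * v k with hTR
    have hTP0 : 0 ≤ TP := Finset.sum_nonneg fun k _ => mul_nonneg (sq_nonneg _) (hv k)
    have hTR0 : 0 ≤ TR := Finset.sum_nonneg fun k _ => mul_nonneg (sq_nonneg _) (hv k)
    have hPm : ∫ x, ‖P x‖ ^ (2 * n) ∂μ ≤ (16 * n ^ 2 * b * TP) ^ n :=
      integral_norm_linear_pow_le hξ he hd hn hb0 hv s (fun k hk => h0 k (by simp [hk]))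
        (fun k hk => hm k (by simp [hk])) _
    have hRm : ∫ x, ‖R x‖ ^ (2 * n) ∂μ ≤ (16 * n ^ 2 * b * TR) ^ n := by
      have := integral_norm_linear_pow_le (μ := μ) hξ he hd hn hb0 hv s
        (fun k hk => h0 k (by simp [hk])) (fun k hk => hm k (by simp [hk]))
        fun k => (starRingEnd ℂ) (c k a)
      simp only [RCLike.norm_conj] at this
      refine le_trans (le_of_eq ?_) this
      refine integral_congr_ae (Filter.Eventually.of_forall fun x => ?_)
      simp only
      rw [← RCLike.norm_conj]
      simp [hRdef]
    have hX1 : ∫ x, ‖(starRingEnd ℂ) (ξ a x) * P x‖ ^ (2 * n) ∂μ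
        ≤ (16 * n ^ 2 * b ^ 2 * (v a * TP)) ^ n := by
      rw [integral_norm_mul_pow_of_dependsOn (hξ a).conj hP (S := {e a})
        (fun x y h => by simp only [hda h]) hPd]
      simp only [RCLike.norm_conj]
      calc _ ≤ (b * v a) ^ n * (16 * n ^ 2 * b * TP) ^ n :=
            mul_le_mul (hm a (by simp)) hPm (integral_nonneg fun x => by positivity) (by positivity)
        _ = _ := by rw [← mul_pow]; ring
    have hX2 : ∫ x, ‖ξ a x * R x‖ ^ (2 * n) ∂μ ≤ (16 * n ^ 2 * b ^ 2 * (v a * TR)) ^ n := by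
      rw [integral_norm_mul_pow_of_dependsOn (hξ a) hR (S := {e a}) hda hRd]
      calc _ ≤ (b * v a) ^ n * (16 * n ^ 2 * b * TR) ^ n :=
            mul_le_mul (hm a (by simp)) hRm (integral_nonneg fun x => by positivity) (by positivity)
        _ = _ := by rw [← mul_pow]; ring
    have hX3 : ∫ x, ‖c a a * D x‖ ^ (2 * n) ∂μ
        ≤ (16 * n ^ 2 * b ^ 2 * (‖c a a‖ ^ 2 * (v a * v a))) ^ n := by
      have hp : ∀ x, ‖D x‖ ^ (2 * n) ≤ 4 ^ n * (‖ξ a x‖ ^ (4 * n) + v a ^ (2 * n)) := fun x => by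
        have h1 : ‖D x‖ ≤ ‖ξ a x‖ ^ 2 + v a := by
          refine (norm_sub_le _ _).trans ?_
          rw [norm_mul, RCLike.norm_conj, ← sq, Complex.norm_real, Real.norm_of_nonneg hva]
        have h2 : ‖D x‖ ≤ 2 * max (‖ξ a x‖ ^ 2) (v a) := by
          have := le_max_left (‖ξ a x‖ ^ 2) (v a)
          have := le_max_right (‖ξ a x‖ ^ 2) (v a)
          linarith
        calc ‖D x‖ ^ (2 * n) ≤ (2 * max (‖ξ a x‖ ^ 2) (v a)) ^ (2 * n) :=
              pow_le_pow_left₀ (norm_nonneg _) h2 _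
          _ = 4 ^ n * max (‖ξ a x‖ ^ 2) (v a) ^ (2 * n) := by
              rw [mul_pow, pow_mul]; norm_num
          _ ≤ _ := by
              refine mul_le_mul_of_nonneg_left ?_ (by positivity)
              have e4 : ‖ξ a x‖ ^ (4 * n) = (‖ξ a x‖ ^ 2) ^ (2 * n) := by
                rw [← pow_mul]; congr 1; ring
              rw [e4]
              have g1 : 0 ≤ (‖ξ a x‖ ^ 2) ^ (2 * n) := by positivity
              have g2 : 0 ≤ v a ^ (2 * n) := by positivity
              rcases max_choice (‖ξ a x‖ ^ 2) (v a) with h | h <;> rw [h] <;> linarith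
      have hDm : ∫ x, ‖D x‖ ^ (2 * n) ∂μ ≤ 4 ^ n * ((b * v a) ^ (2 * n) + v a ^ (2 * n)) := by
        have i4 := (hξ a).integrable_norm_pow (μ := μ) (4 * n)
        refine (integral_mono (hD.integrable_norm_pow _)
          ((i4.add (integrable_const _)).const_mul _) hp).trans ?_
        rw [integral_const_mul]
        refine mul_le_mul_of_nonneg_left ?_ (by positivity)
        have := integral_add (μ := μ) i4 (integrable_const (v a ^ (2 * n)))
        simp only [Pi.add_apply] at this ⊢
        rw [this]
        simp
        exact hm' a (by simp)
      simp only [norm_mul, mul_pow, integral_const_mul]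
      have hv2 : v a ^ (2 * n) ≤ (b * v a) ^ (2 * n) :=
        pow_le_pow_left₀ hva (le_mul_of_one_le_left hva hb) _
      calc ‖c a a‖ ^ (2 * n) * ∫ x, ‖D x‖ ^ (2 * n) ∂μ
          ≤ ‖c a a‖ ^ (2 * n) * (4 ^ n * (2 ^ n * (b * v a) ^ (2 * n))) := by
            refine mul_le_mul_of_nonneg_left (hDm.trans ?_) (by positivity)
            refine mul_le_mul_of_nonneg_left ?_ (by positivity)
            have h2n : (2 : ℝ) ≤ 2 ^ n := by
              calc (2 : ℝ) = 2 ^ 1 := by norm_num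
                _ ≤ _ := pow_le_pow_right₀ (by norm_num) hn
            have : 0 ≤ (b * v a) ^ (2 * n) := by positivity
            nlinarith
        _ = (8 * b ^ 2 * (‖c a a‖ ^ 2 * (v a * v a))) ^ n := by
            rw [show (8 : ℝ) = 4 * 2 by norm_num]
            simp only [mul_pow, ← pow_mul]
            ring
        _ ≤ (16 * n ^ 2 * b ^ 2 * (‖c a a‖ ^ 2 * (v a * v a))) ^ n := by
            gcongr
            nlinarith
        _ = _ := by simp only [mul_pow]
    have hX := integral_norm_add_three_pow_le (μ := μ) ((hξ a).conj.mul hP) ((hξ a).mul hR)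
      (hD.const_mul (c a a)) hn (by positivity) (by positivity) (by positivity) hX1 hX2 hX3
    have hXt := (((hξ a).conj.mul hP).add ((hξ a).mul hR)).add (hD.const_mul (c a a))
    have hSc : Tame fun x => ((‖S x‖ : ℝ) : ℂ) ^ (2 * n - 2) * (starRingEnd ℂ) (S x) :=
      (hS.ofReal_norm.pow _).mul hS.conj
    have hlin : ∫ x, ((‖S x‖ : ℝ) : ℂ) ^ (2 * n - 2) * ((starRingEnd ℂ) (S x) *
        ((starRingEnd ℂ) (ξ a x) * P x + ξ a x * R x + c a a * D x)) ∂μ = 0 := by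
      have e1 := integral_mul_of_dependsOn (μ := μ) (hξ a).conj (hSc.mul hP) (S := {e a})
        (fun x y h => by simp only [hda h]) (fun x y h => by simp only [hSd h, hPd h])
      have e2 := integral_mul_of_dependsOn (μ := μ) (hξ a) (hSc.mul hR) (S := {e a})
        hda (fun x y h => by simp only [hSd h, hRd h])
      have e3 := integral_mul_of_dependsOn (μ := μ) hD (hSc.const_mul (c a a)) (S := {e a})
        (fun x y h => by simp only [hDdef, hda h]) (fun x y h => by simp only [hSd h])
      rw [hconj0, zero_mul] at e1
      rw [h0 a (by simp), zero_mul] at e2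
      rw [hD0, zero_mul] at e3
      have j1 := ((hξ a).conj.mul (hSc.mul hP)).integrable (μ := μ)
      have j2 := ((hξ a).mul (hSc.mul hR)).integrable (μ := μ)
      have j3 := (hD.mul (hSc.const_mul (c a a))).integrable (μ := μ)
      have := integral_add (j1.add j2) j3
      simp only [Pi.add_apply] at this
      rw [integral_add j1 j2, e1, e2, e3] at this
      simp only [add_zero] at this
      rw [← this]
      refine integral_congr_ae (Filter.Eventually.of_forall fun x => ?_)
      simp only
      ring
    have hW0 : 0 ≤ ∑ k ∈ s, ∑ l ∈ s, ‖c k l‖ ^ 2 * (v k * v l) :=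
      Finset.sum_nonneg fun k _ => Finset.sum_nonneg fun l _ =>
        mul_nonneg (sq_nonneg _) (mul_nonneg (hv k) (hv l))
    -- The constant is `16 n² * 9 * 16 n² = 2304 n⁴`: one factor from smoothness, `9` from the three
    -- terms, and one factor from the linear forms.
    have hfin := integral_norm_add_pow_le (μ := μ) hS hXt hn
      (A := 2304 * n ^ 4 * b ^ 2 * ∑ k ∈ s, ∑ l ∈ s, ‖c k l‖ ^ 2 * (v k * v l))
      (B := 9 * (16 * n ^ 2 * b ^ 2 * (v a * TP) + 16 * n ^ 2 * b ^ 2 * (v a * TR)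
        + 16 * n ^ 2 * b ^ 2 * (‖c a a‖ ^ 2 * (v a * v a))))
      (mul_nonneg (by positivity) hW0) (by positivity) ih hX hlin
    refine le_trans (le_of_eq ?_) (hfin.trans (le_of_eq ?_))
    · refine integral_congr_ae (Filter.Eventually.of_forall fun x => ?_)
      simp only [hSdef, hPdef, hRdef, hDdef]
      congr 2
      simp only [Finset.sum_insert ha, Finset.sum_add_distrib, Finset.mul_sum]
      have q1 : ∀ l, c a l * ((starRingEnd ℂ) (ξ a x) * ξ l x)
        = (starRingEnd ℂ) (ξ a x) * (c a l * ξ l x) := fun l => by ring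
      have q2 : ∀ l, c l a * ((starRingEnd ℂ) (ξ l x) * ξ a x)
        = ξ a x * (c l a * (starRingEnd ℂ) (ξ l x)) := fun l => by ring
      simp only [q1, q2]
      ring
    · congr 1
      simp only [Finset.sum_insert ha, Finset.sum_add_distrib]
      have q1 : ∑ l ∈ s, ‖c a l‖ ^ 2 * (v a * v l) = v a * TP := by
        rw [hTP, Finset.mul_sum]; exact Finset.sum_congr rfl fun l _ => by ring
      have q2 : ∑ l ∈ s, ‖c l a‖ ^ 2 * (v l * v a) = v a * TR := by
        rw [hTR, Finset.mul_sum]; exact Finset.sum_congr rfl fun l _ => by ring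
      rw [q1, q2]
      ring

/-- A conditional moment bound yields a tail bound at the conditional scale. -/
lemma measureReal_lt_norm_sq_le {F : (ι → ℂ) → ℂ} (hF : Tame F) {W : (ι → ℂ) → ℝ}
    (hW : Measurable W) (hW0 : ∀ x, 0 ≤ W x) {S : Finset ι} (hWS : DependsOn W (S : Set ι)ᶜ)
    {n : ℕ} (hn : 1 ≤ n)
    (h : ∀ x, ∫ y, ‖F (S.piecewise y x)‖ ^ (2 * n) ∂μ ≤ W x ^ n) :
    μ.real {x | Real.exp 2 * W x < ‖F x‖ ^ 2} ≤ Real.exp (-(2 * n)) := by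
  have hms : MeasurableSet {x | Real.exp 2 * W x < ‖F x‖ ^ 2} :=
    measurableSet_lt (hW.const_mul _) (hF.1.norm.pow_const 2)
  have hmp := ResamplingMeasure.piecewise (μ := μ) S
  have h1 : ∀ x, μ {y | Real.exp 2 * W (S.piecewise y x) < ‖F (S.piecewise y x)‖ ^ 2}
      ≤ ENNReal.ofReal (Real.exp (-(2 * n))) := by
    intro x
    have hWx : ∀ y, W (S.piecewise y x) = W x := fun y => hWS fun e he => by
      have : e ∉ S := by simpa using he
      simp [Finset.piecewise, this]
    simp only [hWx]
    have ht := hF.piecewise S x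
    -- Where the conditional scale vanishes, so does `F` almost surely, and Chebyshev's inequality
    -- would divide by zero.
    rcases (hW0 x).eq_or_lt with h0 | hpos
    · have hz : ∫ y, ‖F (S.piecewise y x)‖ ^ (2 * n) ∂μ = 0 := by
        refine le_antisymm ((h x).trans ?_) (integral_nonneg fun y => by positivity)
        rw [← h0, zero_pow (by omega)]
      rw [integral_eq_zero_iff_of_nonneg (fun y => by positivity) (ht.integrable_norm_pow _)] at hz
      have : μ {y | Real.exp 2 * W x < ‖F (S.piecewise y x)‖ ^ 2} = 0 := by
        rw [← h0]
        refine measure_mono_null (fun y hy => ?_) (ae_iff.1 hz)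
        simp only [Set.mem_ofPred_eq, mul_zero, Pi.zero_apply] at hy ⊢
        intro hy'
        rw [pow_eq_zero_iff (by omega)] at hy'
        rw [hy'] at hy
        simp at hy
      rw [this]
      simp
    -- Chebyshev's inequality for the moment of order `2n`: the factor `exp 2` in the threshold
    -- yields `exp (-2n)`.
    · have hM := mul_meas_ge_le_integral_of_nonneg (μ := μ)
        (f := fun y => ‖F (S.piecewise y x)‖ ^ (2 * n))
        (Filter.Eventually.of_forall fun y => by positivity) (ht.integrable_norm_pow _)
        ((Real.exp 2 * W x) ^ n)
      have hsub : {y | Real.exp 2 * W x < ‖F (S.piecewise y x)‖ ^ 2}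
          ⊆ {y | (Real.exp 2 * W x) ^ n ≤ ‖F (S.piecewise y x)‖ ^ (2 * n)} := fun y hy => by
        simp only [Set.mem_ofPred_eq] at hy ⊢
        rw [pow_mul]
        exact pow_le_pow_left₀ (by positivity) hy.le n
      refine (measure_mono hsub).trans ?_
      rw [← ofReal_measureReal]
      refine ENNReal.ofReal_le_ofReal ?_
      have h2 := hM.trans (h x)
      set r := μ.real {y | (Real.exp 2 * W x) ^ n ≤ ‖F (S.piecewise y x)‖ ^ (2 * n)}
      rw [mul_pow, mul_comm (Real.exp 2 ^ n), mul_assoc] at h2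
      have h3 : Real.exp 2 ^ n * r ≤ 1 := by
        refine le_of_mul_le_mul_left ?_ (pow_pos hpos n)
        linarith
      rw [Real.exp_neg, ← one_div, le_div_iff₀ (Real.exp_pos _), mul_comm]
      rwa [← Real.exp_nat_mul, mul_comm (n : ℝ) 2] at h3
  rw [Measure.real]
  refine ENNReal.toReal_le_of_le_ofReal (Real.exp_pos _).le ?_
  rw [← hmp.measure_preimage hms.nullMeasurableSet, Measure.prod_apply (hmp.measurable hms)]
  refine (lintegral_mono fun x => h1 x).trans ?_
  simp

end MomentInequalities

/-! ### Resolvents of minors: Ward, Schur and expansion identities -/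

section GreenFunction

variable {N : ℕ}

/-- The resolvent of the minor without the rows and columns in `T`, extended by zero. -/
noncomputable def green (A : Matrix (Fin N) (Fin N) ℂ) (z : ℂ) (T : Finset (Fin N))
    (i j : Fin N) : ℂ :=
  if h : i ∉ T ∧ j ∉ T then greenMinor A z T ⟨i, h.1⟩ ⟨j, h.2⟩ else 0

variable {A : Matrix (Fin N) (Fin N) ℂ} {z : ℂ}

lemma green_of_mem_left {T : Finset (Fin N)} {i : Fin N} (hi : i ∈ T) (j : Fin N) :
    green A z T i j = 0 := by simp [green, hi]

lemma green_of_mem_right {T : Finset (Fin N)} {j : Fin N} (hj : j ∈ T) (i : Fin N) :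
    green A z T i j = 0 := by simp [green, hj]

lemma green_of_notMem {T : Finset (Fin N)} (k l : {k // k ∉ T}) :
    green A z T k l = greenMinor A z T k l := by
  simp [green, k.2, l.2]

lemma sum_eq_sum_notMem (T : Finset (Fin N)) {f : Fin N → ℂ} (hf : ∀ k ∈ T, f k = 0) :
    ∑ k, f k = ∑ k : {k // k ∉ T}, f k := by
  rw [← Finset.sum_subset (Finset.subset_univ Tᶜ) fun k _ hk => hf k (by simpa using hk)]
  exact Finset.sum_subtype Tᶜ (by simp) f

lemma quadForm_eq (T : Finset (Fin N)) (i j : Fin N) :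
    quadForm z T i j A
      = ∑ k, ∑ l, (starRingEnd ℂ) (A k i) * green A z T k l * A l j := by
  rw [quadForm, sum_eq_sum_notMem T fun k hk => by simp [green_of_mem_left hk]]
  refine Finset.sum_congr rfl fun k _ => ?_
  rw [sum_eq_sum_notMem T fun l hl => by simp [green_of_mem_right hl]]
  simp only [green_of_notMem]

/-- A kernel vector `v` satisfies `⟨v, B v⟩ = z ‖v‖²`; the left side is real, so `v = 0`. -/
lemma isUnit_det_sub_smul_one {n : Type*} [Fintype n] [DecidableEq n] {B : Matrix n n ℂ}
    (hB : B.IsHermitian) (hz : 0 < z.im) : IsUnit (B - z • (1 : Matrix n n ℂ)).det := by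
  rw [isUnit_iff_ne_zero]
  intro h
  obtain ⟨v, hv, h0⟩ := Matrix.exists_mulVec_eq_zero_iff.2 h
  rw [Matrix.sub_mulVec, Matrix.smul_mulVec, Matrix.one_mulVec, sub_eq_zero] at h0
  have h1 := hB.im_star_dotProduct_mulVec_self v
  rw [h0, dotProduct_smul, smul_eq_mul] at h1
  have h2 : star v ⬝ᵥ v = ((∑ i, ‖v i‖ ^ 2 : ℝ) : ℂ) := by
    simp only [dotProduct, Pi.star_apply, RCLike.star_def]
    push_cast
    refine Finset.sum_congr rfl fun i _ => ?_
    rw [mul_comm, Complex.mul_conj, Complex.normSq_eq_norm_sq]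
    push_cast
    rfl
  rw [h2, RCLike.im_to_complex, Complex.im_mul_ofReal] at h1
  have h3 : ∑ i, ‖v i‖ ^ 2 = 0 := by
    rcases mul_eq_zero.1 h1 with h | h
    · exact absurd h hz.ne'
    · exact h
  apply hv
  ext i
  have := (Finset.sum_eq_zero_iff_of_nonneg fun i _ => by positivity).1 h3 i (Finset.mem_univ i)
  simpa using this

lemma isHermitian_submatrix (hA : A.IsHermitian) (T : Finset (Fin N)) :
    (A.submatrix (Subtype.val : {k // k ∉ T} → Fin N) Subtype.val).IsHermitian :=
  hA.submatrix _

lemma green_left (hA : A.IsHermitian) (hz : 0 < z.im) {T : Finset (Fin N)} {i j : Fin N}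
    (hi : i ∉ T) (hj : j ∉ T) :
    ∑ l, A i l * green A z T l j - z * green A z T i j = if i = j then 1 else 0 := by
  have h := Matrix.mul_nonsing_inv _ (isUnit_det_sub_smul_one (isHermitian_submatrix hA T) hz)
  have h1 := congrFun (congrFun h ⟨i, hi⟩) ⟨j, hj⟩
  rw [Matrix.sub_mul, Matrix.sub_apply, Matrix.smul_mul, Matrix.one_mul, Matrix.smul_apply,
    Matrix.mul_apply, Matrix.one_apply] at h1
  have e : green A z T i j = greenMinor A z T ⟨i, hi⟩ ⟨j, hj⟩ := by simp [green, hi, hj]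
  have e' : ∑ l, A i l * green A z T l j
      = ∑ l : {k // k ∉ T}, A i l * greenMinor A z T l ⟨j, hj⟩ := by
    rw [sum_eq_sum_notMem T (f := fun l => A i l * green A z T l j)
      fun k hk => by simp [green_of_mem_left hk]]
    exact Finset.sum_congr rfl fun l _ => congrArg _ (green_of_notMem l ⟨j, hj⟩)
  rw [e, e']
  simpa [greenMinor] using h1

lemma green_right (hA : A.IsHermitian) (hz : 0 < z.im) {T : Finset (Fin N)} {i j : Fin N}
    (hi : i ∉ T) (hj : j ∉ T) :
    ∑ l, green A z T i l * A l j - z * green A z T i j = if i = j then 1 else 0 := by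
  have h := Matrix.nonsing_inv_mul _ (isUnit_det_sub_smul_one (isHermitian_submatrix hA T) hz)
  have h1 := congrFun (congrFun h ⟨i, hi⟩) ⟨j, hj⟩
  rw [Matrix.mul_sub, Matrix.sub_apply, Matrix.mul_smul, Matrix.mul_one, Matrix.smul_apply,
    Matrix.mul_apply, Matrix.one_apply] at h1
  have e : green A z T i j = greenMinor A z T ⟨i, hi⟩ ⟨j, hj⟩ := by simp [green, hi, hj]
  have e' : ∑ l, green A z T i l * A l j
      = ∑ l : {k // k ∉ T}, greenMinor A z T ⟨i, hi⟩ l * A l j := by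
    rw [sum_eq_sum_notMem T (f := fun l => green A z T i l * A l j)
      fun k hk => by simp [green_of_mem_right hk]]
    exact Finset.sum_congr rfl fun l _ => congrArg (· * _) (green_of_notMem ⟨i, hi⟩ l)
  rw [e, e']
  simpa [greenMinor] using h1

/-- The defining equation determines the resolvent of the minor. -/
lemma eq_green (hA : A.IsHermitian) (hz : 0 < z.im) {T : Finset (Fin N)}
    {f : Fin N → Fin N → ℂ} (h0 : ∀ l ∈ T, ∀ j, f l j = 0)
    (h : ∀ i ∉ T, ∀ j ∉ T, ∑ l, A i l * f l j - z * f i j = if i = j then 1 else 0)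
    {i j : Fin N} (hi : i ∉ T) (hj : j ∉ T) : f i j = green A z T i j := by
  have e1 : ∑ k, ∑ l, green A z T i k * (A k l * f l j)
      = f i j + z * ∑ l, green A z T i l * f l j := by
    rw [Finset.sum_comm, Finset.mul_sum]
    have : ∀ l, ∑ k, green A z T i k * (A k l * f l j)
        = (if i = l then f l j else 0) + z * (green A z T i l * f l j) := fun l => by
      by_cases hl : l ∈ T
      · simp [h0 l hl]
      · have := green_right hA hz hi hl
        have e : ∑ k, green A z T i k * (A k l * f l j)
          = (∑ k, green A z T i k * A k l) * f l j := by
          rw [Finset.sum_mul]; exact Finset.sum_congr rfl fun k _ => by ring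
        rw [e, sub_eq_iff_eq_add.1 this]
        split_ifs <;> ring
    simp only [this, Finset.sum_add_distrib]
    simp
  have e2 : ∑ k, ∑ l, green A z T i k * (A k l * f l j)
      = green A z T i j + z * ∑ l, green A z T i l * f l j := by
    rw [Finset.mul_sum]
    have : ∀ k, ∑ l, green A z T i k * (A k l * f l j)
        = (if k = j then green A z T i k else 0) + z * (green A z T i k * f k j) := fun k => by
      by_cases hk : k ∈ T
      · simp [green_of_mem_right hk]
      · rw [← Finset.mul_sum, sub_eq_iff_eq_add.1 (h k hk j hj)]
        split_ifs <;> ring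
    simp only [this, Finset.sum_add_distrib]
    simp
  exact add_right_cancel (e1.symm.trans e2)

lemma conj_apply_of_isHermitian (hA : A.IsHermitian) (k l : Fin N) :
    (starRingEnd ℂ) (A k l) = A l k := hA.apply l k

/-- The Ward identity for columns. -/
lemma sum_norm_sq_green_left (hA : A.IsHermitian) (hz : 0 < z.im) (T : Finset (Fin N))
    (i : Fin N) : ∑ l, ‖green A z T l i‖ ^ 2 = (green A z T i i).im / z.im := by
  by_cases hi : i ∈ T
  · simp [green_of_mem_right hi]
  set g := green A z T with hg
  -- For the column `g = G_{·i}` the form `⟨g, A g⟩` is computed from the equation for `G` and from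
  -- its conjugate. Comparing imaginary parts gives the identity.
  have e1 : ∑ l, ∑ k, (starRingEnd ℂ) (g l i) * (A l k * g k i)
      = (starRingEnd ℂ) (g i i) + z * ∑ l, (starRingEnd ℂ) (g l i) * g l i := by
    rw [Finset.mul_sum]
    have : ∀ l, ∑ k, (starRingEnd ℂ) (g l i) * (A l k * g k i)
        = (if l = i then (starRingEnd ℂ) (g l i) else 0) + z * ((starRingEnd ℂ) (g l i) * g l i) :=
      fun l => by
      by_cases hl : l ∈ T
      · simp [hg, green_of_mem_left hl]
      · rw [← Finset.mul_sum, sub_eq_iff_eq_add.1 (green_left hA hz hl hi)]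
        split_ifs <;> ring
    simp only [this, Finset.sum_add_distrib]
    simp
  have e2 : ∑ l, ∑ k, (starRingEnd ℂ) (g l i) * (A l k * g k i)
      = g i i + (starRingEnd ℂ) z * ∑ l, (starRingEnd ℂ) (g l i) * g l i := by
    rw [Finset.sum_comm, Finset.mul_sum]
    have : ∀ k, ∑ l, (starRingEnd ℂ) (g l i) * (A l k * g k i)
        = (if k = i then g k i else 0) + (starRingEnd ℂ) z * ((starRingEnd ℂ) (g k i) * g k i) :=
      fun k => by
      by_cases hk : k ∈ T
      · simp [hg, green_of_mem_left hk]
      · have h := congrArg (starRingEnd ℂ) (sub_eq_iff_eq_add.1 (green_left hA hz hk hi))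
        rw [map_sum, map_add, map_mul] at h
        simp only [map_mul, conj_apply_of_isHermitian hA] at h
        have e : ∑ l, (starRingEnd ℂ) (g l i) * (A l k * g k i)
          = (∑ l, A l k * (starRingEnd ℂ) (g l i)) * g k i := by
          rw [Finset.sum_mul]; exact Finset.sum_congr rfl fun l _ => by ring
        rw [e, h]
        split_ifs <;> simp [hg] <;> ring
    simp only [this, Finset.sum_add_distrib]
    simp
  have e3 : ∑ l, (starRingEnd ℂ) (g l i) * g l i = ((∑ l, ‖g l i‖ ^ 2 : ℝ) : ℂ) := by
    push_cast
    refine Finset.sum_congr rfl fun l _ => ?_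
    rw [mul_comm, Complex.mul_conj, Complex.normSq_eq_norm_sq]
    push_cast
    rfl
  have h := e1.symm.trans e2
  rw [e3] at h
  have h2 := congrArg Complex.im h
  simp only [Complex.add_im, Complex.im_mul_ofReal, Complex.conj_im] at h2
  rw [eq_div_iff hz.ne']
  linarith

/-- The Ward identity for rows. -/
lemma sum_norm_sq_green_right (hA : A.IsHermitian) (hz : 0 < z.im) (T : Finset (Fin N))
    (i : Fin N) : ∑ l, ‖green A z T i l‖ ^ 2 = (green A z T i i).im / z.im := by
  by_cases hi : i ∈ T
  · simp [green_of_mem_left hi]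
  set g := green A z T with hg
  have e1 : ∑ l, ∑ k, g i k * (A k l * (starRingEnd ℂ) (g i l))
      = (starRingEnd ℂ) (g i i) + z * ∑ l, g i l * (starRingEnd ℂ) (g i l) := by
    rw [Finset.mul_sum]
    have : ∀ l, ∑ k, g i k * (A k l * (starRingEnd ℂ) (g i l))
        = (if i = l then (starRingEnd ℂ) (g i l) else 0) + z * (g i l * (starRingEnd ℂ) (g i l)) :=
      fun l => by
      by_cases hl : l ∈ T
      · simp [hg, green_of_mem_right hl]
      · have e : ∑ k, g i k * (A k l * (starRingEnd ℂ) (g i l))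
          = (∑ k, g i k * A k l) * (starRingEnd ℂ) (g i l) := by
          rw [Finset.sum_mul]; exact Finset.sum_congr rfl fun k _ => by ring
        rw [e, sub_eq_iff_eq_add.1 (green_right hA hz hi hl)]
        split_ifs <;> ring
    simp only [this, Finset.sum_add_distrib]
    simp
  have e2 : ∑ l, ∑ k, g i k * (A k l * (starRingEnd ℂ) (g i l))
      = g i i + (starRingEnd ℂ) z * ∑ l, g i l * (starRingEnd ℂ) (g i l) := by
    rw [Finset.sum_comm, Finset.mul_sum]
    have : ∀ k, ∑ l, g i k * (A k l * (starRingEnd ℂ) (g i l))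
        = (if i = k then g i k else 0) + (starRingEnd ℂ) z * (g i k * (starRingEnd ℂ) (g i k)) :=
      fun k => by
      by_cases hk : k ∈ T
      · simp [hg, green_of_mem_right hk]
      · have h := congrArg (starRingEnd ℂ) (sub_eq_iff_eq_add.1 (green_right hA hz hi hk))
        rw [map_sum, map_add, map_mul] at h
        simp only [map_mul, conj_apply_of_isHermitian hA] at h
        have e : ∑ l, g i k * (A k l * (starRingEnd ℂ) (g i l))
          = (∑ l, (starRingEnd ℂ) (g i l) * A k l) * g i k := by
          rw [Finset.sum_mul]; exact Finset.sum_congr rfl fun l _ => by ring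
        rw [e, h]
        split_ifs <;> simp [hg] <;> ring
    simp only [this, Finset.sum_add_distrib]
    simp
  have e3 : ∑ l, g i l * (starRingEnd ℂ) (g i l) = ((∑ l, ‖g i l‖ ^ 2 : ℝ) : ℂ) := by
    push_cast
    refine Finset.sum_congr rfl fun l _ => ?_
    rw [Complex.mul_conj, Complex.normSq_eq_norm_sq]
    push_cast
    rfl
  have h := e1.symm.trans e2
  rw [e3] at h
  have h2 := congrArg Complex.im h
  simp only [Complex.add_im, Complex.im_mul_ofReal, Complex.conj_im] at h2
  rw [eq_div_iff hz.ne']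
  linarith

lemma green_diag_im_nonneg (hA : A.IsHermitian) (hz : 0 < z.im) (T : Finset (Fin N)) (i : Fin N) :
    0 ≤ (green A z T i i).im := by
  have h := sum_norm_sq_green_right hA hz T i
  have h0 : 0 ≤ ∑ l, ‖green A z T i l‖ ^ 2 := Finset.sum_nonneg fun l _ => by positivity
  rw [h] at h0
  by_contra hneg
  push Not at hneg
  linarith [div_neg_of_neg_of_pos hneg hz]

/-- By the Ward identity a vanishing diagonal entry would make its whole column vanish, against the
defining equation. -/
lemma green_diag_ne_zero (hA : A.IsHermitian) (hz : 0 < z.im) {T : Finset (Fin N)} {i : Fin N}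
    (hi : i ∉ T) : green A z T i i ≠ 0 := by
  intro h
  have h1 := sum_norm_sq_green_left hA hz T i
  rw [h] at h1
  simp only [Complex.zero_im, zero_div] at h1
  have h2 : ∀ l, green A z T l i = 0 := fun l => by
    simpa using (Finset.sum_eq_zero_iff_of_nonneg fun l _ => by positivity).1 h1 l
      (Finset.mem_univ l)
  have h3 := green_left hA hz hi hi
  simp [h2] at h3

/-- The Ward identity gives `|G_ij|² ≤ |G_ii| / η`; the case `j = i` bounds `|G_ii|`, and then the
general case follows. -/
lemma norm_green_le (hA : A.IsHermitian) (hz : 0 < z.im) (T : Finset (Fin N)) (i j : Fin N) :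
    ‖green A z T i j‖ ≤ 1 / z.im := by
  have h : ∀ i j, ‖green A z T i j‖ ^ 2 ≤ ‖green A z T i i‖ / z.im := fun i j => by
    calc ‖green A z T i j‖ ^ 2 ≤ ∑ l, ‖green A z T i l‖ ^ 2 :=
          Finset.single_le_sum (f := fun l => ‖green A z T i l‖ ^ 2)
            (fun l _ => by positivity) (Finset.mem_univ j)
      _ = (green A z T i i).im / z.im := sum_norm_sq_green_right hA hz T i
      _ ≤ _ := by gcongr; exact (le_abs_self _).trans (Complex.abs_im_le_norm _)
  have h1 : ‖green A z T i i‖ ≤ 1 / z.im := by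
    have h2 := h i i
    rcases (norm_nonneg (green A z T i i)).eq_or_lt with h0 | h0
    · rw [← h0]; positivity
    · rw [sq, div_eq_mul_one_div] at h2
      exact le_of_mul_le_mul_left h2 h0
  have h3 : ‖green A z T i j‖ ^ 2 ≤ (1 / z.im) ^ 2 := by
    refine (h i j).trans ?_
    rw [div_eq_mul_one_div, sq]
    gcongr
  exact le_of_sq_le_sq h3 (by positivity)

/-- Removing one more row and column. -/
lemma green_eq_insert_add (hA : A.IsHermitian) (hz : 0 < z.im) (T : Finset (Fin N))
    (k i j : Fin N) :
    green A z T i j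
      = green A z (insert k T) i j + green A z T i k * green A z T k j / green A z T k k := by
  by_cases hi : i ∈ T
  · simp [green_of_mem_left, hi]
  by_cases hj : j ∈ T
  · simp [green_of_mem_right, hj]
  by_cases hk : k ∈ T
  · simp [hk, green_of_mem_left hk]
  have hkk := green_diag_ne_zero hA hz hk
  by_cases hik : i = k
  · subst hik
    rw [green_of_mem_left (Finset.mem_insert_self _ _)]
    field_simp
    ring
  by_cases hjk : j = k
  · subst hjk
    rw [green_of_mem_right (Finset.mem_insert_self _ _)]
    field_simp
    ring
  -- The rank-one correction makes row `k` vanish, and since `A G` has zero `(i, k)` entry up to `z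
  -- G_ik`, the corrected matrix solves the equation of the smaller minor.
  have := eq_green hA hz (T := insert k T) (f := fun i j => green A z T i j
      - green A z T i k * green A z T k j / green A z T k k) (fun l hl j => by
      rcases Finset.mem_insert.1 hl with rfl | hl
      · rw [mul_comm, mul_div_assoc]
        have := green_diag_ne_zero hA hz hk
        field_simp
        ring
      · simp [green_of_mem_left hl]) (fun i hi j hj => by
      simp only [Finset.mem_insert, not_or] at hi hj
      have h1 := green_left hA hz hi.2 hj.2
      have h2 := green_left hA hz hi.2 hk
      rw [if_neg hi.1] at h2
      rw [← h1]
      simp only [mul_sub, Finset.sum_sub_distrib]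
      have e : ∑ l, A i l * (green A z T l k * green A z T k j / green A z T k k)
          = (∑ l, A i l * green A z T l k) * (green A z T k j / green A z T k k) := by
        rw [Finset.sum_mul]; exact Finset.sum_congr rfl fun l _ => by ring
      rw [e, sub_eq_zero.1 h2]
      ring) (i := i) (j := j) (by simp [hik, hi]) (by simp [hjk, hj])
  rw [← this]
  ring

/-- Insert the removal identity for `i` into the equations at `(i, j)` and `(i, i)` and eliminate.
The gain is that the sum on the right is linear in the column `i`, which is independent of the
minor. -/
lemma green_off_diag_row (hA : A.IsHermitian) (hz : 0 < z.im) {T : Finset (Fin N)} {i j : Fin N}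
    (hi : i ∉ T) (hj : j ∉ T) (hij : i ≠ j) :
    green A z T i j
      = - green A z T i i * ∑ k, (starRingEnd ℂ) (A k i) * green A z (insert i T) k j := by
  have hii := green_diag_ne_zero hA hz hi
  have h1 := green_left hA hz hi hj
  have h2 := green_left hA hz hi hi
  rw [if_neg hij] at h1
  rw [if_pos rfl] at h2
  have e : ∑ l, A i l * green A z T l j = ∑ l, A i l * green A z (insert i T) l j
      + (∑ l, A i l * green A z T l i) * (green A z T i j / green A z T i i) := by
    rw [Finset.sum_mul, ← Finset.sum_add_distrib]
    refine Finset.sum_congr rfl fun l _ => ?_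
    rw [green_eq_insert_add hA hz T i l j]
    ring
  simp only [conj_apply_of_isHermitian hA]
  rw [e, sub_eq_iff_eq_add.1 h2] at h1
  field_simp at h1
  linear_combination h1

lemma green_off_diag_col (hA : A.IsHermitian) (hz : 0 < z.im) {T : Finset (Fin N)} {i j : Fin N}
    (hi : i ∉ T) (hj : j ∉ T) (hij : j ≠ i) :
    green A z T j i
      = - green A z T i i * ∑ k, green A z (insert i T) j k * A k i := by
  have hii := green_diag_ne_zero hA hz hi
  have h1 := green_right hA hz hj hi
  have h2 := green_right hA hz hi hi
  rw [if_neg hij] at h1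
  rw [if_pos rfl] at h2
  have e : ∑ l, green A z T j l * A l i = ∑ l, green A z (insert i T) j l * A l i
      + (∑ l, green A z T i l * A l i) * (green A z T j i / green A z T i i) := by
    rw [Finset.sum_mul, ← Finset.sum_add_distrib]
    refine Finset.sum_congr rfl fun l _ => ?_
    rw [green_eq_insert_add hA hz T i j l]
    ring
  rw [e, sub_eq_iff_eq_add.1 h2] at h1
  field_simp at h1
  linear_combination h1

/-- The Schur complement formula. -/
lemma one_div_green_diag (hA : A.IsHermitian) (hz : 0 < z.im) {T : Finset (Fin N)} {i : Fin N}
    (hi : i ∉ T) :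
    1 / green A z T i i = A i i - z - quadForm z (insert i T) i i A := by
  have hii := green_diag_ne_zero hA hz hi
  have h1 := green_left hA hz hi hi
  rw [if_pos rfl, ← Finset.add_sum_erase _ _ (Finset.mem_univ i)] at h1
  have e : ∑ l ∈ Finset.univ.erase i, A i l * green A z T l i
      = - green A z T i i * quadForm z (insert i T) i i A := by
    rw [quadForm_eq, ← Finset.add_sum_erase _ _ (Finset.mem_univ i)]
    simp only [green_of_mem_left (Finset.mem_insert_self i T), mul_zero, zero_mul,
      Finset.sum_const_zero, zero_add]
    rw [Finset.mul_sum]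
    refine Finset.sum_congr rfl fun l hl => ?_
    have hli := (Finset.mem_erase.1 hl).1
    by_cases hlT : l ∈ T
    · simp [green_of_mem_left hlT, green_of_mem_left (Finset.mem_insert_of_mem hlT)]
    · rw [green_off_diag_col hA hz hi hlT hli, conj_apply_of_isHermitian hA]
      simp only [Finset.mul_sum]
      exact Finset.sum_congr rfl fun k _ => by ring
  rw [e] at h1
  field_simp
  linear_combination -h1

/-- The resolvent identity. -/
lemma green_sub_green (hA : A.IsHermitian) (hz : 0 < z.im) {w : ℂ} (hw : 0 < w.im)
    {T : Finset (Fin N)} {i j : Fin N} (hi : i ∉ T) (hj : j ∉ T) :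
    green A z T i j - green A w T i j = (z - w) * ∑ k, green A z T i k * green A w T k j := by
  have e1 : ∑ k, ∑ l, green A z T i k * (A k l * green A w T l j)
      = green A z T i j + w * ∑ k, green A z T i k * green A w T k j := by
    rw [Finset.mul_sum]
    have : ∀ k, ∑ l, green A z T i k * (A k l * green A w T l j)
        = (if k = j then green A z T i k else 0) + w * (green A z T i k * green A w T k j) :=
      fun k => by
      by_cases hk : k ∈ T
      · simp [green_of_mem_right hk]
      · rw [← Finset.mul_sum, sub_eq_iff_eq_add.1 (green_left hA hw hk hj)]
        split_ifs <;> ring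
    simp only [this, Finset.sum_add_distrib]
    simp
  have e2 : ∑ k, ∑ l, green A z T i k * (A k l * green A w T l j)
      = green A w T i j + z * ∑ k, green A z T i k * green A w T k j := by
    rw [Finset.sum_comm, Finset.mul_sum]
    have : ∀ l, ∑ k, green A z T i k * (A k l * green A w T l j)
        = (if i = l then green A w T l j else 0) + z * (green A z T i l * green A w T l j) :=
      fun l => by
      by_cases hl : l ∈ T
      · simp [green_of_mem_left hl]
      · have e : ∑ k, green A z T i k * (A k l * green A w T l j)
          = (∑ k, green A z T i k * A k l) * green A w T l j := by
          rw [Finset.sum_mul]; exact Finset.sum_congr rfl fun k _ => by ring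
        rw [e, sub_eq_iff_eq_add.1 (green_right hA hz hi hl)]
        split_ifs <;> ring
    simp only [this, Finset.sum_add_distrib]
    simp
  linear_combination e1.symm.trans e2

lemma sum_norm_mul_norm_green_le (hA : A.IsHermitian) (hz : 0 < z.im) {w : ℂ} (hw : 0 < w.im)
    (T : Finset (Fin N)) (i j : Fin N) :
    ∑ k, ‖green A z T i k‖ * ‖green A w T k j‖
      ≤ √((green A z T i i).im / z.im) * √((green A w T j j).im / w.im) := by
  have := Real.sum_mul_le_sqrt_mul_sqrt Finset.univ (fun k => ‖green A z T i k‖)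
    fun k => ‖green A w T k j‖
  rwa [sum_norm_sq_green_right hA hz, sum_norm_sq_green_left hA hw] at this

/-- The resolvent identity, Cauchy–Schwarz and the Ward identity. This Lipschitz bound controls the
step between neighbouring grid points in the bootstrap. -/
lemma norm_green_sub_green_le (hA : A.IsHermitian) (hz : 0 < z.im) {w : ℂ} (hw : 0 < w.im)
    {T : Finset (Fin N)} {i j : Fin N} (hi : i ∉ T) (hj : j ∉ T) :
    ‖green A z T i j - green A w T i j‖ ≤ ‖z - w‖ / (z.im * w.im) := by
  have h0 : ∀ {u : ℂ} (_ : 0 < u.im) (k : Fin N), √((green A u T k k).im / u.im) ≤ 1 / u.im := by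
    intro u hu k
    have h1 : (green A u T k k).im ≤ 1 / u.im :=
      ((le_abs_self _).trans (Complex.abs_im_le_norm _)).trans (norm_green_le hA hu T k k)
    calc √((green A u T k k).im / u.im) ≤ √((1 / u.im) ^ 2) := by
          refine Real.sqrt_le_sqrt ?_
          rw [sq, div_eq_mul_one_div]
          gcongr
      _ = _ := Real.sqrt_sq (by positivity)
  rw [green_sub_green hA hz hw hi hj, norm_mul]
  calc ‖z - w‖ * ‖∑ k, green A z T i k * green A w T k j‖
      ≤ ‖z - w‖ * (1 / z.im * (1 / w.im)) := by
        refine mul_le_mul_of_nonneg_left ?_ (norm_nonneg _)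
        refine (norm_sum_le _ _).trans ?_
        simp only [norm_mul]
        refine (sum_norm_mul_norm_green_le hA hz hw T i j).trans ?_
        exact mul_le_mul (h0 hz i) (h0 hw j) (Real.sqrt_nonneg _) (by positivity)
    _ = _ := by field_simp

/-- The total size of the change of the resolvent when the `i`-th row and column are removed. -/
lemma sum_norm_green_mul_div_le (hA : A.IsHermitian) (hz : 0 < z.im) (T : Finset (Fin N))
    (i : Fin N) :
    ∑ k, ‖green A z T k i * green A z T i k / green A z T i i‖ ≤ 1 / z.im := by
  by_cases hi : i ∈ T
  · simp [green_of_mem_left hi]; exact hz.le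
  have hii := norm_pos_iff.2 (green_diag_ne_zero hA hz hi)
  have h1 := Real.sum_mul_le_sqrt_mul_sqrt Finset.univ (fun k => ‖green A z T k i‖)
    fun k => ‖green A z T i k‖
  have him := green_diag_im_nonneg hA hz T i
  rw [sum_norm_sq_green_right hA hz, sum_norm_sq_green_left hA hz,
    Real.mul_self_sqrt (by positivity)] at h1
  simp only [norm_div, norm_mul]
  rw [← Finset.sum_div, div_le_iff₀ hii]
  refine h1.trans ?_
  rw [div_eq_mul_one_div, mul_comm]
  gcongr
  exact (le_abs_self _).trans (Complex.abs_im_le_norm _)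

/-- Cramer's rule writes the entry as a quotient of determinants. -/
lemma measurable_green {X : Type*} [MeasurableSpace X] {B : X → Matrix (Fin N) (Fin N) ℂ}
    (hB : ∀ k l, Measurable fun x => B x k l) (z : ℂ) (T : Finset (Fin N)) (i j : Fin N) :
    Measurable fun x => green (B x) z T i j := by
  by_cases h : i ∉ T ∧ j ∉ T
  · have hdet : ∀ {C : X → Matrix {k // k ∉ T} {k // k ∉ T} ℂ}, (∀ k l, Measurable fun x => C x k l) →
        Measurable fun x => (C x).det := fun hC => by
      simp only [Matrix.det_apply]
      exact Finset.measurable_sum _ fun σ _ =>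
        (Finset.measurable_prod _ fun k _ => hC _ _).const_smul _
    have hM : ∀ k l : {k // k ∉ T}, Measurable fun x =>
        ((B x).submatrix Subtype.val Subtype.val - z • 1 : Matrix {k // k ∉ T} {k // k ∉ T} ℂ) k l :=
      fun k l => by
        simp only [Matrix.sub_apply, Matrix.submatrix_apply]
        exact (hB _ _).sub measurable_const
    simp only [green, dif_pos h, greenMinor, Matrix.inv_def, Ring.inverse_eq_inv', Matrix.smul_apply,
      Matrix.adjugate_apply, smul_eq_mul]
    refine (hdet hM).inv.mul (hdet fun k l => ?_)
    simp only [Matrix.updateRow_apply]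
    split_ifs
    · exact measurable_const
    · exact hM k l
  · simp only [green, dif_neg h]
    exact measurable_const

end GreenFunction

/-! ### A calculus of iterated differences of set functions -/

section Differences

variable {V : Type*} [DecidableEq V]

/-- The iterated difference of a function of a set in the directions of the elements of `B`. -/
noncomputable def altDiff (B : Finset V) (f : Finset V → ℂ) (T : Finset V) : ℂ :=
  ∑ S ∈ B.powerset, (-1) ^ S.card * f (T ∪ S)

lemma altDiff_empty (f : Finset V → ℂ) (T : Finset V) : altDiff ∅ f T = f T := by
  simp [altDiff]

lemma altDiff_insert {k : V} {B : Finset V} (hk : k ∉ B) (f : Finset V → ℂ) (T : Finset V) :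
    altDiff (insert k B) f T = altDiff B (fun T => f T - f (insert k T)) T := by
  rw [altDiff, Finset.sum_powerset_insert hk, altDiff, ← Finset.sum_add_distrib]
  refine Finset.sum_congr rfl fun S hS => ?_
  have hkS : k ∉ S := fun h => hk (Finset.mem_powerset.1 hS h)
  rw [Finset.card_insert_of_notMem hkS, Finset.union_insert]
  ring

lemma altDiff_add (B : Finset V) (f g : Finset V → ℂ) (T : Finset V) :
    altDiff B (fun T => f T + g T) T = altDiff B f T + altDiff B g T := by
  simp only [altDiff, mul_add, Finset.sum_add_distrib]

lemma altDiff_neg (B : Finset V) (f : Finset V → ℂ) (T : Finset V) :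
    altDiff B (fun T => - f T) T = - altDiff B f T := by
  simp only [altDiff, mul_neg, Finset.sum_neg_distrib]

lemma altDiff_shift (B : Finset V) (f : Finset V → ℂ) (k : V) (T : Finset V) :
    altDiff B (fun T => f (insert k T)) T = altDiff B f (insert k T) := by
  simp only [altDiff, Finset.insert_union]

lemma altDiff_const {B : Finset V} (hB : B.Nonempty) (c : ℂ) (T : Finset V) :
    altDiff B (fun _ => c) T = 0 := by
  obtain ⟨k, hk⟩ := hB
  rw [← Finset.insert_erase hk, altDiff_insert (Finset.notMem_erase k B)]
  simp [altDiff]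

/-- `f` is of order `ψ ^ m`, and differencing in `r` directions outside `J` gains a factor `ψ` for
each direction. -/
def IsSmall (ψ : ℝ) (r t : ℕ) (J : Finset V) (m : ℕ) (C : ℝ) (f : Finset V → ℂ) : Prop :=
  ∀ B T : Finset V, B.card ≤ r → T.card ≤ t → Disjoint B J → ‖altDiff B f T‖ ≤ C * ψ ^ (m + B.card)

lemma IsSmall.mono {ψ : ℝ} {r r' t t' m : ℕ} {J J' : Finset V} {C : ℝ} {f : Finset V → ℂ}
    (h : IsSmall ψ r t J m C f) (hr : r' ≤ r) (ht : t' ≤ t) (hJ : J ⊆ J') :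
    IsSmall ψ r' t' J' m C f := fun B T hB hT hd =>
  h B T (hB.trans hr) (hT.trans ht) (hd.mono_right hJ)

lemma IsSmall.shift {ψ : ℝ} {r t m : ℕ} {J : Finset V} {C : ℝ} {f : Finset V → ℂ}
    (h : IsSmall ψ r (t + 1) J m C f) (k : V) :
    IsSmall ψ r t J m C (fun T => f (insert k T)) := fun B T hB hT hd => by
  rw [altDiff_shift]
  exact h B _ hB ((Finset.card_insert_le _ _).trans (by omega)) hd

/-- One difference uses up one direction and gains one power of `ψ`; adding `k` to `J` ensures that
no direction is used twice. -/
lemma IsSmall.diff {ψ : ℝ} {r t m : ℕ} {J : Finset V} {C : ℝ} {f : Finset V → ℂ}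
    (h : IsSmall ψ (r + 1) t J m C f) {k : V} (hk : k ∉ J) :
    IsSmall ψ r t (insert k J) (m + 1) C (fun T => f T - f (insert k T)) := fun B T hB hT hd => by
  have hkB : k ∉ B := fun h' => (Finset.disjoint_left.1 hd h') (Finset.mem_insert_self _ _)
  rw [← altDiff_insert hkB]
  refine (h (insert k B) T ?_ hT ?_).trans (le_of_eq ?_)
  · rw [Finset.card_insert_of_notMem hkB]; omega
  · rw [Finset.disjoint_insert_left]
    exact ⟨hk, hd.mono_right (Finset.subset_insert _ _)⟩
  · rw [Finset.card_insert_of_notMem hkB]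
    congr 2
    omega

/-- The discrete Leibniz rule `Δ(fg) = Δf g + f Δg - Δf Δg`. Its three terms give the factor `3^r`;
the last one carries a superfluous `ψ ≤ 1`. -/
lemma IsSmall.mul {ψ : ℝ} (hψ : 0 ≤ ψ) (hψ1 : ψ ≤ 1) {r : ℕ} : ∀ {t m m' : ℕ} {J : Finset V}
    {C C' : ℝ} {f g : Finset V → ℂ}, 0 ≤ C → 0 ≤ C' → IsSmall ψ r t J m C f →
    IsSmall ψ r t J m' C' g → IsSmall ψ r t J (m + m') (3 ^ r * C * C') (fun T => f T * g T) := by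
  induction r with
  | zero =>
    intro t m m' J C C' f g hC hC' hf hg B T hB hT hd
    have hB0 : B = ∅ := by simpa using hB
    subst hB0
    have h1 := hf ∅ T hB hT hd
    have h2 := hg ∅ T hB hT hd
    rw [altDiff_empty] at h1 h2 ⊢
    simp only [Finset.card_empty, add_zero] at h1 h2 ⊢
    rw [norm_mul]
    calc _ ≤ (C * ψ ^ m) * (C' * ψ ^ m') := by gcongr
      _ = _ := by ring
  | succ r ih =>
    intro t m m' J C C' f g hC hC' hf hg B T hB hT hd
    rcases B.eq_empty_or_nonempty with rfl | ⟨k, hk⟩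
    · have h1 := hf ∅ T hB hT hd
      have h2 := hg ∅ T hB hT hd
      rw [altDiff_empty] at h1 h2 ⊢
      simp only [Finset.card_empty, add_zero] at h1 h2 ⊢
      rw [norm_mul]
      calc _ ≤ (C * ψ ^ m) * (C' * ψ ^ m') := by gcongr
        _ = 1 * (C * C' * ψ ^ (m + m')) := by ring
        _ ≤ 3 ^ (r + 1) * (C * C' * ψ ^ (m + m')) := by
            gcongr
            exact one_le_pow₀ (by norm_num)
        _ = _ := by ring
    · have hkJ : k ∉ J := Finset.disjoint_left.1 hd hk
      set B' := B.erase k with hB'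
      have hkB' : k ∉ B' := Finset.notMem_erase k B
      have hBeq : B = insert k B' := (Finset.insert_erase hk).symm
      have hcard : B.card = B'.card + 1 := by rw [hBeq, Finset.card_insert_of_notMem hkB']
      have hd' : Disjoint B' (insert k J) := by
        rw [Finset.disjoint_insert_right]
        exact ⟨hkB', hd.mono_left (Finset.erase_subset _ _)⟩
      have hf1 := hf.diff hkJ
      have hg1 := hg.diff hkJ
      have hf0 := hf.mono (Nat.le_succ r) le_rfl (Finset.subset_insert k J)
      have hg0 := hg.mono (Nat.le_succ r) le_rfl (Finset.subset_insert k J)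
      have b1 := ih hC hC' hf1 hg0 B' T (by omega) hT hd'
      have b2 := ih hC hC' hf0 hg1 B' T (by omega) hT hd'
      have b3 := ih hC hC' hf1 hg1 B' T (by omega) hT hd'
      have e : altDiff B (fun T => f T * g T) T
          = altDiff B' (fun T => (f T - f (insert k T)) * g T) T
            + altDiff B' (fun T => f T * (g T - g (insert k T))) T
            + - altDiff B' (fun T => (f T - f (insert k T)) * (g T - g (insert k T))) T := by
        rw [hBeq, altDiff_insert hkB', ← altDiff_neg, ← altDiff_add, ← altDiff_add]
        congr 1
        ext T
        ring
      rw [e, hcard]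
      refine norm_add₃_le.trans ?_
      rw [norm_neg]
      have b3' : ψ ^ (m + 1 + (m' + 1) + B'.card) ≤ ψ ^ (m + m' + (B'.card + 1)) :=
        pow_le_pow_of_le_one hψ hψ1 (by omega)
      have b3'' := mul_le_mul_of_nonneg_left b3' (show 0 ≤ 3 ^ r * C * C' by positivity)
      have q1 : m + 1 + m' + B'.card = m + m' + (B'.card + 1) := by omega
      have q2 : m + (m' + 1) + B'.card = m + m' + (B'.card + 1) := by omega
      rw [q1] at b1
      rw [q2] at b2
      rw [pow_succ]
      linarith

end Differences

/-! ### Each removed index gains a factor `ψ` -/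

section GreenDifferences

variable {N : ℕ} {A : Matrix (Fin N) (Fin N) ℂ} {z : ℂ}

/-- The growth of the constants in the estimates of iterated differences of resolvent entries. -/
def diffConst (a : ℝ) : ℕ → ℝ
  | 0 => a
  | r + 1 => 3 ^ (4 * r) * diffConst a r ^ 5

lemma one_le_diffConst {a : ℝ} (ha : 1 ≤ a) (r : ℕ) : 1 ≤ diffConst a r := by
  induction r with
  | zero => exact ha
  | succ r ih => exact one_le_mul_of_one_le_of_one_le (one_le_pow₀ (by norm_num)) (one_le_pow₀ ih)

lemma diffConst_le_succ {a : ℝ} (ha : 1 ≤ a) (r : ℕ) : diffConst a r ≤ diffConst a (r + 1) := by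
  have h := one_le_diffConst ha r
  calc diffConst a r = 1 * diffConst a r ^ 1 := by ring
    _ ≤ 3 ^ (4 * r) * diffConst a r ^ 5 :=
        mul_le_mul (one_le_pow₀ (by norm_num)) (pow_le_pow_right₀ h (by norm_num)) (by positivity)
          (by positivity)

lemma diffConst_mono {a : ℝ} (ha : 1 ≤ a) : Monotone (diffConst a) :=
  monotone_nat_of_le_succ (diffConst_le_succ ha)

/-- The removal identity for `G_ii` divided by the two diagonal entries. Two off-diagonal entries
appear, so the first difference of `1 / G_ii` is of order `ψ²` rather than `ψ`. For `i ∈ T` both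
sides are zero by the convention on division. -/
lemma one_div_green_sub (hA : A.IsHermitian) (hz : 0 < z.im) {i k : Fin N} (hik : i ≠ k)
    (T : Finset (Fin N)) :
    1 / green A z T i i - 1 / green A z (insert k T) i i
      = - (green A z T i k * green A z T k i * (1 / green A z T k k) * (1 / green A z T i i) *
        (1 / green A z (insert k T) i i)) := by
  by_cases hi : i ∈ T
  · simp [green_of_mem_left, hi]
  have h1 := green_diag_ne_zero hA hz hi
  have h2 := green_diag_ne_zero hA hz (T := insert k T) (i := i) (by simp [hik, hi])
  have h3 := green_eq_insert_add hA hz T k i i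
  rw [div_sub_div _ _ h1 h2, one_mul, mul_one, div_eq_iff (mul_ne_zero h1 h2)]
  have e : -(green A z T i k * green A z T k i * (1 / green A z T k k) * (1 / green A z T i i) *
        (1 / green A z (insert k T) i i)) * (green A z T i i * green A z (insert k T) i i)
      = -(green A z T i k * green A z T k i / green A z T k k) := by
    field_simp
  rw [e]
  linear_combination -h3

/-- Iterated differences of resolvent entries of minors in the removed indices. -/
lemma isSmall_green (hA : A.IsHermitian) (hz : 0 < z.im) {a ψ : ℝ} (ha : 1 ≤ a) (hψ : 0 ≤ ψ)
    (hψ1 : ψ ≤ 1) {R : ℕ}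
    (hoff : ∀ T : Finset (Fin N), T.card ≤ R → ∀ i j, i ≠ j → ‖green A z T i j‖ ≤ a * ψ)
    (hdiag : ∀ T : Finset (Fin N), T.card ≤ R → ∀ i, ‖1 / green A z T i i‖ ≤ a) (r : ℕ) :
    ∀ t, r + t ≤ R →
      (∀ i j, i ≠ j → IsSmall ψ r t {i, j} 1 (diffConst a r) fun T => green A z T i j) ∧
      (∀ i, IsSmall ψ r t {i} 0 (diffConst a r) fun T => 1 / green A z T i i) ∧
      (∀ i (B T : Finset (Fin N)), B.card ≤ r → T.card ≤ t → i ∉ B → B.Nonempty →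
        ‖altDiff B (fun T => 1 / green A z T i i) T‖ ≤ diffConst a r * ψ ^ (1 + B.card)) := by
  -- The claims are proved together, since one difference turns each quantity into a product of the
  -- others. The third records the extra power of `ψ` that `1 / G_ii` acquires once it has been
  -- differenced; it is the one used for the quadratic forms.
  induction r with
  | zero =>
    refine fun t ht => ⟨fun i j hij B T hB hT hd => ?_, fun i B T hB hT hd => ?_,
      fun i B T hB hT hi hne => ?_⟩
    · have hB0 : B = ∅ := by simpa using hB
      subst hB0
      simpa [altDiff_empty, diffConst] using hoff T (by omega) i j hij
    · have hB0 : B = ∅ := by simpa using hB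
      subst hB0
      simpa [altDiff_empty, diffConst] using hdiag T (by omega) i
    · have hB0 : B = ∅ := by simpa using hB
      simp [hB0] at hne
  | succ r ih =>
    intro t ht
    set c := diffConst a r with hc
    have hc1 : 1 ≤ c := one_le_diffConst ha r
    have hc0 : 0 ≤ c := zero_le_one.trans hc1
    have hle := diffConst_le_succ ha r
    have hac : a ≤ diffConst a (r + 1) := diffConst_mono ha (Nat.zero_le (r + 1))
    obtain ⟨iho, ihd, -⟩ := ih t (by omega)
    -- One factor of the difference has `k` already removed, so it is a shift and requires one more
    -- admissible removed index.
    obtain ⟨-, ihd', -⟩ := ih (t + 1) (by omega)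
    have h3r : (1 : ℝ) ≤ 3 ^ r := one_le_pow₀ (by norm_num)
    have hdiff : ∀ i (B T : Finset (Fin N)), B.card ≤ r + 1 → T.card ≤ t → i ∉ B → B.Nonempty →
        ‖altDiff B (fun T => 1 / green A z T i i) T‖ ≤ diffConst a (r + 1) * ψ ^ (1 + B.card) := by
      intro i B T hB hT hi ⟨k, hk⟩
      set B' := B.erase k with hB'
      have hkB' : k ∉ B' := Finset.notMem_erase k B
      have hBeq : B = insert k B' := (Finset.insert_erase hk).symm
      have hcard : B.card = B'.card + 1 := by rw [hBeq, Finset.card_insert_of_notMem hkB']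
      have hik : i ≠ k := fun h => hi (h ▸ hk)
      have hiB' : i ∉ B' := fun h => hi (Finset.mem_of_mem_erase h)
      have s1 := (iho i k hik).mono le_rfl le_rfl (J' := {i, k}) (by simp)
      have s2 := (iho k i hik.symm).mono le_rfl le_rfl (J' := {i, k}) (by
        intro x; simp; tauto)
      have s3 := (ihd k).mono le_rfl le_rfl (J' := {i, k}) (by simp)
      have s4 := (ihd i).mono le_rfl le_rfl (J' := {i, k}) (by simp)
      have s5 := ((ihd' i).shift k).mono le_rfl le_rfl (J' := {i, k}) (by simp)
      -- A product of five factors takes four multiplications, each costing `3^r`; this is the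
      -- recursion of `diffConst`.
      have p1 := IsSmall.mul hψ hψ1 hc0 hc0 s1 s2
      have p2 := IsSmall.mul hψ hψ1 (by positivity) hc0 p1 s3
      have p3 := IsSmall.mul hψ hψ1 (by positivity) hc0 p2 s4
      have p4 := IsSmall.mul hψ hψ1 (by positivity) hc0 p3 s5
      have h := p4 B' T (by omega) hT (by
        simp only [Finset.disjoint_insert_right, Finset.disjoint_singleton_right]
        exact ⟨hiB', hkB'⟩)
      rw [hBeq, altDiff_insert hkB', ← hBeq, hcard]
      simp only [one_div_green_sub hA hz hik]
      rw [altDiff_neg, norm_neg]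
      refine h.trans (le_of_eq ?_)
      simp only [diffConst]
      rw [← hc]
      have : 1 + 1 + 0 + 0 + 0 + B'.card = 1 + (B'.card + 1) := by omega
      rw [this, pow_mul']
      ring
    refine ⟨fun i j hij B T hB hT hd => ?_, fun i B T hB hT hd => ?_, hdiff⟩
    · rcases B.eq_empty_or_nonempty with rfl | ⟨k, hk⟩
      · rw [altDiff_empty]
        refine (hoff T (by omega) i j hij).trans ?_
        simpa using mul_le_mul_of_nonneg_right hac hψ
      · set B' := B.erase k with hB'
        have hkB' : k ∉ B' := Finset.notMem_erase k B
        have hBeq : B = insert k B' := (Finset.insert_erase hk).symm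
        have hcard : B.card = B'.card + 1 := by rw [hBeq, Finset.card_insert_of_notMem hkB']
        have hkJ := Finset.disjoint_left.1 hd hk
        simp only [Finset.mem_insert, Finset.mem_singleton, not_or] at hkJ
        have s1 := (iho i k (Ne.symm hkJ.1)).mono le_rfl le_rfl (J' := {i, j, k}) (by
          intro x; simp; tauto)
        have s2 := (iho k j hkJ.2).mono le_rfl le_rfl (J' := {i, j, k}) (by
          intro x; simp; tauto)
        have s3 := (ihd k).mono le_rfl le_rfl (J' := {i, j, k}) (by simp)
        have p1 := IsSmall.mul hψ hψ1 hc0 hc0 s1 s2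
        have p2 := IsSmall.mul hψ hψ1 (by positivity) hc0 p1 s3
        have h := p2 B' T (by omega) hT (by
          rw [Finset.disjoint_left]
          intro x hx
          have := Finset.disjoint_left.1 hd (Finset.mem_of_mem_erase hx)
          simp only [Finset.mem_insert, Finset.mem_singleton, not_or] at this ⊢
          exact ⟨this.1, this.2, fun h => hkB' (h ▸ hx)⟩)
        rw [hBeq, altDiff_insert hkB', ← hBeq, hcard]
        have e : (fun T => green A z T i j - green A z (insert k T) i j)
            = fun T => green A z T i k * green A z T k j * (1 / green A z T k k) := by
          ext T
          rw [green_eq_insert_add hA hz T k i j]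
          ring
        rw [e]
        refine h.trans ?_
        have q : 1 + 1 + 0 + B'.card = 1 + (B'.card + 1) := by omega
        rw [q]
        refine mul_le_mul_of_nonneg_right ?_ (by positivity)
        simp only [diffConst]
        rw [← hc, pow_mul']
        have h5 : c ^ 3 ≤ c ^ 5 := pow_le_pow_right₀ hc1 (by norm_num)
        have h6 : ((3 : ℝ) ^ r) ^ 2 ≤ (3 ^ r) ^ 4 := pow_le_pow_right₀ h3r (by norm_num)
        calc _ = ((3 : ℝ) ^ r) ^ 2 * c ^ 3 := by ring
          _ ≤ _ := mul_le_mul h6 h5 (by positivity) (by positivity)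
    · rcases B.eq_empty_or_nonempty with rfl | hne
      · rw [altDiff_empty]
        refine (hdiag T (by omega) i).trans ?_
        simpa using hac
      · refine (hdiff i B T hB hT (by simpa using hd) hne).trans ?_
        have : 0 ≤ diffConst a (r + 1) := hc0.trans hle
        refine mul_le_mul_of_nonneg_left ?_ this
        exact pow_le_pow_of_le_one hψ hψ1 (by omega)

/-- Resolvent entries of small minors inherit the estimates for those of the full matrix. -/
lemma green_minor_bounds (hA : A.IsHermitian) (hz : 0 < z.im) {ψ c : ℝ} (hψ : 0 ≤ ψ) (hc : 0 < c)
    {R : ℕ} (h1 : R * ((2 ^ R * ψ) ^ 2 * (2 / c)) ≤ c / 2) (h2 : 2 ^ R * ψ * (2 / c) ≤ 1)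
    (hoff : ∀ i j, i ≠ j → ‖green A z ∅ i j‖ ≤ ψ) (hdiag : ∀ i, c ≤ ‖green A z ∅ i i‖)
    (T : Finset (Fin N)) (hT : T.card ≤ R) :
    (∀ i j, i ≠ j → ‖green A z T i j‖ ≤ 2 ^ T.card * ψ) ∧
      ∀ i ∉ T, c - T.card * ((2 ^ R * ψ) ^ 2 * (2 / c)) ≤ ‖green A z T i i‖ := by
  induction T using Finset.induction_on with
  | empty => exact ⟨by simpa using hoff, by simpa using hdiag⟩
  | insert k T hk ih =>
    rw [Finset.card_insert_of_notMem hk] at hT ⊢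
    obtain ⟨ih1, ih2⟩ := ih (by omega)
    have hTR : (2 : ℝ) ^ T.card ≤ 2 ^ R := pow_le_pow_right₀ (by norm_num) (by omega)
    set δ := (2 ^ R * ψ) ^ 2 * (2 / c) with hδ
    have hδ0 : 0 ≤ δ := by positivity
    have hkk : ‖1 / green A z T k k‖ ≤ 2 / c := by
      have h3 := ih2 k hk
      have h4 : (T.card : ℝ) * δ ≤ R * δ :=
        mul_le_mul_of_nonneg_right (by exact_mod_cast (by omega : T.card ≤ R)) hδ0
      have h5 : c / 2 ≤ ‖green A z T k k‖ := by linarith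
      rw [norm_div, norm_one]
      calc 1 / ‖green A z T k k‖ ≤ 1 / (c / 2) := one_div_le_one_div_of_le (by positivity) h5
        _ = 2 / c := by field_simp
    have hle : ∀ i j, i ≠ j → ‖green A z T i j‖ ≤ 2 ^ R * ψ := fun i j hij =>
      (ih1 i j hij).trans (mul_le_mul_of_nonneg_right hTR hψ)
    have e : ∀ i j, green A z (insert k T) i j
        = green A z T i j - green A z T i k * green A z T k j * (1 / green A z T k k) := by
      intro i j
      rw [green_eq_insert_add hA hz T k i j]
      ring
    constructor
    · intro i j hij
      by_cases hik : i = k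
      · rw [green_of_mem_left (by simp [hik]), norm_zero]
        positivity
      by_cases hjk : j = k
      · rw [green_of_mem_right (by simp [hjk]), norm_zero]
        positivity
      rw [e]
      refine (norm_sub_le _ _).trans ?_
      rw [norm_mul, norm_mul]
      have b1 : ‖green A z T i k‖ * ‖green A z T k j‖ * ‖1 / green A z T k k‖
          ≤ (2 ^ T.card * ψ) * (2 ^ R * ψ) * (2 / c) := by
        gcongr
        · exact ih1 i k hik
        · exact hle k j (Ne.symm hjk)
      -- The correction is at most the bound already known, so each removal at most doubles it.
      have b2 : (2 ^ T.card * ψ) * (2 ^ R * ψ) * (2 / c) ≤ 2 ^ T.card * ψ := by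
        rw [mul_assoc]
        exact mul_le_of_le_one_right (by positivity) h2
      have b3 := ih1 i j hij
      rw [pow_succ]
      linarith
    · intro i hi
      simp only [Finset.mem_insert, not_or] at hi
      rw [e]
      have b1 : ‖green A z T i k * green A z T k i * (1 / green A z T k k)‖ ≤ δ := by
        rw [norm_mul, norm_mul, hδ, sq]
        gcongr
        · exact hle i k hi.1
        · exact hle k i (Ne.symm hi.1)
      have b2 := ih2 i hi.2
      have b3 := norm_sub_norm_le (green A z T i i)
        (green A z T i k * green A z T k i * (1 / green A z T k k))
      push_cast
      linarith

/-- Iterated differences of the quadratic forms `Z_ii` in the removed indices. -/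
lemma norm_altDiff_quadForm_le (hA : A.IsHermitian) (hz : 0 < z.im) {a ψ : ℝ} (ha : 1 ≤ a)
    (hψ : 0 ≤ ψ) (hψ1 : ψ ≤ 1) {R : ℕ}
    (hoff : ∀ T : Finset (Fin N), T.card ≤ R → ∀ i j, i ≠ j → ‖green A z T i j‖ ≤ a * ψ)
    (hdiag : ∀ T : Finset (Fin N), T.card ≤ R → ∀ i, ‖1 / green A z T i i‖ ≤ a)
    {i : Fin N} {B : Finset (Fin N)} (hi : i ∉ B) (hB : B.Nonempty) (hBR : B.card ≤ R) :
    ‖altDiff B (fun T => quadForm z (insert i T) i i A) ∅‖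
      ≤ diffConst a R * ψ ^ (1 + B.card) := by
  have h := (isSmall_green hA hz ha hψ hψ1 hoff hdiag R 0 (by omega)).2.2 i B ∅ hBR (by simp) hi hB
  refine le_trans (le_of_eq ?_) h
  -- By the Schur complement the quadratic form equals `A_ii - z - 1 / G_ii^(T)`, and the part
  -- independent of `T` has no differences.
  have e : altDiff B (fun T => quadForm z (insert i T) i i A) ∅
      = altDiff B (fun T => (A i i - z) + - (1 / green A z T i i)) ∅ := by
    refine Finset.sum_congr rfl fun S hS => ?_
    have hiS : i ∉ ∅ ∪ S := by
      rw [Finset.empty_union]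
      exact fun h => hi (Finset.mem_powerset.1 hS h)
    simp only
    rw [one_div_green_diag hA hz hiS]
    ring
  rw [e, altDiff_add, altDiff_const hB, altDiff_neg, zero_add, norm_neg]

end GreenDifferences

/-! ### Bounds on `m_sc` and on the control function `θ` -/

section Semicircle

variable {z : ℂ}

lemma msc_im_pos (hz : 0 < z.im) : 0 < (msc z).im := ((eq_msc_iff hz _).1 rfl).2

lemma msc_mul_add (hz : 0 < z.im) : msc z * (z + msc z) = -1 := by
  obtain ⟨h, hm⟩ := (eq_msc_iff hz _).1 rfl
  have hne : z + msc z ≠ 0 := by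
    intro h0
    have := congrArg Complex.im h0
    simp at this
    linarith
  field_simp at h
  linear_combination h

lemma msc_ne_zero (hz : 0 < z.im) : msc z ≠ 0 := by
  intro h
  have := msc_im_pos hz
  rw [h] at this
  simp at this

lemma one_div_msc (hz : 0 < z.im) : 1 / msc z = -z - msc z := by
  rw [div_eq_iff (msc_ne_zero hz)]
  linear_combination msc_mul_add hz

lemma norm_msc_pos (hz : 0 < z.im) : 0 < ‖msc z‖ := norm_pos_iff.2 (msc_ne_zero hz)

lemma norm_msc_sq_mul (hz : 0 < z.im) : ‖msc z‖ ^ 2 * (z.im + (msc z).im) = (msc z).im := by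
  have h := congrArg Complex.im (one_div_msc hz)
  rw [one_div, Complex.inv_im, Complex.normSq_eq_norm_sq] at h
  have := norm_msc_pos hz
  simp only [Complex.sub_im, Complex.neg_im] at h
  rw [div_eq_iff (by positivity)] at h
  linarith

lemma msc_im_le_norm (z : ℂ) : (msc z).im ≤ ‖msc z‖ :=
  (le_abs_self _).trans (Complex.abs_im_le_norm _)

lemma norm_msc_le_one (hz : 0 < z.im) : ‖msc z‖ ≤ 1 := by
  have h := norm_msc_sq_mul hz
  have hm := msc_im_pos hz
  by_contra hlt
  push Not at hlt
  have h1 : 1 < ‖msc z‖ ^ 2 := by nlinarith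
  have h2 : 1 * (z.im + (msc z).im) < ‖msc z‖ ^ 2 * (z.im + (msc z).im) := by gcongr
  linarith

lemma norm_msc_sq_le (hz : 0 < z.im) : ‖msc z‖ ^ 2 * (1 + z.im) ≤ 1 := by
  have h := norm_msc_sq_mul hz
  have hm := msc_im_pos hz
  have h1 : (msc z).im ≤ 1 := (msc_im_le_norm z).trans (norm_msc_le_one hz)
  have h2 : ‖msc z‖ ^ 2 * (1 + z.im) * (msc z).im ≤ 1 * (msc z).im := by
    have h3 : ‖msc z‖ ^ 2 * (z.im * (msc z).im) ≤ ‖msc z‖ ^ 2 * (z.im * 1) := by gcongr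
    nlinarith
  exact le_of_mul_le_mul_right h2 hm

lemma norm_msc_le_one_div (hz : 0 < z.im) : ‖msc z‖ ≤ 1 / z.im := by
  have h := congrArg norm (msc_mul_add hz)
  rw [norm_mul, norm_neg, norm_one] at h
  have h1 : z.im ≤ ‖z + msc z‖ := by
    have := (le_abs_self _).trans (Complex.abs_im_le_norm (z + msc z))
    have hm := msc_im_pos hz
    rw [Complex.add_im] at this
    linarith
  rw [le_div_iff₀ hz]
  calc ‖msc z‖ * z.im ≤ ‖msc z‖ * ‖z + msc z‖ := by gcongr
    _ = 1 := h

lemma le_norm_msc (hz : 0 < z.im) : 1 / (‖z‖ + 1) ≤ ‖msc z‖ := by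
  have h := congrArg norm (msc_mul_add hz)
  rw [norm_mul, norm_neg, norm_one] at h
  have h1 : ‖z + msc z‖ ≤ ‖z‖ + 1 := (norm_add_le _ _).trans (by linarith [norm_msc_le_one hz])
  rw [div_le_iff₀ (by positivity)]
  calc 1 = ‖msc z‖ * ‖z + msc z‖ := h.symm
    _ ≤ _ := by gcongr

/-- Factor `1 - m² = (1 - m)(1 + m)`: according to the sign of `Re m` one factor has modulus at
least `1`, and both have modulus at least `Im m`. -/
lemma msc_im_le (z : ℂ) : (msc z).im ≤ ‖1 - msc z ^ 2‖ := by
  have e : 1 - msc z ^ 2 = (1 - msc z) * (1 + msc z) := by ring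
  rw [e, norm_mul]
  have h1 : (msc z).im ≤ ‖1 - msc z‖ := by
    have := (neg_le_abs _).trans (Complex.abs_im_le_norm (1 - msc z))
    simpa using this
  have h2 : (msc z).im ≤ ‖1 + msc z‖ := by
    have := (le_abs_self _).trans (Complex.abs_im_le_norm (1 + msc z))
    simpa using this
  rcases le_total 0 (msc z).re with h | h
  · have h3 : 1 ≤ ‖1 + msc z‖ := by
      have := (le_abs_self _).trans (Complex.abs_re_le_norm (1 + msc z))
      simp at this
      linarith
    nlinarith [norm_nonneg (1 - msc z)]
  · have h3 : 1 ≤ ‖1 - msc z‖ := by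
      have := (le_abs_self _).trans (Complex.abs_re_le_norm (1 - msc z))
      simp at this
      linarith
    nlinarith [norm_nonneg (1 + msc z)]

/-- From `z m = -(1 + m²)` one gets `(1 - m²)² = (1 + m²)² - 4m² = m² (z² - 4)`. Thus `|1 - m²|` is
comparable to `√(κ + η)` in the bounded region. -/
lemma norm_one_sub_msc_sq_sq (hz : 0 < z.im) :
    ‖1 - msc z ^ 2‖ ^ 2 = ‖msc z‖ ^ 2 * (‖z - 2‖ * ‖z + 2‖) := by
  have e : (1 - msc z ^ 2) ^ 2 = msc z ^ 2 * ((z - 2) * (z + 2)) := by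
    linear_combination (msc z ^ 2 + 1 - z * msc z) * msc_mul_add hz
  rw [← norm_pow, e, norm_mul, norm_mul, norm_pow]

lemma norm_one_sub_msc_sq_le_two (hz : 0 < z.im) : ‖1 - msc z ^ 2‖ ≤ 2 := by
  refine (norm_sub_le _ _).trans ?_
  rw [norm_one, norm_pow]
  have := norm_msc_le_one hz
  have := norm_msc_pos hz
  nlinarith

lemma norm_one_sub_msc_sq_pos (hz : 0 < z.im) : 0 < ‖1 - msc z ^ 2‖ :=
  (msc_im_pos hz).trans_le (msc_im_le z)

lemma kappa_add_im_pos (hz : 0 < z.im) : 0 < kappa z + z.im :=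
  add_pos_of_nonneg_of_pos (abs_nonneg _) hz

lemma norm_eq_sqrt_re_im (w : ℂ) : ‖w‖ = √(w.re ^ 2 + w.im ^ 2) := by
  rw [Complex.norm_eq_sqrt_sq_add_sq]

lemma norm_sub_two_mul_norm_add_two (z : ℂ) :
    ‖z - 2‖ * ‖z + 2‖
      = √((|z.re| - 2) ^ 2 + z.im ^ 2) * √((|z.re| + 2) ^ 2 + z.im ^ 2) := by
  have h1 : ‖z - 2‖ = √((z.re - 2) ^ 2 + z.im ^ 2) := by rw [norm_eq_sqrt_re_im]; simp
  have h2 : ‖z + 2‖ = √((z.re + 2) ^ 2 + z.im ^ 2) := by rw [norm_eq_sqrt_re_im]; simp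
  rw [h1, h2]
  rcases abs_choice z.re with h | h <;> rw [h]
  rw [mul_comm]
  congr 3 <;> ring

lemma kappa_add_im_le (hz : 0 < z.im) : kappa z + z.im ≤ ‖z - 2‖ * ‖z + 2‖ := by
  rw [norm_sub_two_mul_norm_add_two]
  have h1 : (kappa z + z.im) / 2 ≤ √((|z.re| - 2) ^ 2 + z.im ^ 2) := by
    apply Real.le_sqrt_of_sq_le
    have e : (|z.re| - 2) ^ 2 = kappa z ^ 2 := by rw [kappa, sq_abs]
    rw [e]
    nlinarith [sq_nonneg (kappa z - z.im), sq_nonneg (kappa z), sq_nonneg z.im]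
  have h2 : 2 ≤ √((|z.re| + 2) ^ 2 + z.im ^ 2) := by
    apply Real.le_sqrt_of_sq_le
    nlinarith [abs_nonneg z.re, sq_nonneg z.im]
  have h3 := kappa_add_im_pos hz
  nlinarith

lemma norm_sub_two_mul_le (hz : 0 < z.im) (hre : |z.re| ≤ 5) (him : z.im ≤ 10) :
    ‖z - 2‖ * ‖z + 2‖ ≤ 17 * (kappa z + z.im) := by
  rw [norm_sub_two_mul_norm_add_two]
  have hk : 0 ≤ kappa z := abs_nonneg _
  have h1 : √((|z.re| - 2) ^ 2 + z.im ^ 2) ≤ kappa z + z.im := by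
    apply Real.sqrt_le_iff.2
    have e : (|z.re| - 2) ^ 2 = kappa z ^ 2 := by rw [kappa, sq_abs]
    rw [e]
    exact ⟨by positivity, by nlinarith⟩
  have h2 : √((|z.re| + 2) ^ 2 + z.im ^ 2) ≤ 17 := by
    apply Real.sqrt_le_iff.2
    exact ⟨by norm_num, by nlinarith [abs_nonneg z.re]⟩
  have h3 := kappa_add_im_pos hz
  have := Real.sqrt_nonneg ((|z.re| + 2) ^ 2 + z.im ^ 2)
  nlinarith

lemma norm_le_fifteen (hz : 0 < z.im) (hre : |z.re| ≤ 5) (him : z.im ≤ 10) : ‖z‖ ≤ 15 := by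
  have := Complex.norm_le_abs_re_add_abs_im z
  rw [abs_of_pos hz] at this
  linarith

lemma le_norm_msc_of_bounded (hz : 0 < z.im) (hre : |z.re| ≤ 5) (him : z.im ≤ 10) :
    1 / 16 ≤ ‖msc z‖ := by
  refine le_trans ?_ (le_norm_msc hz)
  have := norm_le_fifteen hz hre him
  exact one_div_le_one_div_of_le (by positivity) (by linarith)

lemma norm_one_sub_msc_sq_sq_le (hz : 0 < z.im) (hre : |z.re| ≤ 5) (him : z.im ≤ 10) :
    ‖1 - msc z ^ 2‖ ^ 2 ≤ 17 * (kappa z + z.im) := by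
  rw [norm_one_sub_msc_sq_sq hz]
  have h1 := norm_sub_two_mul_le hz hre him
  have h2 : ‖msc z‖ ^ 2 ≤ 1 := pow_le_one₀ (norm_nonneg _) (norm_msc_le_one hz)
  have h3 : 0 ≤ ‖z - 2‖ * ‖z + 2‖ := by positivity
  nlinarith

lemma le_norm_one_sub_msc_sq_sq (hz : 0 < z.im) (hre : |z.re| ≤ 5) (him : z.im ≤ 10) :
    (kappa z + z.im) / 256 ≤ ‖1 - msc z ^ 2‖ ^ 2 := by
  rw [norm_one_sub_msc_sq_sq hz]
  have h1 := kappa_add_im_le hz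
  have h2 := le_norm_msc_of_bounded hz hre him
  have h3 : 1 / 256 ≤ ‖msc z‖ ^ 2 := by nlinarith
  have h4 := kappa_add_im_pos hz
  nlinarith

/-- `1 - Re m²` in terms of the modulus and the imaginary part of `m`. -/
lemma one_sub_re_msc_sq (z : ℂ) :
    1 - (msc z ^ 2).re = (1 - ‖msc z‖ ^ 2) + 2 * (msc z).im ^ 2 := by
  rw [← Complex.normSq_eq_norm_sq, Complex.normSq_apply, sq, Complex.mul_re]
  ring

lemma one_sub_re_msc_sq_pos (hz : 0 < z.im) : 0 < 1 - (msc z ^ 2).re := by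
  rw [one_sub_re_msc_sq]
  have h1 : ‖msc z‖ ^ 2 ≤ 1 := pow_le_one₀ (norm_nonneg _) (norm_msc_le_one hz)
  have := msc_im_pos hz
  nlinarith [pow_pos this 2]

lemma abs_re_msc_sq_sub_one (hz : 0 < z.im) : |(msc z ^ 2).re - 1| = 1 - (msc z ^ 2).re := by
  rw [abs_sub_comm, abs_of_pos (one_sub_re_msc_sq_pos hz)]

/-- In polar coordinates `m = r e^{iφ}`, `u = 1 / r - r`, `v = sin φ`: `η = u v`. -/
lemma im_eq_polar (hz : 0 < z.im) :
    z.im = (1 / ‖msc z‖ - ‖msc z‖) * ((msc z).im / ‖msc z‖) := by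
  have h := norm_msc_sq_mul hz
  have hr := norm_msc_pos hz
  field_simp
  linarith

lemma re_sq_eq_polar (hz : 0 < z.im) :
    z.re ^ 2 = (4 + (1 / ‖msc z‖ - ‖msc z‖) ^ 2) * (1 - ((msc z).im / ‖msc z‖) ^ 2) := by
  have hr := norm_msc_pos hz
  have h := congrArg Complex.re (one_div_msc hz)
  rw [one_div, Complex.inv_re, Complex.normSq_eq_norm_sq] at h
  simp only [Complex.sub_re, Complex.neg_re] at h
  have hE : z.re = -((msc z).re * (1 + 1 / ‖msc z‖ ^ 2)) := by
    have : (msc z).re * (1 + 1 / ‖msc z‖ ^ 2) = (msc z).re / ‖msc z‖ ^ 2 + (msc z).re := by ring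
    rw [this]; linarith
  have hn : (msc z).re ^ 2 = ‖msc z‖ ^ 2 - (msc z).im ^ 2 := by
    rw [← Complex.normSq_eq_norm_sq, Complex.normSq_apply]; ring
  rw [hE, neg_sq, mul_pow, hn]
  field_simp
  ring

/-- For fixed `E` the relation `E² = (4 + u²)(1 - v²)` prevents `u` and `v` from moving in opposite
directions, and the growth of `η = u v` then forces both to grow. -/
lemma polar_monotone {w : ℂ} (hz : 0 < z.im) (hre : w.re = z.re) (him : z.im ≤ w.im) :
    1 / ‖msc z‖ - ‖msc z‖ ≤ 1 / ‖msc w‖ - ‖msc w‖ ∧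
      (msc z).im / ‖msc z‖ ≤ (msc w).im / ‖msc w‖ := by
  have hw : 0 < w.im := hz.trans_le him
  have h1 := im_eq_polar hz
  have h2 := im_eq_polar hw
  have h3 := re_sq_eq_polar hz
  have h4 := re_sq_eq_polar hw
  rw [hre] at h4
  have v1 : 0 < (msc z).im / ‖msc z‖ := div_pos (msc_im_pos hz) (norm_msc_pos hz)
  have v2 : 0 < (msc w).im / ‖msc w‖ := div_pos (msc_im_pos hw) (norm_msc_pos hw)
  have v3 : (msc w).im / ‖msc w‖ ≤ 1 := (div_le_one (norm_msc_pos hw)).2 (msc_im_le_norm w)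
  have v4 : (msc z).im / ‖msc z‖ ≤ 1 := (div_le_one (norm_msc_pos hz)).2 (msc_im_le_norm z)
  set u := 1 / ‖msc z‖ - ‖msc z‖
  set v := (msc z).im / ‖msc z‖
  set u' := 1 / ‖msc w‖ - ‖msc w‖
  set v' := (msc w).im / ‖msc w‖
  have u1 : 0 < u := by
    by_contra h
    push Not at h
    nlinarith
  have u2 : 0 < u' := by
    by_contra h
    push Not at h
    nlinarith
  have hu : u ≤ u' := by
    by_contra h
    push Not at h
    have hv : v < v' := by
      by_contra h'
      push Not at h'
      have : u' * v' < u * v := by nlinarith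
      linarith
    have a1 : v ^ 2 < v' ^ 2 := by nlinarith
    have a2 : u' ^ 2 < u ^ 2 := by nlinarith
    have a3 : v' ^ 2 ≤ 1 := by nlinarith
    have : (4 + u' ^ 2) * (1 - v' ^ 2) < (4 + u ^ 2) * (1 - v ^ 2) := by nlinarith
    linarith
  refine ⟨hu, ?_⟩
  by_contra h
  push Not at h
  have a1 : v' ^ 2 < v ^ 2 := by nlinarith
  have a2 : u ^ 2 ≤ u' ^ 2 := by nlinarith
  have a3 : v ^ 2 ≤ 1 := by nlinarith
  have : (4 + u ^ 2) * (1 - v ^ 2) < (4 + u' ^ 2) * (1 - v' ^ 2) := by nlinarith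
  linarith

/-- In polar coordinates `1 - Re m² = r u + 2 r² v²`, where `u` and `v` are monotone in the height
and `1/16 ≤ r ≤ 1`; the constant is `16²`. -/
lemma one_sub_re_msc_sq_le {w : ℂ} (hz : 0 < z.im) (hre : w.re = z.re) (him : z.im ≤ w.im)
    (hre' : |w.re| ≤ 5) (him' : w.im ≤ 10) :
    1 - (msc z ^ 2).re ≤ 256 * (1 - (msc w ^ 2).re) := by
  have hw : 0 < w.im := hz.trans_le him
  obtain ⟨hu, hv⟩ := polar_monotone hz hre him
  have hr1 := norm_msc_le_one hz
  have hr0 := norm_msc_pos hz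
  have hr' := le_norm_msc_of_bounded hw hre' him'
  have v1 : 0 < (msc z).im / ‖msc z‖ := div_pos (msc_im_pos hz) (norm_msc_pos hz)
  have key : ∀ w : ℂ, 0 < w.im → 1 - (msc w ^ 2).re = ‖msc w‖ * (1 / ‖msc w‖ - ‖msc w‖)
      + 2 * ‖msc w‖ ^ 2 * ((msc w).im / ‖msc w‖) ^ 2 := fun w hw => by
    rw [one_sub_re_msc_sq]
    have := norm_msc_pos hw
    field_simp
  rw [key z hz, key w hw]
  have hu0 : 0 ≤ 1 / ‖msc z‖ - ‖msc z‖ := by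
    have : 1 ≤ 1 / ‖msc z‖ := by rw [le_div_iff₀ hr0]; linarith
    linarith
  set u := 1 / ‖msc z‖ - ‖msc z‖
  set v := (msc z).im / ‖msc z‖
  set u' := 1 / ‖msc w‖ - ‖msc w‖
  set v' := (msc w).im / ‖msc w‖
  set r := ‖msc z‖
  set r' := ‖msc w‖
  have a1 : r * u ≤ 16 * (r' * u') := by nlinarith
  have a2 : r ^ 2 * v ^ 2 ≤ 256 * (r' ^ 2 * v' ^ 2) := by
    have b1 : r * v ≤ 16 * (r' * v') := by nlinarith
    have b2 : 0 ≤ r * v := by positivity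
    nlinarith
  have a3 : 0 ≤ r' * u' := by nlinarith
  nlinarith

/-- Up to a constant `θ` does not increase upwards, so smallness at `z` serves along the whole
vertical line of the bootstrap. -/
lemma theta_le {w : ℂ} {δp : ℝ} (hδ : 0 ≤ δp) (hz : 0 < z.im) (hre : w.re = z.re)
    (him : z.im ≤ w.im) (hre' : |w.re| ≤ 5) (him' : w.im ≤ 10) :
    theta δp w ≤ 256 * theta δp z := by
  have hw : 0 < w.im := hz.trans_le him
  have h1 : ‖1 - msc z ^ 2‖ ≤ 256 * ‖1 - msc w ^ 2‖ := by
    have a1 := norm_one_sub_msc_sq_sq_le hz (hre ▸ hre') (him.trans him')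
    have a2 := le_norm_one_sub_msc_sq_sq hw hre' him'
    have a3 : kappa w = kappa z := by rw [kappa, kappa, hre]
    rw [a3] at a2
    refine le_of_sq_le_sq ?_ (by positivity)
    nlinarith
  have h2 : max δp |(msc z ^ 2).re - 1| ≤ 256 * max δp |(msc w ^ 2).re - 1| := by
    rw [abs_re_msc_sq_sub_one hz, abs_re_msc_sq_sub_one hw]
    have a1 := one_sub_re_msc_sq_le hz hre him hre' him'
    have a2 := le_max_left δp (1 - (msc w ^ 2).re)
    have a3 := le_max_right δp (1 - (msc w ^ 2).re)
    exact max_le (by linarith) (by linarith)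
  have p1 := norm_one_sub_msc_sq_pos hz
  have p2 := norm_one_sub_msc_sq_pos hw
  have p3 : 0 < max δp |(msc z ^ 2).re - 1| := lt_max_of_lt_right (by
    rw [abs_re_msc_sq_sub_one hz]; exact one_sub_re_msc_sq_pos hz)
  have p4 : 0 < max δp |(msc w ^ 2).re - 1| := lt_max_of_lt_right (by
    rw [abs_re_msc_sq_sub_one hw]; exact one_sub_re_msc_sq_pos hw)
  have q1 : 1 / ‖1 - msc w ^ 2‖ ≤ 256 * (1 / ‖1 - msc z ^ 2‖) := by
    rw [mul_one_div, div_le_div_iff₀ p2 p1]; linarith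
  have q2 : 1 / max δp |(msc w ^ 2).re - 1| ≤ 256 * (1 / max δp |(msc z ^ 2).re - 1|) := by
    rw [mul_one_div, div_le_div_iff₀ p4 p3]; linarith
  rw [theta, theta]
  linarith

lemma one_div_le_theta {δp : ℝ} (hδ : 0 ≤ δp) (z : ℂ) :
    1 / ‖1 - msc z ^ 2‖ ≤ theta δp z :=
  le_add_of_nonneg_right (one_div_nonneg.2 (le_max_of_le_left hδ))

lemma half_le_theta {δp : ℝ} (hδ : 0 ≤ δp) (hz : 0 < z.im) : 1 / 2 ≤ theta δp z :=
  (one_div_le_one_div_of_le (norm_one_sub_msc_sq_pos hz)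
    (norm_one_sub_msc_sq_le_two hz)).trans (one_div_le_theta hδ z)

/-- Subtracting the two equations gives `(1 - m m')(m - m') = m m' (z - w)`, and `|m m'| ≤ 1 / (1 +
η)` keeps the first factor away from zero. -/
lemma norm_msc_sub_le {w : ℂ} {η : ℝ} (hη : 0 < η) (hz : η ≤ z.im) (hw : η ≤ w.im) :
    ‖msc z - msc w‖ ≤ (1 + η) / η * ‖z - w‖ := by
  have hz0 := hη.trans_le hz
  have hw0 := hη.trans_le hw
  have e : (1 - msc z * msc w) * (msc z - msc w) = msc z * msc w * (z - w) := by
    linear_combination msc z * msc_mul_add hw0 - msc w * msc_mul_add hz0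
  have h := congrArg norm e
  rw [norm_mul, norm_mul, norm_mul] at h
  have a1 := norm_msc_sq_le hz0
  have a2 := norm_msc_sq_le hw0
  have b1 : ‖msc z‖ ^ 2 * (1 + η) ≤ 1 := by nlinarith [sq_nonneg ‖msc z‖]
  have b2 : ‖msc w‖ ^ 2 * (1 + η) ≤ 1 := by nlinarith [sq_nonneg ‖msc w‖]
  have b3 : ‖msc z‖ * ‖msc w‖ * (1 + η) ≤ 1 := by
    nlinarith [sq_nonneg (‖msc z‖ - ‖msc w‖)]
  have b4 : 1 - ‖msc z‖ * ‖msc w‖ ≤ ‖1 - msc z * msc w‖ := by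
    have := norm_sub_norm_le 1 (msc z * msc w)
    rwa [norm_one, norm_mul] at this
  have b5 : η / (1 + η) ≤ ‖1 - msc z * msc w‖ := by
    refine le_trans ?_ b4
    rw [div_le_iff₀ (by positivity)]
    nlinarith
  have b6 : ‖msc z‖ * ‖msc w‖ ≤ 1 := by
    have := norm_msc_le_one hz0
    have := norm_msc_le_one hw0
    nlinarith [norm_nonneg (msc z), norm_nonneg (msc w)]
  have b7 : η / (1 + η) * ‖msc z - msc w‖ ≤ ‖z - w‖ := by
    calc _ ≤ ‖1 - msc z * msc w‖ * ‖msc z - msc w‖ := by gcongr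
      _ = ‖msc z‖ * ‖msc w‖ * ‖z - w‖ := h
      _ ≤ 1 * ‖z - w‖ := by gcongr
      _ = _ := one_mul _
  rw [div_mul_eq_mul_div, le_div_iff₀ hη]
  rw [div_mul_eq_mul_div, div_le_iff₀ (by positivity)] at b7
  linarith

end Semicircle

/-! ### Inverting `1 - m² Σ` in the maximum norm -/

section Stability

/-- A doubly stochastic symmetric matrix with simple eigenvalue `1` and remaining spectrum in
`[-1 + δ₋, 1 - δ₊]`. -/
structure IsGappedStochastic {N : ℕ} (S : Matrix (Fin N) (Fin N) ℝ) (δm δp : ℝ) : Prop where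
  symm : ∀ i j, S i j = S j i
  nonneg : ∀ i j, 0 ≤ S i j
  sum_one : ∀ j, ∑ i, S i j = 1
  simple_one : Module.finrank ℝ (Module.End.eigenspace (Matrix.toLin' S) 1) = 1
  spectrum_subset : spectrum ℝ S ⊆ Set.Icc (-1 + δm) (1 - δp) ∪ {1}

variable {N : ℕ} {S : Matrix (Fin N) (Fin N) ℝ} {δm δp : ℝ}

lemma IsGappedStochastic.sum_one' (hS : IsGappedStochastic S δm δp) (i : Fin N) :
    ∑ j, S i j = 1 := by
  rw [← hS.sum_one i]
  exact Finset.sum_congr rfl fun j _ => hS.symm i j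

lemma IsGappedStochastic.isHermitian (hS : IsGappedStochastic S δm δp) : S.IsHermitian := by
  ext i j
  simpa using hS.symm j i

/-- For `l ≤ 0` the gap at `-1` gives `|1 + w l| ≤ 2 - δ₋`. For `l ≥ 0`, `|1 + w l|² ≤ (1 + l)² - 2
l (1 - Re w)`, which gains from `1 - l ≥ δ₊` or from `1 - Re w`, whichever is larger. -/
lemma norm_one_add_mul_le {w : ℂ} (hw : ‖w‖ ≤ 1) {l : ℝ} (hδm : 0 < δm) (hδp : 0 ≤ δp)
    (hl : l ∈ Set.Icc (-1 + δm) (1 - δp)) {c : ℝ} (hc0 : 0 ≤ c) (hc1 : c ≤ δm / 4)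
    (hc2 : c ≤ 1 / 16) :
    ‖1 + w * l‖ ^ 2 ≤ 4 * (1 - c * max δp (1 - w.re)) ^ 2 := by
  obtain ⟨h1, h2⟩ := hl
  have hre := (abs_le.1 (Complex.abs_re_le_norm w))
  have hτ2 : max δp (1 - w.re) ≤ 2 := max_le (by linarith) (by linarith [hre.1])
  have hτ0 : 0 ≤ max δp (1 - w.re) := le_max_of_le_left hδp
  set τ := max δp (1 - w.re) with hτ
  have hcτ : c * τ ≤ c * 2 := mul_le_mul_of_nonneg_left hτ2 hc0
  have hcτ0 : 0 ≤ c * τ := mul_nonneg hc0 hτ0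
  rcases le_total l 0 with h | h
  · have h3 : ‖1 + w * l‖ ≤ 2 - δm := by
      refine (norm_add_le _ _).trans ?_
      rw [norm_one, norm_mul, Complex.norm_real, Real.norm_eq_abs, abs_of_nonpos h]
      nlinarith [norm_nonneg w]
    have h4 : ‖1 + w * l‖ ≤ 2 * (1 - c * τ) := by linarith
    nlinarith [norm_nonneg (1 + w * l)]
  · have e : ‖1 + w * l‖ ^ 2 = 1 + 2 * l * w.re + l ^ 2 * ‖w‖ ^ 2 := by
      rw [← Complex.normSq_eq_norm_sq, ← Complex.normSq_eq_norm_sq, Complex.normSq_apply,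
        Complex.normSq_apply]
      simp
      ring
    have hw2 : ‖w‖ ^ 2 ≤ 1 := pow_le_one₀ (norm_nonneg _) hw
    have h3 : ‖1 + w * l‖ ^ 2 ≤ (1 + l) ^ 2 - 2 * l * (1 - w.re) := by
      rw [e]; nlinarith [sq_nonneg l]
    have h4 : ‖1 + w * l‖ ^ 2 ≤ 4 - 8 * (c * τ) := by
      rcases le_total l (1 / 2) with h5 | h5
      · nlinarith [hre.2]
      · have h6 : c * τ ≤ 1 / 16 * τ := mul_le_mul_of_nonneg_right hc2 hτ0
        have h7 : ‖1 + w * l‖ ^ 2 ≤ 4 - τ := by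
          rcases max_choice δp (1 - w.re) with h8 | h8
          · rw [hτ, h8]; nlinarith [hre.2]
          · rw [hτ, h8]; nlinarith [hre.2]
        linarith
    nlinarith [sq_nonneg (c * τ)]

lemma sum_sq_eq_sum_sq_dotProduct (hS : S.IsHermitian) (a : Fin N → ℝ) :
    ∑ i, a i ^ 2 = ∑ k, (∑ i, hS.eigenvectorBasis k i * a i) ^ 2 := by
  have h := hS.eigenvectorBasis.sum_sq_norm_inner_right (WithLp.toLp 2 a)
  rw [EuclideanSpace.norm_sq_eq] at h
  simp only [PiLp.inner_apply, Real.norm_eq_abs, sq_abs] at h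
  rw [← h]
  refine Finset.sum_congr rfl fun k _ => ?_
  congr 1
  refine Finset.sum_congr rfl fun i _ => ?_
  simp [mul_comm]

lemma dotProduct_eigenvector_mulVec (hS : S.IsHermitian) (a : Fin N → ℝ) (k : Fin N) :
    ∑ i, hS.eigenvectorBasis k i * ∑ j, S i j * a j
      = hS.eigenvalues k * ∑ i, hS.eigenvectorBasis k i * a i := by
  have h := hS.mulVec_eigenvectorBasis k
  have h1 : ∀ j, ∑ i, S j i * hS.eigenvectorBasis k i
      = hS.eigenvalues k * hS.eigenvectorBasis k j := fun j => by
    have := congrFun h j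
    simpa [Matrix.mulVec, dotProduct] using this
  simp only [Finset.mul_sum]
  rw [Finset.sum_comm]
  refine Finset.sum_congr rfl fun j _ => ?_
  rw [← mul_assoc, ← h1 j, Finset.sum_mul]
  refine Finset.sum_congr rfl fun i _ => ?_
  have : S i j = S j i := by simpa using (hS.apply i j).symm
  rw [this]
  ring

/-- The constant vector is an eigenvector for `1`, and the eigenspace is one-dimensional. -/
lemma IsGappedStochastic.eigenvector_of_one (hS : IsGappedStochastic S δm δp) {u : Fin N → ℝ}
    (hu : S.mulVec u = u) : ∃ c : ℝ, ∀ i, u i = c := by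
  obtain hN | hN := isEmpty_or_nonempty (Fin N)
  · exact ⟨0, fun i => hN.elim i⟩
  set E := Module.End.eigenspace (Matrix.toLin' S) 1
  have h1 : (fun _ => 1 : Fin N → ℝ) ∈ E := by
    rw [Module.End.mem_eigenspace_iff, Matrix.toLin'_apply, one_smul]
    ext i
    simp [Matrix.mulVec, dotProduct, hS.sum_one']
  have h2 : u ∈ E := by
    rw [Module.End.mem_eigenspace_iff, Matrix.toLin'_apply, one_smul, hu]
  have hne : (⟨_, h1⟩ : E) ≠ 0 := by
    intro h
    have := congrFun (congrArg Subtype.val h) hN.some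
    simp at this
  obtain ⟨c, hc⟩ := (finrank_eq_one_iff_of_nonzero' _ hne).1 hS.simple_one ⟨u, h2⟩
  refine ⟨c, fun i => ?_⟩
  have := congrFun (congrArg Subtype.val hc) i
  simpa using this.symm

/-- One step of the averaged dynamics. -/
noncomputable def halfStep (S : Matrix (Fin N) (Fin N) ℝ) (w : ℂ) (v : Fin N → ℂ) : Fin N → ℂ :=
  fun i => (v i + w * ∑ j, S i j * v j) / 2

lemma sum_norm_sq_eq (v : Fin N → ℂ) :
    ∑ i, ‖v i‖ ^ 2 = ∑ i, (v i).re ^ 2 + ∑ i, (v i).im ^ 2 := by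
  rw [← Finset.sum_add_distrib]
  refine Finset.sum_congr rfl fun i _ => ?_
  rw [← Complex.normSq_eq_norm_sq, Complex.normSq_apply]
  ring

/-- In a real eigenbasis of `S` the step multiplies by `(1 + w l) / 2`. Averaging with the identity
matters: `|w l|` may be close to `1`, but `|1 + w l|` is close to `2` only if `w l` is close to `1`.
The mean-zero condition removes the eigenvalue `1`, whose eigenvectors are constant. -/
lemma IsGappedStochastic.sum_norm_sq_halfStep_le (hS : IsGappedStochastic S δm δp) {w : ℂ}
    (hw : ‖w‖ ≤ 1) (hδm : 0 < δm) (hδp : 0 ≤ δp) {c : ℝ} (hc0 : 0 ≤ c) (hc1 : c ≤ δm / 4)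
    (hc2 : c ≤ 1 / 16) {v : Fin N → ℂ} (hv : ∑ i, v i = 0) :
    ∑ i, ‖halfStep S w v i‖ ^ 2 ≤ (1 - c * max δp (1 - w.re)) ^ 2 * ∑ i, ‖v i‖ ^ 2 := by
  have hH := hS.isHermitian
  set a : Fin N → ℝ := fun i => (v i).re with ha
  set b : Fin N → ℝ := fun i => (v i).im with hb
  have hre : ∀ i, (halfStep S w v i).re
      = (a i + w.re * ∑ j, S i j * a j - w.im * ∑ j, S i j * b j) / 2 := fun i => by
    have : (2 : ℂ) = ((2 : ℝ) : ℂ) := by norm_num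
    rw [halfStep, this, Complex.div_ofReal_re]
    simp [ha, hb]
    ring
  have him : ∀ i, (halfStep S w v i).im
      = (b i + w.re * ∑ j, S i j * b j + w.im * ∑ j, S i j * a j) / 2 := fun i => by
    have : (2 : ℂ) = ((2 : ℝ) : ℂ) := by norm_num
    rw [halfStep, this, Complex.div_ofReal_im]
    simp [ha, hb]
    ring
  rw [sum_norm_sq_eq, sum_norm_sq_eq,
    sum_sq_eq_sum_sq_dotProduct hH fun i => (halfStep S w v i).re,
    sum_sq_eq_sum_sq_dotProduct hH fun i => (halfStep S w v i).im,
    sum_sq_eq_sum_sq_dotProduct hH fun i => (v i).re,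
    sum_sq_eq_sum_sq_dotProduct hH fun i => (v i).im, ← Finset.sum_add_distrib,
    ← Finset.sum_add_distrib, Finset.mul_sum]
  refine Finset.sum_le_sum fun k _ => ?_
  set u := hH.eigenvectorBasis k with hu
  set l := hH.eigenvalues k with hl
  set α := ∑ i, u i * a i with hα
  set β := ∑ i, u i * b i with hβ
  have ea := dotProduct_eigenvector_mulVec hH a k
  have eb := dotProduct_eigenvector_mulVec hH b k
  have e1 : ∑ i, u i * (halfStep S w v i).re = (α + w.re * (l * α) - w.im * (l * β)) / 2 := by
    rw [← ea, ← eb, hα]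
    simp only [hre]
    rw [Finset.mul_sum, Finset.mul_sum, ← Finset.sum_add_distrib, ← Finset.sum_sub_distrib,
      Finset.sum_div]
    exact Finset.sum_congr rfl fun i _ => by ring
  have e2 : ∑ i, u i * (halfStep S w v i).im = (β + w.re * (l * β) + w.im * (l * α)) / 2 := by
    rw [← ea, ← eb, hβ]
    simp only [him]
    rw [Finset.mul_sum, Finset.mul_sum, ← Finset.sum_add_distrib, ← Finset.sum_add_distrib,
      Finset.sum_div]
    exact Finset.sum_congr rfl fun i _ => by ring
  rw [e1, e2]
  have e3 : ((α + w.re * (l * α) - w.im * (l * β)) / 2) ^ 2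
      + ((β + w.re * (l * β) + w.im * (l * α)) / 2) ^ 2 = ‖1 + w * l‖ ^ 2 / 4 * (α ^ 2 + β ^ 2) := by
    rw [← Complex.normSq_eq_norm_sq, Complex.normSq_apply]
    simp
    ring
  rw [e3]
  rcases hS.spectrum_subset (hH.eigenvalues_mem_spectrum_real k) with h | h
  · have := norm_one_add_mul_le hw hδm hδp h hc0 hc1 hc2
    refine mul_le_mul_of_nonneg_right ?_ (by positivity)
    linarith
  · have hl1 : hH.eigenvalues k = 1 := h
    have hmul := hH.mulVec_eigenvectorBasis k
    rw [hl1, one_smul] at hmul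
    obtain ⟨t, ht⟩ := hS.eigenvector_of_one hmul
    have hα0 : α = 0 := by
      have := congrArg Complex.re hv
      simp only [Complex.re_sum, Complex.zero_re] at this
      rw [hα]
      simp only [hu, ht, ← Finset.mul_sum]
      simp [ha, this]
    have hβ0 : β = 0 := by
      have := congrArg Complex.im hv
      simp only [Complex.im_sum, Complex.zero_im] at this
      rw [hβ]
      simp only [hu, ht, ← Finset.mul_sum]
      simp [hb, this]
    rw [hα0, hβ0]
    simp

lemma IsGappedStochastic.norm_halfStep_le (hS : IsGappedStochastic S δm δp) {w : ℂ}
    (hw : ‖w‖ ≤ 1) (v : Fin N → ℂ) : ‖halfStep S w v‖ ≤ ‖v‖ := by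
  refine (pi_norm_le_iff_of_nonneg (norm_nonneg v)).2 fun i => ?_
  have h1 : ‖∑ j, (S i j : ℂ) * v j‖ ≤ ‖v‖ := by
    refine (norm_sum_le _ _).trans ?_
    calc ∑ j, ‖(S i j : ℂ) * v j‖ ≤ ∑ j, S i j * ‖v‖ := by
          refine Finset.sum_le_sum fun j _ => ?_
          rw [norm_mul, Complex.norm_real, Real.norm_of_nonneg (hS.nonneg i j)]
          exact mul_le_mul_of_nonneg_left (norm_le_pi_norm v j) (hS.nonneg i j)
      _ = ‖v‖ := by rw [← Finset.sum_mul, hS.sum_one', one_mul]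
  rw [halfStep, norm_div]
  have h2 : ‖v i + w * ∑ j, (S i j : ℂ) * v j‖ ≤ ‖v‖ + ‖v‖ := by
    refine (norm_add_le _ _).trans (add_le_add (norm_le_pi_norm v i) ?_)
    rw [norm_mul]
    calc _ ≤ 1 * ‖v‖ := mul_le_mul hw h1 (norm_nonneg _) zero_le_one
      _ = _ := one_mul _
  rw [Complex.norm_ofNat]
  linarith

lemma IsGappedStochastic.sum_mulVec (hS : IsGappedStochastic S δm δp) (v : Fin N → ℂ) :
    ∑ i, ∑ j, (S i j : ℂ) * v j = ∑ j, v j := by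
  rw [Finset.sum_comm]
  refine Finset.sum_congr rfl fun j _ => ?_
  rw [← Finset.sum_mul]
  have := congrArg (fun x : ℝ => (x : ℂ)) (hS.sum_one j)
  push_cast at this
  rw [this, one_mul]

lemma IsGappedStochastic.sum_halfStep (hS : IsGappedStochastic S δm δp) (w : ℂ) {v : Fin N → ℂ}
    (hv : ∑ i, v i = 0) : ∑ i, halfStep S w v i = 0 := by
  simp only [halfStep]
  rw [← Finset.sum_div, Finset.sum_add_distrib, ← Finset.mul_sum, hS.sum_mulVec, hv]
  simp

lemma halfStep_sub (w : ℂ) (v v' : Fin N → ℂ) :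
    halfStep S w (v - v') = halfStep S w v - halfStep S w v' := by
  ext i
  simp only [halfStep, Pi.sub_apply, mul_sub, Finset.sum_sub_distrib]
  ring

lemma norm_le_sqrt_sum_sq (v : Fin N → ℂ) : ‖v‖ ≤ √(∑ i, ‖v i‖ ^ 2) := by
  refine (pi_norm_le_iff_of_nonneg (Real.sqrt_nonneg _)).2 fun i => ?_
  apply Real.le_sqrt_of_sq_le
  exact Finset.single_le_sum (f := fun i => ‖v i‖ ^ 2) (fun _ _ => by positivity)
    (Finset.mem_univ i)

lemma sqrt_sum_sq_le (v : Fin N → ℂ) : √(∑ i, ‖v i‖ ^ 2) ≤ √N * ‖v‖ := by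
  apply Real.sqrt_le_iff.2
  refine ⟨by positivity, ?_⟩
  calc ∑ i, ‖v i‖ ^ 2 ≤ ∑ _i : Fin N, ‖v‖ ^ 2 :=
        Finset.sum_le_sum fun i _ => pow_le_pow_left₀ (norm_nonneg _) (norm_le_pi_norm v i) 2
    _ = _ := by rw [mul_pow, Real.sq_sqrt (by positivity)]; simp

lemma norm_sub_iterate_le {f : (Fin N → ℂ) → Fin N → ℂ} (hf : ∀ v, ‖f v‖ ≤ ‖v‖)
    (hsub : ∀ v v', f (v - v') = f v - f v') (v : Fin N → ℂ) (K : ℕ) :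
    ‖v - f^[K] v‖ ≤ K * ‖v - f v‖ := by
  induction K with
  | zero => simp
  | succ K ih =>
    have h1 : ∀ K : ℕ, ‖f^[K] v - f^[K + 1] v‖ ≤ ‖v - f v‖ := fun K => by
      induction K with
      | zero => simp
      | succ K ih =>
        rw [Function.iterate_succ_apply', Function.iterate_succ_apply' f (K + 1), ← hsub]
        exact (hf _).trans ih
    have : v - f^[K + 1] v = (v - f^[K] v) + (f^[K] v - f^[K + 1] v) := by ring
    rw [this]
    refine (norm_add_le _ _).trans ?_
    push_cast
    linarith [h1 K]

/-- Stability of `1 - w S` in the maximum norm on vectors of mean zero. -/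
lemma IsGappedStochastic.norm_le_of_sum_zero (hS : IsGappedStochastic S δm δp) {w : ℂ}
    (hw : ‖w‖ ≤ 1) (hδm : 0 < δm) (hδp : 0 ≤ δp) {c : ℝ} (hc0 : 0 < c) (hc1 : c ≤ δm / 4)
    (hc2 : c ≤ 1 / 16) (hτ : 0 < max δp (1 - w.re)) (hτ2 : c * max δp (1 - w.re) ≤ 1)
    (hN : 4 ≤ N) {v : Fin N → ℂ} (hv : ∑ i, v i = 0) {ρ : ℝ} (hρ : 0 ≤ ρ)
    (h : ∀ i, ‖v i - w * ∑ j, S i j * v j‖ ≤ ρ) :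
    ‖v‖ ≤ (Real.log N / (c * max δp (1 - w.re)) + 1) * ρ := by
  set τ := max δp (1 - w.re) with hτdef
  set f := halfStep S w with hf
  have hN0 : (0 : ℝ) < N := by exact_mod_cast (by omega : 0 < N)
  have hcτ : 0 < c * τ := mul_pos hc0 hτ
  -- After this many steps the `ℓ²` norm has shrunk by `1 / N`, which beats the loss `√N` in passing
  -- between the `ℓ²` and maximum norms.
  set K := ⌈Real.log N / (c * τ)⌉₊ with hK
  have hK1 : Real.log N / (c * τ) ≤ K := Nat.le_ceil _
  have hK2 : (K : ℝ) ≤ Real.log N / (c * τ) + 1 :=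
    (Nat.ceil_lt_add_one (div_nonneg (Real.log_natCast_nonneg N) hcτ.le)).le
  have hit : ∀ K : ℕ, ∑ i, f^[K] v i = 0 ∧
      ∑ i, ‖f^[K] v i‖ ^ 2 ≤ ((1 - c * τ) ^ K) ^ 2 * ∑ i, ‖v i‖ ^ 2 := fun K => by
    induction K with
    | zero => simpa using hv
    | succ K ih =>
      rw [Function.iterate_succ_apply']
      refine ⟨hS.sum_halfStep w ih.1, ?_⟩
      refine (hS.sum_norm_sq_halfStep_le hw hδm hδp hc0.le hc1 hc2 ih.1).trans ?_
      refine (mul_le_mul_of_nonneg_left ih.2 (sq_nonneg (1 - c * τ))).trans (le_of_eq ?_)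
      ring
  have h1 : ‖f^[K] v‖ ≤ 1 / 2 * ‖v‖ := by
    refine (norm_le_sqrt_sum_sq _).trans ((Real.sqrt_le_sqrt (hit K).2).trans ?_)
    rw [Real.sqrt_mul (sq_nonneg _), Real.sqrt_sq (pow_nonneg (by linarith) _)]
    have a1 : (1 - c * τ) ^ K ≤ 1 / N := by
      have b1 : 1 - c * τ ≤ Real.exp (-(c * τ)) := by
        have := Real.add_one_le_exp (-(c * τ)); linarith
      have b2 := pow_le_pow_left₀ (by linarith) b1 K
      refine b2.trans ?_
      have b3 : 1 / (N : ℝ) = Real.exp (-Real.log N) := by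
        rw [Real.exp_neg, Real.exp_log hN0, one_div]
      rw [← Real.exp_nat_mul, b3]
      apply Real.exp_le_exp.2
      rw [div_le_iff₀ hcτ] at hK1
      linarith
    have a2 := sqrt_sum_sq_le v
    have a3 : √(N : ℝ) / N ≤ 1 / 2 := by
      rw [div_le_iff₀ hN0]
      have b1 : 2 ≤ √(N : ℝ) := Real.le_sqrt_of_sq_le (by
        have : (4 : ℝ) ≤ N := by exact_mod_cast hN
        linarith)
      have b2 := Real.mul_self_sqrt hN0.le
      nlinarith
    calc _ ≤ 1 / N * (√N * ‖v‖) := by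
          refine mul_le_mul a1 a2 (Real.sqrt_nonneg _) (by positivity)
      _ = √N / N * ‖v‖ := by ring
      _ ≤ _ := by gcongr
  -- Each step also contracts the maximum norm weakly, so `v - f^K v` telescopes to at most `K ‖v -
  -- f v‖ ≤ K ρ / 2`, while `‖f^K v‖ ≤ ‖v‖ / 2` is absorbed.
  have h2 := norm_sub_iterate_le (fun v => hS.norm_halfStep_le hw v) (halfStep_sub w) v K
  have h3 : ‖v - f v‖ ≤ ρ / 2 := by
    refine (pi_norm_le_iff_of_nonneg (by positivity)).2 fun i => ?_
    have : (v - f v) i = (v i - w * ∑ j, S i j * v j) / 2 := by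
      simp only [hf, halfStep, Pi.sub_apply]; ring
    rw [this, norm_div, Complex.norm_ofNat]
    linarith [h i]
  have h4 : ‖v‖ ≤ ‖v - f^[K] v‖ + ‖f^[K] v‖ := by
    have := norm_add_le (v - f^[K] v) (f^[K] v)
    simpa using this
  have h5 : (K : ℝ) * ‖v - f v‖ ≤ K * (ρ / 2) := by gcongr
  have h6 : (K : ℝ) * ρ ≤ (Real.log N / (c * τ) + 1) * ρ := by gcongr
  linarith

/-- The constant in the stability estimate. -/
noncomputable def stabilityConst (δm : ℝ) : ℝ := 8 / min (δm / 4) (1 / 16)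

lemma one_le_stabilityConst (hδm : 0 < δm) : 1 ≤ stabilityConst δm := by
  have h1 : min (δm / 4) (1 / 16) ≤ 1 / 16 := min_le_right _ _
  have h2 : 0 < min (δm / 4) (1 / 16) := lt_min (by linarith) (by norm_num)
  rw [stabilityConst, le_div_iff₀ h2]
  linarith

/-- Stability of `1 - m² S` in the maximum norm. -/
theorem IsGappedStochastic.norm_le (hS : IsGappedStochastic S δm δp) {z : ℂ} (hz : 0 < z.im)
    (hδm : 0 < δm) (hδp : 0 ≤ δp) (hδp2 : δp ≤ 2) (hN : 4 ≤ N) (hL : 1 ≤ Real.log N)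
    {v : Fin N → ℂ} {ρ : ℝ}
    (h : ∀ i, ‖v i - msc z ^ 2 * ∑ j, S i j * v j‖ ≤ ρ) (i : Fin N) :
    ‖v i‖ ≤ stabilityConst δm * Real.log N * theta δp z * ρ := by
  set w := msc z ^ 2 with hw
  have hρ : 0 ≤ ρ := (norm_nonneg _).trans (h i)
  have hw1 : ‖w‖ ≤ 1 := by
    rw [hw, norm_pow]; exact pow_le_one₀ (norm_nonneg _) (norm_msc_le_one hz)
  have hN0 : (0 : ℝ) < N := by exact_mod_cast (by omega : 0 < N)
  have hN0' : (N : ℂ) ≠ 0 := by exact_mod_cast hN0.ne'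
  have hw2 := norm_one_sub_msc_sq_pos hz
  rw [← hw] at hw2
  -- Since `S` preserves means, the mean solves a scalar equation with coefficient `1 - m²` (the
  -- first term of `θ`), and the rest has mean zero (the second term).
  set vbar : ℂ := (∑ i, v i) / N with hvbar
  have hmean : (1 - w) * vbar = (∑ i, (v i - w * ∑ j, S i j * v j)) / N := by
    rw [Finset.sum_sub_distrib, ← Finset.mul_sum, hS.sum_mulVec, hvbar]
    ring
  have hrbar : ‖(1 - w) * vbar‖ ≤ ρ := by
    rw [hmean, norm_div, Complex.norm_natCast, div_le_iff₀ hN0]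
    refine (norm_sum_le _ _).trans ((Finset.sum_le_sum fun i _ => h i).trans ?_)
    simp [mul_comm]
  have hvb : ‖vbar‖ ≤ 1 / ‖1 - w‖ * ρ := by
    rw [norm_mul] at hrbar
    rw [one_div_mul_eq_div, le_div_iff₀ hw2]
    linarith
  set c := min (δm / 4) (1 / 16) with hc
  have hc0 : 0 < c := lt_min (by linarith) (by norm_num)
  have hτeq : max δp |w.re - 1| = max δp (1 - w.re) := by
    rw [hw, abs_re_msc_sq_sub_one hz]
  have hτ : 0 < max δp (1 - w.re) := lt_max_of_lt_right (one_sub_re_msc_sq_pos hz)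
  have hre := (abs_le.1 (Complex.abs_re_le_norm w))
  have hτ2 : max δp (1 - w.re) ≤ 2 := max_le hδp2 (by linarith [hre.1])
  set τ := max δp (1 - w.re) with hτdef
  have hc16 : c ≤ 1 / 16 := min_le_right _ _
  have hcτ : 0 < c * τ := mul_pos hc0 hτ
  have hcτ1 : c * τ ≤ 1 := by nlinarith
  set u : Fin N → ℂ := fun i => v i - vbar with hu
  have husum : ∑ i, u i = 0 := by
    simp only [hu, Finset.sum_sub_distrib, Finset.sum_const, Finset.card_univ, Fintype.card_fin,
      nsmul_eq_mul, hvbar]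
    field_simp
    ring
  have hueq : ∀ i, u i - w * ∑ j, S i j * u j
      = (v i - w * ∑ j, S i j * v j) - (1 - w) * vbar := fun i => by
    have hone : ∑ j, (S i j : ℂ) = 1 := by
      have := congrArg (fun x : ℝ => (x : ℂ)) (hS.sum_one' i)
      push_cast at this
      exact this
    simp only [hu, mul_sub, Finset.sum_sub_distrib, ← Finset.sum_mul, hone]
    ring
  have hub := hS.norm_le_of_sum_zero hw1 hδm hδp hc0 (min_le_left _ _) hc16 hτ hcτ1 hN husum
    (ρ := 2 * ρ) (by positivity) fun i => by
      rw [hueq]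
      refine (norm_sub_le _ _).trans ?_
      linarith [h i]
  have hui : ‖u i‖ ≤ (Real.log N / (c * τ) + 1) * (2 * ρ) := (norm_le_pi_norm u i).trans hub
  have hvi : ‖v i‖ ≤ ‖u i‖ + ‖vbar‖ := by
    have := norm_add_le (u i) vbar
    simpa [hu] using this
  have h1 : Real.log N / (c * τ) + 1 ≤ 2 * (Real.log N / (c * τ)) := by
    have : 1 ≤ Real.log N / (c * τ) := by rw [le_div_iff₀ hcτ]; linarith
    linarith
  have h2 : 1 / ‖1 - w‖ ≤ 8 / c * Real.log N * (1 / ‖1 - w‖) := by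
    have : 1 ≤ 8 / c * Real.log N := by
      have : 1 ≤ 8 / c := by rw [le_div_iff₀ hc0]; linarith
      nlinarith
    exact le_mul_of_one_le_left (by positivity) this
  have h3 : 2 * (Real.log N / (c * τ)) * (2 * ρ) ≤ 8 / c * Real.log N * (1 / τ) * ρ := by
    have : 2 * (Real.log N / (c * τ)) * (2 * ρ) = 4 / c * Real.log N * (1 / τ) * ρ := by
      field_simp; ring
    rw [this]
    gcongr
    norm_num
  have h4 : (Real.log N / (c * τ) + 1) * (2 * ρ) ≤ 2 * (Real.log N / (c * τ)) * (2 * ρ) := by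
    gcongr
  have h5 : 1 / ‖1 - w‖ * ρ ≤ 8 / c * Real.log N * (1 / ‖1 - w‖) * ρ := by gcongr
  rw [theta, ← hw, hτeq, stabilityConst, ← hc]
  calc ‖v i‖ ≤ 8 / c * Real.log N * (1 / τ) * ρ + 8 / c * Real.log N * (1 / ‖1 - w‖) * ρ := by
        linarith
    _ = _ := by ring

end Stability

/-! ### Errors in the self-consistent equation -/

section Bootstrap

variable {N : ℕ} {S : Matrix (Fin N) (Fin N) ℝ} {A : Matrix (Fin N) (Fin N) ℂ} {w z : ℂ}

/-- The large deviation estimates for the diagonal entries and the quadratic forms of `A` at the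
spectral parameter `w`, with constant `K`. -/
structure LargeDeviation (S : Matrix (Fin N) (Fin N) ℝ) (K : ℝ) (A : Matrix (Fin N) (Fin N) ℂ)
    (w : ℂ) : Prop where
  diag : ∀ i, ‖A i i‖ ≤ K * √(S i i)
  quad : ∀ i, ‖quadForm w {i} i i A - ∑ k, S k i * green A w {i} k k‖
    ≤ K * √(∑ k, ∑ l, S k i * S l i * ‖green A w {i} k l‖ ^ 2)

lemma norm_one_sub_msc_sq_le_sqrt (hw : 0 < w.im) (hre : |w.re| ≤ 5) (him : w.im ≤ 10) :
    ‖1 - msc w ^ 2‖ ≤ 5 * √(kappa w + w.im) := by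
  have h := norm_one_sub_msc_sq_sq_le hw hre him
  have h2 := Real.sq_sqrt (kappa_add_im_pos hw).le
  refine (sq_le_sq₀ (norm_nonneg _) (by positivity)).1 ?_
  rw [mul_pow, h2]
  linarith [(kappa_add_im_pos hw).le]

lemma sum_mul_le_of_le {f : Fin N → ℝ} {g : Fin N → ℝ} {c : ℝ} (hf : ∀ k, f k ≤ c)
    (hg : ∀ k, 0 ≤ g k) : ∑ k, f k * g k ≤ c * ∑ k, g k := by
  rw [Finset.mul_sum]
  exact Finset.sum_le_sum fun k _ => mul_le_mul_of_nonneg_right (hf k) (hg k)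

/-- The Ward identity reduces the inner sum to `Im G_kk^(i)`. Here `Im G_kk ≤ Im m + Λ ≤ 10 √(κ +
η)`, and the corrections `q k` from removing `i` need no pointwise bound, as they sum to at most `1
/ η`. -/
lemma sum_weighted_norm_sq_green_le (hA : A.IsHermitian) (hw : 0 < w.im) (hre : |w.re| ≤ 5)
    (him : w.im ≤ 10) (hS0 : ∀ i j, 0 ≤ S i j) (hS1 : ∀ j, ∑ i, S i j = 1) {M : ℝ} (hM : 0 < M)
    (hSM : ∀ i j, S i j ≤ 1 / M) (hMs : 1 / (M * w.im) ≤ √(kappa w + w.im)) {Λ : ℝ}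
    (hΛ : Λ ≤ 5 * √(kappa w + w.im)) (h : ∀ i, ‖green A w ∅ i i - msc w‖ ≤ Λ) (i : Fin N) :
    ∑ k, ∑ l, S k i * S l i * ‖green A w {i} k l‖ ^ 2
      ≤ 11 * (√(kappa w + w.im) / (M * w.im)) := by
  set s := √(kappa w + w.im) with hs
  set q : Fin N → ℂ := fun k => green A w ∅ k i * green A w ∅ i k / green A w ∅ i i with hq
  have hqk : ∀ k, green A w ∅ k k = green A w {i} k k + q k := fun k => by
    simpa using green_eq_insert_add hA hw ∅ i k k
  have him' : (msc w).im ≤ 5 * s :=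
    (msc_im_le w).trans (norm_one_sub_msc_sq_le_sqrt hw hre him)
  have h1 : ∀ k, (green A w {i} k k).im ≤ 10 * s + ‖q k‖ := fun k => by
    have e := congrArg Complex.im (hqk k)
    rw [Complex.add_im] at e
    have a1 := (abs_le.1 (Complex.abs_im_le_norm (q k))).1
    have a2 := (Complex.abs_im_le_norm (green A w ∅ k k - msc w)).trans (h k)
    rw [Complex.sub_im] at a2
    linarith [(abs_le.1 a2).2]
  have h2 : ∑ k, S k i * ‖q k‖ ≤ 1 / (M * w.im) :=
    calc ∑ k, S k i * ‖q k‖ ≤ 1 / M * ∑ k, ‖q k‖ :=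
          sum_mul_le_of_le (fun k => hSM k i) fun k => norm_nonneg _
      _ ≤ 1 / M * (1 / w.im) := by
          gcongr
          exact sum_norm_green_mul_div_le hA hw ∅ i
      _ = _ := by field_simp
  calc ∑ k, ∑ l, S k i * S l i * ‖green A w {i} k l‖ ^ 2
      = ∑ k, S k i * ∑ l, S l i * ‖green A w {i} k l‖ ^ 2 := by
        refine Finset.sum_congr rfl fun k _ => ?_
        rw [Finset.mul_sum]
        exact Finset.sum_congr rfl fun l _ => by ring
    _ ≤ ∑ k, S k i * (1 / M * ((10 * s + ‖q k‖) / w.im)) := by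
        refine Finset.sum_le_sum fun k _ => mul_le_mul_of_nonneg_left ?_ (hS0 k i)
        refine (sum_mul_le_of_le (fun l => hSM l i) fun l => by positivity).trans ?_
        rw [sum_norm_sq_green_right hA hw]
        gcongr
        exact h1 k
    _ = 1 / (M * w.im) * (10 * s * ∑ k, S k i + ∑ k, S k i * ‖q k‖) := by
        rw [Finset.mul_sum, ← Finset.sum_add_distrib, Finset.mul_sum]
        refine Finset.sum_congr rfl fun k _ => ?_
        field_simp
    _ ≤ 1 / (M * w.im) * (10 * s * 1 + s) := by
        rw [hS1]
        have : 0 < 1 / (M * w.im) := by positivity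
        gcongr
        exact h2.trans hMs
    _ = _ := by ring

/-- By the Schur complement and `1 / m = -z - m` the error is exactly `A_ii` minus the centred
quadratic form plus the averaged correction `∑ S_ki q_k`. These are at most `2KB`, `4KB` and `B`. -/
lemma norm_error_le (hA : A.IsHermitian) (hw : 0 < w.im) (hre : |w.re| ≤ 5)
    (him : w.im ≤ 10) (hS0 : ∀ i j, 0 ≤ S i j) (hS1 : ∀ j, ∑ i, S i j = 1) {M : ℝ} (hM : 0 < M)
    (hSM : ∀ i j, S i j ≤ 1 / M) (hMs : 1 / (M * w.im) ≤ √(kappa w + w.im)) {Λ : ℝ}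
    (hΛ : Λ ≤ 5 * √(kappa w + w.im)) (h : ∀ i, ‖green A w ∅ i i - msc w‖ ≤ Λ)
    {K B : ℝ} (hK : 1 ≤ K) (hB : 0 ≤ B) (hB2 : √(kappa w + w.im) / (M * w.im) ≤ B ^ 2)
    (hld : LargeDeviation S K A w) (i : Fin N) :
    ‖quadForm w {i} i i A - ∑ k, S k i * green A w {i} k k‖ ≤ 4 * (K * B) ∧
      ‖1 / green A w ∅ i i - 1 / msc w + ∑ k, S k i * (green A w ∅ k k - msc w)‖
        ≤ 8 * (K * B) := by
  have hV := sum_weighted_norm_sq_green_le hA hw hre him hS0 hS1 hM hSM hMs hΛ h i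
  set s := √(kappa w + w.im) with hs
  have hs2 : s ^ 2 = kappa w + w.im := Real.sq_sqrt (kappa_add_im_pos hw).le
  have hs0 : 0 < s := Real.sqrt_pos.2 (kappa_add_im_pos hw)
  have hZ : ‖quadForm w {i} i i A - ∑ k, S k i * green A w {i} k k‖ ≤ 4 * (K * B) := by
    refine (hld.quad i).trans ?_
    have : √(∑ k, ∑ l, S k i * S l i * ‖green A w {i} k l‖ ^ 2) ≤ 4 * B := by
      apply Real.sqrt_le_iff.2 ⟨by positivity, ?_⟩
      nlinarith [sq_nonneg B]
    calc _ ≤ K * (4 * B) := by gcongr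
      _ = _ := by ring
  refine ⟨hZ, ?_⟩
  set q : Fin N → ℂ := fun k => green A w ∅ k i * green A w ∅ i k / green A w ∅ i i with hq
  have hqk : ∀ k, green A w ∅ k k = green A w {i} k k + q k := fun k => by
    simpa using green_eq_insert_add hA hw ∅ i k k
  have hone : ∑ k, (S k i : ℂ) = 1 := by
    have := congrArg (fun x : ℝ => (x : ℂ)) (hS1 i)
    push_cast at this
    exact this
  have hdiag := one_div_green_diag hA hw (Finset.notMem_empty i)
  have hid : 1 / green A w ∅ i i - 1 / msc w + ∑ k, S k i * (green A w ∅ k k - msc w)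
      = A i i - (quadForm w {i} i i A - ∑ k, S k i * green A w {i} k k)
        + ∑ k, S k i * q k := by
    have e1 : ∑ k, (S k i : ℂ) * (green A w ∅ k k - msc w)
        = ∑ k, S k i * green A w {i} k k + ∑ k, S k i * q k - msc w := by
      simp only [mul_sub, Finset.sum_sub_distrib, ← Finset.sum_mul, hone, one_mul]
      rw [← Finset.sum_add_distrib]
      congr 1
      refine Finset.sum_congr rfl fun k _ => ?_
      rw [hqk k]; ring
    rw [hdiag, e1, one_div_msc hw, insert_empty_eq]
    ring
  have hq2 : ‖∑ k, S k i * q k‖ ≤ B := by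
    have h2 : ∑ k, S k i * ‖q k‖ ≤ 1 / (M * w.im) :=
      calc ∑ k, S k i * ‖q k‖ ≤ 1 / M * ∑ k, ‖q k‖ :=
            sum_mul_le_of_le (fun k => hSM k i) fun k => norm_nonneg _
        _ ≤ 1 / M * (1 / w.im) := by
            gcongr
            exact sum_norm_green_mul_div_le hA hw ∅ i
        _ = _ := by field_simp
    have h3 : 1 / (M * w.im) ≤ B := by
      refine (sq_le_sq₀ (by positivity) hB).1 (le_trans ?_ hB2)
      rw [pow_two, div_eq_mul_one_div s, mul_comm s]
      gcongr
    refine (norm_sum_le _ _).trans (le_trans (Finset.sum_le_sum fun k _ => ?_) (h2.trans h3))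
    rw [norm_mul, Complex.norm_real, Real.norm_of_nonneg (hS0 k i)]
  have hA2 : ‖A i i‖ ≤ 2 * (K * B) := by
    have : √(S i i) ≤ 2 * B := by
      apply Real.sqrt_le_iff.2 ⟨by positivity, (hSM i i).trans ?_⟩
      have hk : 0 ≤ kappa w := abs_nonneg _
      have h4 : w.im ≤ 4 * s := by
        refine (sq_le_sq₀ hw.le (by positivity)).1 ?_
        nlinarith
      have : 1 / M ≤ 4 * (s / (M * w.im)) := by
        rw [mul_div_assoc', div_le_div_iff₀ hM (by positivity)]
        nlinarith
      nlinarith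
    calc _ ≤ K * √(S i i) := hld.diag i
      _ ≤ K * (2 * B) := by gcongr
      _ = _ := by ring
  rw [hid]
  have hKB : B ≤ K * B := le_mul_of_one_le_left hB hK
  calc _ ≤ ‖A i i - (quadForm w {i} i i A - ∑ k, S k i * green A w {i} k k)‖
        + ‖∑ k, S k i * q k‖ := norm_add_le _ _
    _ ≤ ‖A i i‖ + ‖quadForm w {i} i i A - ∑ k, S k i * green A w {i} k k‖
        + ‖∑ k, S k i * q k‖ := by gcongr; exact norm_sub_le _ _
    _ ≤ _ := by linarith

/-- The self-consistent equation in terms of the deviation from `msc`. -/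
lemma self_consistent_identity {g m a r : ℂ} (hg : g ≠ 0) (hm : m ≠ 0)
    (h : 1 / g - 1 / m + a = r) : (g - m) - m ^ 2 * a = - m ^ 2 * r + m * (g - m) * (a - r) := by
  have h1 : g - m = g * m * (a - r) := by
    rw [← h]
    field_simp
    ring
  have h2 : g * m * (a - r) = m ^ 2 * (a - r) + m * (g - m) * (a - r) := by ring
  rw [h1]
  rw [h1] at h2
  linear_combination h2

lemma norm_sum_mul_le (hS0 : ∀ i j, 0 ≤ S i j) (hS1 : ∀ j, ∑ i, S i j = 1) {v : Fin N → ℂ} {Λ : ℝ}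
    (h : ∀ i, ‖v i‖ ≤ Λ) (i : Fin N) : ‖∑ k, S k i * v k‖ ≤ Λ := by
  refine (norm_sum_le _ _).trans ?_
  calc ∑ k, ‖(S k i : ℂ) * v k‖ ≤ ∑ k, S k i * Λ := by
        refine Finset.sum_le_sum fun k _ => ?_
        rw [norm_mul, Complex.norm_real, Real.norm_of_nonneg (hS0 k i)]
        exact mul_le_mul_of_nonneg_left (h k) (hS0 k i)
    _ = Λ := by rw [← Finset.sum_mul, hS1, one_mul]

end Bootstrap

/-! ### Descent along the grid and entrywise resolvent bounds -/

section BootstrapScale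

variable {N : ℕ} {S : Matrix (Fin N) (Fin N) ℝ} {A : Matrix (Fin N) (Fin N) ℂ} {w z : ℂ}

/-- The points of a vertical grid from `z.re + 10 i` down to `z`. -/
noncomputable def gridPoint (z : ℂ) (m k : ℕ) : ℂ :=
  ⟨z.re, z.im + (10 - z.im) * (1 - k / m)⟩

/-- Deterministic control parameters at the spectral parameter `z`. -/
structure ScaleData (S : Matrix (Fin N) (Fin N) ℝ) (δm δp M K B : ℝ) (z : ℂ) : Prop where
  gapped : IsGappedStochastic S δm δp
  δm_pos : 0 < δm
  δp_nonneg : 0 ≤ δp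
  δp_le : δp ≤ 2
  four_le : 4 ≤ N
  log_ge : 10000 * stabilityConst δm ≤ Real.log N
  re_le : |z.re| ≤ 5
  le_im : 1 / (N : ℝ) ≤ z.im
  im_le : z.im ≤ 10
  M_pos : 0 < M
  le_M : ∀ i j, S i j ≤ 1 / M
  one_le_K : 1 ≤ K
  B_nonneg : 0 ≤ B
  B_sq : B ^ 2 = √(kappa z + z.im) / (M * z.im)
  small : Real.log N ^ 7 * (K * B) * theta δp z ^ 2 ≤ 1

variable {δm δp M K B : ℝ}

namespace ScaleData

lemma one_le_log (h : ScaleData S δm δp M K B z) : 10000 ≤ Real.log N := by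
  linarith [h.log_ge, one_le_stabilityConst h.δm_pos]

lemma N_pos (h : ScaleData S δm δp M K B z) : (0 : ℝ) < N := by
  exact_mod_cast (by linarith [h.four_le] : 0 < N)

lemma im_pos (h : ScaleData S δm δp M K B z) : 0 < z.im :=
  lt_of_lt_of_le (one_div_pos.2 h.N_pos) h.le_im

lemma theta_pos (h : ScaleData S δm δp M K B z) : 0 < theta δp z := by
  linarith [half_le_theta h.δp_nonneg h.im_pos]

lemma sqrt_pos' (h : ScaleData S δm δp M K B z) : 0 < √(kappa z + z.im) :=
  Real.sqrt_pos.2 (kappa_add_im_pos h.im_pos)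

lemma one_div_theta_le (h : ScaleData S δm δp M K B z) :
    1 / theta δp z ≤ 5 * √(kappa z + z.im) := by
  have h1 := one_div_le_theta h.δp_nonneg z
  have h2 := norm_one_sub_msc_sq_pos h.im_pos
  have h3 := norm_one_sub_msc_sq_le_sqrt h.im_pos h.re_le h.im_le
  refine le_trans ?_ h3
  rw [div_le_iff₀ h.theta_pos]
  rw [div_le_iff₀ h2] at h1
  linarith

lemma B_theta_le (h : ScaleData S δm δp M K B z) : B * theta δp z ^ 2 ≤ 1 / 10000 := by
  have hL := h.one_le_log
  have h1 : (10000 : ℝ) ≤ Real.log N ^ 7 := hL.trans (le_self_pow₀ (by linarith) (by norm_num))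
  have h2 : 10000 * (1 * B) * theta δp z ^ 2 ≤ Real.log N ^ 7 * (K * B) * theta δp z ^ 2 := by
    have := h.B_nonneg
    have := h.one_le_K
    gcongr
  linarith [h.small]

/-- Combine `1 ≤ 5 s θ` for `s = √(κ + η)` with the smallness of `(B θ²)² = s θ⁴ / (M η)`. -/
lemma one_div_le_sqrt (h : ScaleData S δm δp M K B z) :
    1 / (M * z.im) ≤ √(kappa z + z.im) := by
  have h1 := h.one_div_theta_le
  have h2 := half_le_theta h.δp_nonneg h.im_pos
  have h3 := h.B_theta_le
  have hs := h.sqrt_pos'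
  have hB := h.B_sq
  have hM := h.M_pos
  have hz := h.im_pos
  set s := √(kappa z + z.im)
  set t := theta δp z
  have ht := h.theta_pos
  have h4 : 1 ≤ 5 * s * t := by rwa [div_le_iff₀ ht] at h1
  have h5 : (B * t ^ 2) ^ 2 ≤ 1 := pow_le_one₀ (mul_nonneg h.B_nonneg (sq_nonneg _)) (by linarith)
  have h6 : (B * t ^ 2) ^ 2 ≤ (1 / 10000) ^ 2 :=
    pow_le_pow_left₀ (mul_nonneg h.B_nonneg (sq_nonneg _)) h3 2
  have h7 : (B * t ^ 2) ^ 2 = 1 / (M * z.im) * (s * t ^ 2) * t ^ 2 := by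
    rw [mul_pow, hB]; ring
  have h8 : 1 / 25 ≤ s * (s * t ^ 2) := by nlinarith
  have h9 : 1 / 4 ≤ t ^ 2 := by nlinarith
  have hx : 0 < 1 / (M * z.im) := by positivity
  have h10 : 1 / (M * z.im) * (1 / 25) * (1 / 4) ≤ s * (B * t ^ 2) ^ 2 := by
    rw [h7]
    calc 1 / (M * z.im) * (1 / 25) * (1 / 4)
        ≤ 1 / (M * z.im) * (s * (s * t ^ 2)) * t ^ 2 := by gcongr
      _ = _ := by ring
  nlinarith

lemma sqrt_le (hre : w.re = z.re) (him : z.im ≤ w.im) :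
    √(kappa z + z.im) ≤ √(kappa w + w.im) := by
  apply Real.sqrt_le_sqrt
  rw [kappa, kappa, hre]
  linarith

lemma one_div_le_sqrt_of_le (h : ScaleData S δm δp M K B z) (hre : w.re = z.re)
    (him : z.im ≤ w.im) : 1 / (M * w.im) ≤ √(kappa w + w.im) := by
  refine le_trans ?_ (h.one_div_le_sqrt.trans (sqrt_le hre him))
  have := h.M_pos
  have := h.im_pos
  gcongr

/-- For fixed `E` the ratio `√(κ + η) / η` decreases in `η`, so the scale `B` at `z` works at every
higher point. -/
lemma sqrt_div_le (h : ScaleData S δm δp M K B z) (hre : w.re = z.re)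
    (him : z.im ≤ w.im) : √(kappa w + w.im) / (M * w.im) ≤ B ^ 2 := by
  rw [h.B_sq]
  have hM := h.M_pos
  have hz := h.im_pos
  have hw : 0 < w.im := hz.trans_le him
  have hk : kappa w = kappa z := by rw [kappa, kappa, hre]
  have hk0 : 0 ≤ kappa z := abs_nonneg _
  have key : √(kappa w + w.im) * z.im ≤ √(kappa z + z.im) * w.im := by
    refine (sq_le_sq₀ (by positivity) (by positivity)).1 ?_
    rw [mul_pow, mul_pow, Real.sq_sqrt (by linarith), Real.sq_sqrt (by linarith), hk]
    have : 0 ≤ kappa z * (w.im - z.im) * (w.im + z.im) :=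
      mul_nonneg (mul_nonneg hk0 (by linarith)) (by linarith)
    have : 0 ≤ w.im * z.im * (w.im - z.im) := mul_nonneg (by positivity) (by linarith)
    nlinarith
  rw [div_le_div_iff₀ (by positivity) (by positivity)]
  nlinarith

/-- The size below which deviations are contracted. -/
lemma threshold_le (h : ScaleData S δm δp M K B z) :
    1 / (Real.log N ^ 3 * theta δp z) ≤ 5 * √(kappa z + z.im) := by
  refine le_trans ?_ h.one_div_theta_le
  have := h.theta_pos
  have hL := h.one_le_log
  refine one_div_le_one_div_of_le this (le_mul_of_one_le_left this.le (one_le_pow₀ (by linarith)))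

lemma threshold_le_small (h : ScaleData S δm δp M K B z) :
    1 / (Real.log N ^ 3 * theta δp z) ≤ 1 / 1000 := by
  have h1 := half_le_theta h.δp_nonneg h.im_pos
  have hL := h.one_le_log
  have h2 : (10000 : ℝ) ≤ Real.log N ^ 3 := hL.trans (le_self_pow₀ (by linarith) (by norm_num))
  apply one_div_le_one_div_of_le (by norm_num)
  nlinarith

lemma KB_theta_le (h : ScaleData S δm δp M K B z) :
    K * B * theta δp z ≤ 1 / (Real.log N ^ 3 * theta δp z) / Real.log N ^ 4 := by
  have := h.theta_pos
  have hL : 0 < Real.log N := by linarith [h.one_le_log]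
  rw [div_div, le_div_iff₀ (by positivity)]
  linarith [h.small]

lemma KB_le (h : ScaleData S δm δp M K B z) :
    K * B ≤ 1 / (Real.log N ^ 3 * theta δp z) / 1000 := by
  have h1 := half_le_theta h.δp_nonneg h.im_pos
  have h2 := h.KB_theta_le
  have hL := h.one_le_log
  have h3 : (10000 : ℝ) ≤ Real.log N ^ 4 := hL.trans (le_self_pow₀ (by linarith) (by norm_num))
  have hKB : 0 ≤ K * B := mul_nonneg (by linarith [h.one_le_K]) h.B_nonneg
  have h4 : 1 / (Real.log N ^ 3 * theta δp z) / Real.log N ^ 4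
      ≤ 1 / (Real.log N ^ 3 * theta δp z) / 10000 := by
    have := h.theta_pos
    gcongr
  nlinarith

lemma norm_error_le_of_le (h : ScaleData S δm δp M K B z) (hA : A.IsHermitian) (hre : w.re = z.re)
    (him : z.im ≤ w.im) (him' : w.im ≤ 10) (hld : LargeDeviation S K A w) {Λ : ℝ}
    (hΛ : Λ ≤ 5 * √(kappa w + w.im)) (hv : ∀ i, ‖green A w ∅ i i - msc w‖ ≤ Λ) (i : Fin N) :
    ‖quadForm w {i} i i A - ∑ k, S k i * green A w {i} k k‖ ≤ 4 * (K * B) ∧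
      ‖1 / green A w ∅ i i - 1 / msc w + ∑ k, S k i * (green A w ∅ k k - msc w)‖
        ≤ 8 * (K * B) :=
  norm_error_le hA (h.im_pos.trans_le him) (hre ▸ h.re_le) him' h.gapped.nonneg h.gapped.sum_one
    h.M_pos h.le_M (h.one_div_le_sqrt_of_le hre him) hΛ hv h.one_le_K h.B_nonneg
    (h.sqrt_div_le hre him) hld i

/-- With `ε = 1 / (L³ θ)`, where `L = log N`, the linearised equation has right side at most `16 K B
+ ε²`. Inversion costs `C L θ`; since `L θ ε = L⁻²` and `L θ K B ≤ ε / L²`, the result is `4352 C ε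
/ L²` with `4352 = 256 * 17`, below `ε / 2`. -/
lemma contract (h : ScaleData S δm δp M K B z) (hA : A.IsHermitian) (hre : w.re = z.re)
    (him : z.im ≤ w.im) (him' : w.im ≤ 10) (hld : LargeDeviation S K A w)
    (hv : ∀ i, ‖green A w ∅ i i - msc w‖ ≤ 1 / (Real.log N ^ 3 * theta δp z)) (i : Fin N) :
    ‖green A w ∅ i i - msc w‖ ≤ 1 / (Real.log N ^ 3 * theta δp z) / 2 := by
  have hw : 0 < w.im := h.im_pos.trans_le him
  have hre' : |w.re| ≤ 5 := hre ▸ h.re_le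
  have herr := fun i => (h.norm_error_le_of_le hA hre him him' hld
    (h.threshold_le.trans (by linarith [sqrt_le hre him])) hv i).2
  have hθ := theta_le h.δp_nonneg h.im_pos hre him hre' him'
  have hKBθ := h.KB_theta_le
  have hL := h.one_le_log
  have hLC := h.log_ge
  have hC := one_le_stabilityConst h.δm_pos
  have hεs := h.threshold_le_small
  have ht := h.theta_pos
  have hKB : 0 ≤ K * B := mul_nonneg (by linarith [h.one_le_K]) h.B_nonneg
  set ε := 1 / (Real.log N ^ 3 * theta δp z) with hε
  have hε0 : 0 < ε := by positivity
  have hεθ : Real.log N * theta δp z * ε = 1 / Real.log N ^ 2 := by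
    rw [hε]; field_simp
  have hLθ : Real.log N * theta δp z * (K * B) ≤ ε / Real.log N ^ 2 := by
    have : Real.log N * (K * B * theta δp z) ≤ Real.log N * (ε / Real.log N ^ 4) := by gcongr
    have e : Real.log N * (ε / Real.log N ^ 4) ≤ ε / Real.log N ^ 2 := by
      rw [mul_div_assoc', div_le_div_iff₀ (by positivity) (by positivity)]
      have : Real.log N ^ 3 ≤ Real.log N ^ 4 := pow_le_pow_right₀ (by linarith) (by norm_num)
      calc _ = ε * Real.log N ^ 3 := by ring
        _ ≤ _ := by gcongr
    linarith
  set C := stabilityConst δm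
  have hm1 := norm_msc_le_one hw
  have hρ : ∀ i, ‖(green A w ∅ i i - msc w)
      - msc w ^ 2 * ∑ j, S i j * (green A w ∅ j j - msc w)‖ ≤ 16 * (K * B) + ε * ε := fun i => by
    have e : ∑ j, (S i j : ℂ) * (green A w ∅ j j - msc w)
        = ∑ j, (S j i : ℂ) * (green A w ∅ j j - msc w) :=
      Finset.sum_congr rfl fun j _ => by rw [h.gapped.symm]
    rw [e, self_consistent_identity (green_diag_ne_zero hA hw (Finset.notMem_empty i))
      (msc_ne_zero hw) rfl]
    set r := 1 / green A w ∅ i i - 1 / msc w + ∑ k, S k i * (green A w ∅ k k - msc w)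
    have hr : ‖r‖ ≤ 8 * (K * B) := herr i
    have hSv := norm_sum_mul_le h.gapped.nonneg h.gapped.sum_one hv i
    set a := ∑ j, (S j i : ℂ) * (green A w ∅ j j - msc w)
    have b1 : ‖-msc w ^ 2 * r‖ ≤ 8 * (K * B) := by
      rw [norm_mul, norm_neg, norm_pow]
      exact (mul_le_of_le_one_left (norm_nonneg _) (pow_le_one₀ (norm_nonneg _) hm1)).trans hr
    have b2 : ‖msc w * (green A w ∅ i i - msc w) * (a - r)‖ ≤ ε * (ε + 8 * (K * B)) := by
      rw [norm_mul, norm_mul]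
      refine mul_le_mul ?_ ((norm_sub_le _ _).trans (add_le_add hSv hr)) (norm_nonneg _) hε0.le
      exact (mul_le_of_le_one_left (norm_nonneg _) hm1).trans (hv i)
    refine (norm_add_le _ _).trans ?_
    nlinarith
  have hst := h.gapped.norm_le hw h.δm_pos h.δp_nonneg h.δp_le h.four_le (by linarith) hρ i
  refine hst.trans ?_
  calc C * Real.log N * theta δp w * (16 * (K * B) + ε * ε)
      ≤ C * Real.log N * (256 * theta δp z) * (16 * (K * B) + ε * ε) := by gcongr
    _ = 256 * C * (16 * (Real.log N * theta δp z * (K * B))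
          + Real.log N * theta δp z * ε * ε) := by ring
    _ ≤ 256 * C * (16 * (ε / Real.log N ^ 2) + 1 / Real.log N ^ 2 * ε) := by
        rw [hεθ]; gcongr
    _ = 4352 * C / Real.log N ^ 2 * ε := by ring
    _ ≤ 1 / 2 * ε := by
        refine mul_le_mul_of_nonneg_right ?_ hε0.le
        rw [div_le_iff₀ (by positivity)]
        nlinarith
    _ = _ := by ring

/-- At height `10` both `G_ii` and `m` are at most `1/10`, so the equation is a contraction without
any spectral input: `Λ ≤ (Λ + 8 K B) / 100`. -/
lemma start (h : ScaleData S δm δp M K B z) (hA : A.IsHermitian) (hre : w.re = z.re)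
    (him : w.im = 10) (hld : LargeDeviation S K A w) (i : Fin N) :
    ‖green A w ∅ i i - msc w‖ ≤ 1 / (Real.log N ^ 3 * theta δp z) / 2 := by
  have hw : 0 < w.im := by rw [him]; norm_num
  have hg : ∀ i, ‖green A w ∅ i i‖ ≤ 1 / 10 := fun i => by
    simpa [him] using norm_green_le hA hw ∅ i i
  have hm : ‖msc w‖ ≤ 1 / 10 := by simpa [him] using norm_msc_le_one_div hw
  have hNe : (Finset.univ : Finset (Fin N)).Nonempty :=
    ⟨⟨0, by linarith [h.four_le]⟩, Finset.mem_univ _⟩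
  obtain ⟨i₀, -, hi₀⟩ := Finset.exists_max_image Finset.univ
    (fun i => ‖green A w ∅ i i - msc w‖) hNe
  set Λ := ‖green A w ∅ i₀ i₀ - msc w‖ with hΛ
  have hv : ∀ i, ‖green A w ∅ i i - msc w‖ ≤ Λ := fun i => hi₀ i (Finset.mem_univ i)
  have hΛ1 : Λ ≤ 5 * √(kappa w + w.im) := by
    have h1 : Λ ≤ 2 / 10 := (norm_sub_le _ _).trans (by linarith [hg i₀])
    have h2 : (1 : ℝ) ≤ √(kappa w + w.im) := by
      apply Real.le_sqrt_of_sq_le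
      have : 0 ≤ kappa w := abs_nonneg _
      rw [him]; linarith
    linarith
  have herr := (h.norm_error_le_of_le hA hre (him ▸ h.im_le) him.le hld hΛ1 hv i₀).2
  have hSv := norm_sum_mul_le h.gapped.nonneg h.gapped.sum_one hv i₀
  have hid : green A w ∅ i₀ i₀ - msc w = green A w ∅ i₀ i₀ * msc w *
      ((∑ k, S k i₀ * (green A w ∅ k k - msc w)) - (1 / green A w ∅ i₀ i₀ - 1 / msc w
        + ∑ k, S k i₀ * (green A w ∅ k k - msc w))) := by
    have := green_diag_ne_zero hA hw (Finset.notMem_empty i₀)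
    have := msc_ne_zero hw
    field_simp
    ring
  have hΛ2 : Λ ≤ 1 / 10 * (1 / 10) * (Λ + 8 * (K * B)) := by
    have : Λ = ‖green A w ∅ i₀ i₀ - msc w‖ := rfl
    rw [hid, norm_mul, norm_mul] at this
    rw [this]
    have hA0 : 0 ≤ Λ := norm_nonneg _
    refine mul_le_mul (mul_le_mul (hg i₀) hm (norm_nonneg _) (by norm_num)) ?_ (norm_nonneg _)
      (by norm_num)
    rw [← this]
    exact (norm_sub_le _ _).trans (add_le_add hSv herr)
  have hKB := h.KB_le
  have h0 : 0 ≤ K * B := mul_nonneg (by linarith [h.one_le_K]) h.B_nonneg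
  refine (hv i).trans ?_
  linarith

lemma M_le (h : ScaleData S δm δp M K B z) : M ≤ N := by
  have i : Fin N := ⟨0, by linarith [h.four_le]⟩
  have h1 : ∑ j, S j i ≤ ∑ _j : Fin N, 1 / M := Finset.sum_le_sum fun j _ => h.le_M j i
  rw [h.gapped.sum_one] at h1
  simp only [Finset.sum_const, Finset.card_univ, Fintype.card_fin, nsmul_eq_mul] at h1
  rwa [mul_one_div, le_div_iff₀ h.M_pos, one_mul] at h1

/-- As `M ≤ N` and `η ≤ 10`, the scale `B` is at least `N⁻²`, and `B θ² ≤ 1` then bounds `θ`. This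
makes the threshold `ε` polynomially large, hence visible to a polynomial grid. -/
lemma theta_le_N (h : ScaleData S δm δp M K B z) : theta δp z ≤ N := by
  have hN := h.N_pos
  have hN4 : (4 : ℝ) ≤ N := by exact_mod_cast h.four_le
  have hz := h.im_pos
  have hM := h.M_pos
  have hk : 0 ≤ kappa z := abs_nonneg _
  have h1 : 1 / (N : ℝ) ≤ √(kappa z + z.im) := by
    apply Real.le_sqrt_of_sq_le
    have : (1 / (N : ℝ)) ^ 2 ≤ 1 / N := by
      rw [div_pow, one_pow]
      apply one_div_le_one_div_of_le hN
      nlinarith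
    linarith [h.le_im]
  have h2 : (1 / (N : ℝ) ^ 2) ^ 2 ≤ B ^ 2 := by
    rw [h.B_sq]
    calc (1 / (N : ℝ) ^ 2) ^ 2 ≤ 1 / N / (N * 10) := by
          rw [div_pow, div_div, one_pow]
          apply one_div_le_one_div_of_le (by positivity)
          have : (4 : ℝ) ^ 2 ≤ (N : ℝ) ^ 2 := by gcongr
          nlinarith
      _ ≤ √(kappa z + z.im) / (M * z.im) := by
          have := h.M_le
          have := h.im_le
          gcongr
  have h3 : 1 / (N : ℝ) ^ 2 ≤ B := (sq_le_sq₀ (by positivity) h.B_nonneg).1 h2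
  have h4 := h.B_theta_le
  have h5 : 1 / (N : ℝ) ^ 2 * theta δp z ^ 2 ≤ 1 := by
    have : 1 / (N : ℝ) ^ 2 * theta δp z ^ 2 ≤ B * theta δp z ^ 2 := by gcongr
    linarith
  refine (sq_le_sq₀ h.theta_pos.le hN.le).1 ?_
  rw [one_div_mul_eq_div, div_le_one (by positivity)] at h5
  exact h5

/-- Lipschitz constants `N²` for the resolvent and `N + 1` for `m` are negligible against the
spacing `10 / N⁹`. -/
lemma drift (h : ScaleData S δm δp M K B z) (hA : A.IsHermitian) {w' : ℂ}
    (him : z.im ≤ w.im) (him' : z.im ≤ w'.im) (hww : ‖w' - w‖ ≤ 10 / (N : ℝ) ^ 9) (i : Fin N) :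
    ‖green A w' ∅ i i - msc w'‖
      ≤ ‖green A w ∅ i i - msc w‖ + 1 / (Real.log N ^ 3 * theta δp z) / 2 := by
  have hN := h.N_pos
  have hN4 : (4 : ℝ) ≤ N := by exact_mod_cast h.four_le
  have hz := h.im_pos
  have hw := hz.trans_le him
  have hw' := hz.trans_le him'
  have hinv : 1 / z.im ≤ N := by
    have := one_div_le_one_div_of_le (one_div_pos.2 hN) h.le_im
    simpa using this
  have h1 : ‖green A w' ∅ i i - green A w ∅ i i‖ ≤ 10 / (N : ℝ) ^ 9 * (N * N) := by
    refine (norm_green_sub_green_le hA hw' hw (Finset.notMem_empty i)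
      (Finset.notMem_empty i)).trans ?_
    rw [div_eq_mul_one_div, ← one_div_mul_one_div]
    gcongr
    · exact (one_div_le_one_div_of_le hz him').trans hinv
    · exact (one_div_le_one_div_of_le hz him).trans hinv
  have h2 : ‖msc w' - msc w‖ ≤ (N + 1) * (10 / (N : ℝ) ^ 9) := by
    refine (norm_msc_sub_le hz him' him).trans ?_
    have : (1 + z.im) / z.im ≤ N + 1 := by
      rw [add_div, div_self hz.ne']; linarith
    gcongr
  have h3 : green A w' ∅ i i - msc w' = (green A w ∅ i i - msc w)
      + (green A w' ∅ i i - green A w ∅ i i) - (msc w' - msc w) := by ring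
  rw [h3]
  have hθ := h.theta_le_N
  have ht := h.theta_pos
  have hL0 := h.one_le_log
  have hL : Real.log N ≤ N := (Real.log_le_sub_one_of_pos hN).trans (by linarith)
  have h4 : 1 / ((N : ℝ) ^ 3 * N) / 2 ≤ 1 / (Real.log N ^ 3 * theta δp z) / 2 := by
    gcongr
  have h5 : 10 / (N : ℝ) ^ 9 * (N * N) + (N + 1) * (10 / (N : ℝ) ^ 9) ≤ 1 / ((N : ℝ) ^ 3 * N) / 2 := by
    have e : 10 / (N : ℝ) ^ 9 * (N * N) + (N + 1) * (10 / (N : ℝ) ^ 9)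
        = 10 * (N * N + (N + 1)) / (N : ℝ) ^ 9 := by ring
    rw [e, div_div, div_le_div_iff₀ (by positivity) (by positivity)]
    have a1 : (N : ℝ) * N + (N + 1) ≤ 2 * (N * N) := by nlinarith
    have a2 : (64 : ℝ) ≤ (N : ℝ) ^ 3 := by
      calc (64 : ℝ) = 4 ^ 3 := by norm_num
        _ ≤ _ := by gcongr
    calc 10 * ((N : ℝ) * N + (N + 1)) * ((N : ℝ) ^ 3 * N * 2)
        ≤ 10 * (2 * (N * N)) * ((N : ℝ) ^ 3 * N * 2) := by gcongr
      _ = 40 * (N : ℝ) ^ 6 := by ring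
      _ ≤ (N : ℝ) ^ 3 * (N : ℝ) ^ 6 := by gcongr; linarith
      _ = _ := by ring
  calc _ ≤ ‖(green A w ∅ i i - msc w) + (green A w' ∅ i i - green A w ∅ i i)‖
        + ‖msc w' - msc w‖ := norm_sub_le _ _
    _ ≤ ‖green A w ∅ i i - msc w‖ + ‖green A w' ∅ i i - green A w ∅ i i‖
        + ‖msc w' - msc w‖ := by gcongr; exact norm_add_le _ _
    _ ≤ _ := by linarith

/-- A weak local law for the diagonal entries of the resolvent. -/
lemma weak_local_law (h : ScaleData S δm δp M K B z) (hA : A.IsHermitian)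
    (hld : ∀ k ≤ N ^ 9, LargeDeviation S K A (gridPoint z (N ^ 9) k)) (i : Fin N) :
    ‖green A z ∅ i i - msc z‖ ≤ 1 / (Real.log N ^ 3 * theta δp z) := by
  have hN := h.N_pos
  have hm : (0 : ℝ) < ((N ^ 9 : ℕ) : ℝ) := by push_cast; positivity
  have him : ∀ k ≤ N ^ 9, z.im ≤ (gridPoint z (N ^ 9) k).im
      ∧ (gridPoint z (N ^ 9) k).im ≤ 10 := fun k hk => by
    have h1 : (k : ℝ) / ((N ^ 9 : ℕ) : ℝ) ≤ 1 := by
      rw [div_le_one hm]; exact_mod_cast hk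
    have h2 : 0 ≤ (k : ℝ) / ((N ^ 9 : ℕ) : ℝ) := by positivity
    have := h.im_le
    simp only [gridPoint]
    constructor <;> nlinarith
  -- Half the threshold at one grid point plus a drift of at most half keeps the deviation below the
  -- threshold at the next, where `contract` restores the half.
  have key : ∀ k ≤ N ^ 9, ∀ i, ‖green A (gridPoint z (N ^ 9) k) ∅ i i
      - msc (gridPoint z (N ^ 9) k)‖ ≤ 1 / (Real.log N ^ 3 * theta δp z) / 2 := fun k => by
    induction k with
    | zero =>
      intro hk i
      exact h.start (w := gridPoint z (N ^ 9) 0) hA rfl (by simp [gridPoint]) (hld 0 hk) i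
    | succ k ih =>
      intro hk i
      have hk' : k ≤ N ^ 9 := by omega
      refine h.contract (w := gridPoint z (N ^ 9) (k + 1)) hA rfl (him _ hk).1 (him _ hk).2 (hld _ hk) (fun i => ?_) i
      refine (h.drift hA (him k hk').1 (him _ hk).1 ?_ i).trans ?_
      · have e : gridPoint z (N ^ 9) (k + 1) - gridPoint z (N ^ 9) k
            = ((-(10 - z.im) / (N : ℝ) ^ 9 : ℝ) : ℂ) * Complex.I := by
          apply Complex.ext
          · rw [Complex.sub_re, Complex.re_ofReal_mul, Complex.I_re, mul_zero]
            exact sub_self _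
          · rw [Complex.sub_im, Complex.im_ofReal_mul, Complex.I_im]
            simp only [gridPoint]
            push_cast
            ring
        rw [e, norm_mul, Complex.norm_I, mul_one, Complex.norm_real, Real.norm_eq_abs, abs_div,
          abs_neg, abs_of_nonneg (by linarith [h.im_le]), abs_of_nonneg (by positivity)]
        have := h.im_pos
        gcongr
        linarith
      · linarith [ih hk' i]
  have e : gridPoint z (N ^ 9) (N ^ 9) = z := by
    apply Complex.ext
    · rfl
    · simp only [gridPoint]
      rw [div_self hm.ne']; ring
  have h1 := key (N ^ 9) le_rfl i
  rw [e] at h1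
  have := h.theta_pos
  have hL := h.one_le_log
  have : 0 < 1 / (Real.log N ^ 3 * theta δp z) := by positivity
  linarith

/-- Entrywise bounds on the resolvent and on the quadratic forms. -/
lemma entrywise_bounds (h : ScaleData S δm δp M K B z) (hA : A.IsHermitian)
    (hld : ∀ k ≤ N ^ 9, LargeDeviation S K A (gridPoint z (N ^ 9) k))
    (hlin : ∀ i j, i ≠ j → ‖∑ k, (starRingEnd ℂ) (A k i) * green A z {i} k j‖
      ≤ K * √(∑ k, S k i * ‖green A z {i} k j‖ ^ 2)) :
    (∀ i j, i ≠ j → ‖green A z ∅ i j‖ ≤ Real.log N * (K * B)) ∧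
      (∀ i, 1 / 20 ≤ ‖green A z ∅ i i‖) ∧
      ∀ i, ‖quadForm z {i} i i A - ∑ k, S k i * green A z {i} k k‖ ≤ Real.log N * (K * B) := by
  have hz := h.im_pos
  have hv := h.weak_local_law hA hld
  have hε := h.threshold_le_small
  have hεs := h.threshold_le
  have hL := h.one_le_log
  have hK := h.one_le_K
  have hB := h.B_nonneg
  have hM := h.M_pos
  have hs := h.sqrt_pos'
  have hKB : 0 ≤ K * B := by positivity
  have hg1 : ∀ i, 1 / 20 ≤ ‖green A z ∅ i i‖ := fun i => by
    have h1 := le_norm_msc_of_bounded hz h.re_le h.im_le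
    have h2 := norm_sub_norm_le (msc z) (green A z ∅ i i)
    rw [norm_sub_rev] at h2
    linarith [hv i]
  have hg2 : ∀ i, ‖green A z ∅ i i‖ ≤ 2 := fun i => by
    have h1 := norm_msc_le_one hz
    have h2 := norm_sub_norm_le (green A z ∅ i i) (msc z)
    linarith [hv i]
  have e : gridPoint z (N ^ 9) (N ^ 9) = z := by
    have hm : ((N ^ 9 : ℕ) : ℝ) ≠ 0 := by
      have := h.N_pos
      push_cast; positivity
    apply Complex.ext
    · rfl
    · simp only [gridPoint]
      rw [div_self hm]; ring
  have hldz := e ▸ hld (N ^ 9) le_rfl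
  refine ⟨?_, hg1, fun i => ?_⟩
  swap
  · refine ((h.norm_error_le_of_le hA rfl le_rfl h.im_le hldz hεs hv i).1).trans ?_
    gcongr
    linarith
  set s := √(kappa z + z.im) with hsdef
  have hN4 := h.four_le
  have hne : ((Finset.univ : Finset (Fin N × Fin N)).filter fun q => q.1 ≠ q.2).Nonempty :=
    ⟨(⟨0, by omega⟩, ⟨1, by omega⟩), by simp⟩
  -- The bound is self-improving for the largest off-diagonal entry `x`: the linear large deviation
  -- estimate gives `x² ≤ 4 K² (10 s + 20 x²) / (M η)`, and `hsmall` absorbs the term in `x²`.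
  obtain ⟨q, hq, hmax⟩ := Finset.exists_max_image _ (fun q => ‖green A z ∅ q.1 q.2‖) hne
  set x := ‖green A z ∅ q.1 q.2‖ with hx
  have hx0 : 0 ≤ x := norm_nonneg _
  have hoff : ∀ i j, i ≠ j → ‖green A z ∅ i j‖ ≤ x := fun i j hij =>
    hmax (i, j) (by simpa using hij)
  obtain ⟨i, j⟩ := q
  have hij : i ≠ j := by simpa using hq
  have hW : ∑ k, S k i * ‖green A z {i} k j‖ ^ 2 ≤ 1 / (M * z.im) * (10 * s + 20 * x ^ 2) := by
    refine (sum_mul_le_of_le (fun k => h.le_M k i) fun k => by positivity).trans ?_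
    rw [sum_norm_sq_green_left hA hz]
    have e1 := green_eq_insert_add hA hz ∅ i j j
    rw [insert_empty_eq] at e1
    have e2 := congrArg Complex.im e1
    rw [Complex.add_im] at e2
    have a1 := (abs_le.1 (Complex.abs_im_le_norm
      (green A z ∅ j i * green A z ∅ i j / green A z ∅ i i))).1
    have a2 := (Complex.abs_im_le_norm (green A z ∅ j j - msc z)).trans (hv j)
    rw [Complex.sub_im] at a2
    have a3 := (abs_le.1 a2).2
    have a4 : (msc z).im ≤ 5 * s :=
      (msc_im_le z).trans (norm_one_sub_msc_sq_le_sqrt hz h.re_le h.im_le)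
    have a5 : ‖green A z ∅ j i * green A z ∅ i j / green A z ∅ i i‖ ≤ 20 * x ^ 2 := by
      rw [norm_div, norm_mul, div_le_iff₀ (by linarith [hg1 i])]
      have b1 : ‖green A z ∅ j i‖ * ‖green A z ∅ i j‖ ≤ x * x :=
        mul_le_mul (hoff j i hij.symm) (hoff i j hij) (norm_nonneg _) hx0
      nlinarith [hg1 i]
    have a6 : (green A z {i} j j).im ≤ 10 * s + 20 * x ^ 2 := by linarith
    calc 1 / M * ((green A z {i} j j).im / z.im)
        ≤ 1 / M * ((10 * s + 20 * x ^ 2) / z.im) := by gcongr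
      _ = _ := by field_simp
  have hxle : x ≤ 2 * (K * √(1 / (M * z.im) * (10 * s + 20 * x ^ 2))) := by
    have e1 := green_off_diag_row hA hz (Finset.notMem_empty i) (Finset.notMem_empty j) hij
    rw [insert_empty_eq] at e1
    have e2 : x = ‖green A z ∅ i i‖ * ‖∑ k, (starRingEnd ℂ) (A k i) * green A z {i} k j‖ := by
      rw [← norm_neg (green A z ∅ i i), ← norm_mul, ← e1]
    calc x = _ := e2
      _ ≤ 2 * (K * √(1 / (M * z.im) * (10 * s + 20 * x ^ 2))) := by
          refine mul_le_mul (hg2 i) ((hlin i j hij).trans ?_) (norm_nonneg _) (by norm_num)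
          gcongr
  have hx2 : x ^ 2 ≤ 4 * K ^ 2 * (1 / (M * z.im) * (10 * s + 20 * x ^ 2)) := by
    have := pow_le_pow_left₀ hx0 hxle 2
    rw [mul_pow, mul_pow, Real.sq_sqrt (by positivity)] at this
    linarith
  have hB2 : 1 / (M * z.im) * s = B ^ 2 := by rw [h.B_sq]; ring
  -- Multiply by `1 ≤ 5 s θ` and use `s / (M η) = B²`: what remains is `5 (K B θ)(K B)`.
  have hsmall : K ^ 2 * (1 / (M * z.im)) ≤ 1 / 160 := by
    have t := h.theta_pos
    have h1 := h.one_div_theta_le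
    rw [div_le_iff₀ t] at h1
    have h2 := h.KB_theta_le
    have h3 := h.KB_le
    have h4 : 1 / (Real.log N ^ 3 * theta δp z) / Real.log N ^ 4
        ≤ 1 / (Real.log N ^ 3 * theta δp z) := by
      apply div_le_self (by positivity)
      exact one_le_pow₀ (by linarith)
    have h5 : K * B * theta δp z ≤ 1 / 1000 := by linarith
    have h6 : K * B ≤ 1 / 1000 := by linarith
    calc K ^ 2 * (1 / (M * z.im)) ≤ K ^ 2 * (1 / (M * z.im)) * (5 * s * theta δp z) :=
          le_mul_of_one_le_right (by positivity) h1
      _ = 5 * (K * B * theta δp z) * (K * B) := by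
          have : K ^ 2 * (1 / (M * z.im)) * (5 * s * theta δp z)
            = 5 * K ^ 2 * theta δp z * (1 / (M * z.im) * s) := by ring
          rw [this, hB2]; ring
      _ ≤ 5 * (1 / 1000) * (1 / 1000) := by gcongr
      _ ≤ _ := by norm_num
  have hx3 : x ^ 2 ≤ 80 * (K * B) ^ 2 := by
    have e1 : 4 * K ^ 2 * (1 / (M * z.im) * (10 * s + 20 * x ^ 2))
        = 40 * (K ^ 2 * (1 / (M * z.im) * s)) + 80 * (K ^ 2 * (1 / (M * z.im))) * x ^ 2 := by ring
    rw [e1, hB2] at hx2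
    nlinarith [sq_nonneg x]
  have hx4 : x ≤ 9 * (K * B) := by
    refine (sq_le_sq₀ hx0 (by positivity)).1 ?_
    nlinarith [sq_nonneg (K * B)]
  intro a b hab
  refine (hoff a b hab).trans (hx4.trans ?_)
  gcongr
  linarith

end ScaleData

end BootstrapScale

/-! ### Hermitian matrices as functions of independent coordinates -/

section Configurations

variable {N : ℕ}

/-- The index set of the independent entries of a hermitian matrix. -/
abbrev Edge (N : ℕ) := {q : Fin N × Fin N // q.1 ≤ q.2}

/-- The position in the upper triangle that determines the entries `(i, j)` and `(j, i)`. -/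
def edge (i j : Fin N) : Edge N := ⟨(min i j, max i j), min_le_max⟩

lemma edge_comm (i j : Fin N) : edge i j = edge j i := by
  simp [edge, min_comm, max_comm]

lemma edge_injective (i : Fin N) : Function.Injective fun k => edge k i := by
  intro k l h
  simp only [edge, Subtype.mk.injEq, Prod.mk.injEq] at h
  obtain ⟨h1, h2⟩ := h
  rcases le_total k i with a | a <;> rcases le_total l i with b | b <;>
    simp only [min_eq_left, min_eq_right, max_eq_left, max_eq_right, a, b] at h1 h2 <;>
    simp_all

/-- The hermitian matrix with prescribed entries on and above the diagonal. -/
noncomputable def mat (x : Edge N → ℂ) : Matrix (Fin N) (Fin N) ℂ := Matrix.of fun i j =>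
  if i < j then x (edge i j) else if j < i then (starRingEnd ℂ) (x (edge i j))
  else ((x (edge i j)).re : ℂ)

lemma mat_apply (x : Edge N → ℂ) (i j : Fin N) : mat x i j =
    if i < j then x (edge i j) else if j < i then (starRingEnd ℂ) (x (edge i j))
    else ((x (edge i j)).re : ℂ) := rfl

lemma isHermitian_mat (x : Edge N → ℂ) : (mat x).IsHermitian := by
  ext i j
  rw [Matrix.conjTranspose_apply, mat_apply, mat_apply, edge_comm j i]
  rcases lt_trichotomy i j with h | h | h
  · simp [h, h.not_gt]
  · subst h; simp
  · simp [h, h.not_gt]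

lemma mat_congr {x y : Edge N → ℂ} {i j : Fin N} (h : x (edge i j) = y (edge i j)) :
    mat x i j = mat y i j := by
  rw [mat_apply, mat_apply, h]

lemma dependsOn_mat (i j : Fin N) : DependsOn (fun x : Edge N → ℂ => mat x i j) {edge i j} :=
  fun _ _ h => mat_congr (h _ rfl)

lemma measurable_mat (i j : Fin N) : Measurable fun x : Edge N → ℂ => mat x i j := by
  simp only [mat_apply]
  split_ifs <;> fun_prop

lemma norm_mat_le (x : Edge N → ℂ) (i j : Fin N) : ‖mat x i j‖ ≤ ‖x (edge i j)‖ := by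
  rw [mat_apply]
  split_ifs
  · exact le_rfl
  · rw [RCLike.norm_conj]
  · rw [Complex.norm_real]; exact Complex.abs_re_le_norm _

lemma tame_mat (i j : Fin N) : Tame fun x : Edge N → ℂ => mat x i j :=
  ⟨measurable_mat i j, 1, 1, zero_le_one, fun x => by
    have h1 := norm_mat_le x i j
    have h2 := norm_le_pi_norm x (edge i j)
    simp; linarith⟩

/-- The positions in the rows and columns with index in `C`. -/
def incident (C : Finset (Fin N)) : Finset (Edge N) :=
  Finset.univ.filter fun q => q.1.1 ∈ C ∨ q.1.2 ∈ C

lemma edge_mem_incident {C : Finset (Fin N)} {i j : Fin N} :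
    edge i j ∈ incident C ↔ i ∈ C ∨ j ∈ C := by
  simp only [incident, edge, Finset.mem_filter, Finset.mem_univ, true_and]
  rcases le_total i j with h | h
  · simp [h]
  · simp [h, or_comm]

lemma isIncidence_incident : IsIncidence (incident (N := N)) where
  empty := by simp [incident]
  union A B := by
    ext q
    simp only [incident, Finset.mem_filter, Finset.mem_univ, true_and, Finset.mem_union]
    tauto

/-- Identifies the column expectation with the average over the coordinates incident to `i`. -/
lemma replaceCol_mat (i : Fin N) (x y : Edge N → ℂ) :
    replaceCol i (mat x) (mat y) = mat ((incident {i}).piecewise y x) := by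
  ext k l
  simp only [replaceCol, Matrix.of_apply]
  have h := edge_mem_incident (C := {i}) (i := k) (j := l)
  simp only [Finset.mem_singleton] at h
  split_ifs with hc
  · refine mat_congr ?_
    rw [Finset.piecewise_eq_of_mem _ _ _ (h.2 hc)]
  · refine mat_congr ?_
    rw [Finset.piecewise_eq_of_notMem _ _ _ (fun hh => hc (h.1 hh))]

lemma dependsOn_green (z : ℂ) (T : Finset (Fin N)) (k l : Fin N) :
    DependsOn (fun x : Edge N → ℂ => green (mat x) z T k l) (incident T : Set (Edge N))ᶜ := by
  intro x y hxy
  have : (mat x).submatrix (Subtype.val : {k // k ∉ T} → Fin N)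
        (Subtype.val : {k // k ∉ T} → Fin N)
      = (mat y).submatrix (Subtype.val : {k // k ∉ T} → Fin N)
        (Subtype.val : {k // k ∉ T} → Fin N) := by
    ext i j
    refine mat_congr (hxy _ ?_)
    simp only [Set.mem_compl_iff, Finset.mem_coe, edge_mem_incident, not_or]
    exact ⟨i.2, j.2⟩
  simp only [green, greenMinor, this]

lemma incident_mono {C D : Finset (Fin N)} (h : C ⊆ D) : incident C ⊆ incident D := by
  intro q
  simp only [incident, Finset.mem_filter, Finset.mem_univ, true_and]
  exact Or.imp (@h _) (@h _)

lemma tame_green {z : ℂ} (hz : 0 < z.im) (T : Finset (Fin N)) (k l : Fin N) :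
    Tame fun x : Edge N → ℂ => green (mat x) z T k l :=
  Tame.of_bounded (measurable_green measurable_mat z T k l) (1 / z.im) fun x =>
    norm_green_le (isHermitian_mat x) hz T k l

lemma tame_quadForm {z : ℂ} (hz : 0 < z.im) (T : Finset (Fin N)) (i j : Fin N) :
    Tame fun x : Edge N → ℂ => quadForm z T i j (mat x) := by
  simp only [quadForm_eq]
  exact Tame.sum _ fun k _ => Tame.sum _ fun l _ =>
    ((tame_mat k i).conj.mul (tame_green hz T k l)).mul (tame_mat l j)

/-- The quadratic form of a larger minor does not depend on the columns that it omits. -/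
lemma dependsOn_quadForm_insert (z : ℂ) (T : Finset (Fin N)) {i : Fin N} (hi : i ∉ T) :
    DependsOn (fun x : Edge N → ℂ => quadForm z (insert i T) i i (mat x))
      (incident T : Set (Edge N))ᶜ := by
  intro x y hxy
  simp only [quadForm_eq]
  have hm : ∀ k, k ∉ T → mat x k i = mat y k i := fun k hk => mat_congr (hxy _ (by
    simp only [Set.mem_compl_iff, Finset.mem_coe, edge_mem_incident, not_or]
    exact ⟨hk, hi⟩))
  refine Finset.sum_congr rfl fun k _ => Finset.sum_congr rfl fun l _ => ?_
  have hg := dependsOn_green z (insert i T) k l (x := x) (y := y) (fun e he => hxy e (by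
    simp only [Set.mem_compl_iff, Finset.mem_coe] at he ⊢
    exact fun h => he (incident_mono (Finset.subset_insert i T) h)))
  simp only at hg
  rw [hg]
  by_cases hk : k ∈ T
  · rw [green_of_mem_left (Finset.mem_insert_of_mem hk)]; simp
  by_cases hl : l ∈ T
  · rw [green_of_mem_right (Finset.mem_insert_of_mem hl)]; simp
  rw [hm k hk, hm l hl]

lemma mat_piecewise_col (i k : Fin N) (x y : Edge N → ℂ) :
    mat ((incident {i}).piecewise y x) k i = mat y k i := by
  refine mat_congr (Finset.piecewise_eq_of_mem _ _ _ ?_)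
  rw [edge_mem_incident]; simp

lemma green_piecewise (T : Finset (Fin N)) (z : ℂ) (k l : Fin N) (x y : Edge N → ℂ) :
    green (mat ((incident T).piecewise y x)) z T k l = green (mat x) z T k l :=
  dependsOn_green z T k l fun e he => Finset.piecewise_eq_of_notMem _ _ _ (by simpa using he)

end Configurations

/-! ### The exceptional event for the large deviation estimates -/

section LargeDeviations

variable {N : ℕ} {μ : Measure (Edge N → ℂ)} [IsProbabilityMeasure μ] [ResamplingMeasure μ]
variable {S : Matrix (Fin N) (Fin N) ℝ} {b : ℕ → ℝ}

/-- The law `μ` of the entries is centred with variances `S`, and `b` controls the moments. -/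
structure HasMoments (μ : Measure (Edge N → ℂ)) (S : Matrix (Fin N) (Fin N) ℝ) (b : ℕ → ℝ) :
    Prop where
  centred : ∀ i j, ∫ x, mat x i j ∂μ = 0
  var : ∀ i j, ∫ x, ‖mat x i j‖ ^ 2 ∂μ = S i j
  moment : ∀ i j n, 1 ≤ n → ∫ x, ‖mat x i j‖ ^ (2 * n) ∂μ ≤ (b n * S i j) ^ n
  one_le : ∀ n, 1 ≤ b n
  mono : Monotone b

lemma HasMoments.nonneg (h : HasMoments μ S b) (i j : Fin N) : 0 ≤ S i j := by
  rw [← h.var]; exact integral_nonneg fun _ => by positivity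

lemma HasMoments.moment' (h : HasMoments μ S b) (i j : Fin N) {m n : ℕ} (hm : 1 ≤ m) (hmn : m ≤ n) :
    ∫ x, ‖mat x i j‖ ^ (2 * m) ∂μ ≤ (b n * S i j) ^ m := by
  refine (h.moment i j m hm).trans ?_
  have := h.nonneg i j
  have := h.one_le m
  have := h.mono hmn
  gcongr

/-- The constant in the large deviation estimates with failure probability `exp (-2 n)`. -/
noncomputable def deviationConst (b : ℕ → ℝ) (n : ℕ) : ℝ := Real.exp 1 * (48 * n ^ 2 * b (2 * n))

/-- `deviationConst b n` is the square root of `exp 2 * 2304 n⁴ b(2n)²`, the largest of the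
constants, so one constant serves the diagonal entries, the linear forms and the quadratic forms. -/
lemma le_deviationConst_mul_sqrt {b : ℕ → ℝ} {n : ℕ} (hb : 1 ≤ b (2 * n)) {u v c : ℝ}
    (hc : c ≤ 2304 * n ^ 4 * b (2 * n) ^ 2) (hv : 0 ≤ v) (hu : 0 ≤ u)
    (h : ¬ Real.exp 2 * (c * v) < u ^ 2) : u ≤ deviationConst b n * √v := by
  have hD : 0 ≤ deviationConst b n := by unfold deviationConst; positivity
  refine (sq_le_sq₀ hu (by positivity)).1 ?_
  rw [mul_pow, Real.sq_sqrt hv]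
  refine (not_lt.1 h).trans ?_
  rw [← mul_assoc]
  refine mul_le_mul_of_nonneg_right ?_ hv
  have : Real.exp 2 = Real.exp 1 ^ 2 := by rw [← Real.exp_nat_mul]; norm_num
  rw [deviationConst, mul_pow, ← this]
  refine mul_le_mul_of_nonneg_left (hc.trans (le_of_eq ?_)) (Real.exp_pos 2).le
  ring

lemma HasMoments.measureReal_diag_le (h : HasMoments μ S b) {n : ℕ} (hn : 1 ≤ n) (i : Fin N) :
    μ.real {x | Real.exp 2 * (b (2 * n) * S i i) < ‖mat x i i‖ ^ 2} ≤ Real.exp (-(2 * n)) := by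
  have h0 : 0 ≤ b (2 * n) * S i i := mul_nonneg (by linarith [h.one_le (2 * n)]) (h.nonneg i i)
  refine measureReal_lt_norm_sq_le (S := Finset.univ) (tame_mat i i)
    (W := fun _ => b (2 * n) * S i i) measurable_const (fun _ => h0) (fun _ _ _ => rfl) hn
    fun x => ?_
  simp only [Finset.piecewise_univ]
  exact h.moment' i i hn (by omega)

/-- The minor without `i` is independent of the column `i`, so conditionally the sum is a linear
form with fixed coefficients. -/
lemma HasMoments.measureReal_linear_le (h : HasMoments μ S b) {n : ℕ} (hn : 1 ≤ n) {z : ℂ}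
    (hz : 0 < z.im) (i j : Fin N) :
    μ.real {x | Real.exp 2 * (16 * n ^ 2 * b (2 * n) *
        ∑ k, S k i * ‖green (mat x) z {i} k j‖ ^ 2)
      < ‖∑ k, (starRingEnd ℂ) (mat x k i) * green (mat x) z {i} k j‖ ^ 2}
      ≤ Real.exp (-(2 * n)) := by
  have hb := h.one_le (2 * n)
  refine measureReal_lt_norm_sq_le (S := incident {i})
    (F := fun x => ∑ k, (starRingEnd ℂ) (mat x k i) * green (mat x) z {i} k j)
    (W := fun x => 16 * n ^ 2 * b (2 * n) * ∑ k, S k i * ‖green (mat x) z {i} k j‖ ^ 2)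
    (Tame.sum _ fun k _ => (tame_mat k i).conj.mul (tame_green hz {i} k j)) ?_ ?_ ?_ hn ?_
  · have := fun k => (tame_green hz {i} k j).1
    fun_prop
  · intro x
    have := fun k => h.nonneg k i
    have : 0 ≤ ∑ k, S k i * ‖green (mat x) z {i} k j‖ ^ 2 :=
      Finset.sum_nonneg fun k _ => mul_nonneg (this k) (by positivity)
    positivity
  · intro x y hxy
    have := fun k => dependsOn_green z {i} k j hxy
    simp only at this
    simp only [this]
  · intro x
    have h1 := integral_norm_linear_pow_le (μ := μ)
      (ξ := fun k x => (starRingEnd ℂ) (mat x k i)) (fun k => (tame_mat k i).conj)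
      (edge_injective i) (fun k x y hxy => congrArg (starRingEnd ℂ) (dependsOn_mat k i hxy)) hn
      (by linarith : 0 ≤ b (2 * n)) (v := fun k => S k i) (fun k => h.nonneg k i) Finset.univ
      (fun k _ => by rw [integral_conj, h.centred, map_zero])
      (fun k _ => by
        simp only [RCLike.norm_conj]
        exact h.moment' k i hn (by omega)) (fun k => green (mat x) z {i} k j)
    simp only [mat_piecewise_col, green_piecewise]
    refine le_trans (le_of_eq ?_) (h1.trans (le_of_eq ?_))
    · simp only [mul_comm]
    · simp only [mul_comm (S _ _)]

lemma HasMoments.measureReal_quad_le (h : HasMoments μ S b) {n : ℕ} (hn : 1 ≤ n) {z : ℂ}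
    (hz : 0 < z.im) (i : Fin N) :
    μ.real {x | Real.exp 2 * (2304 * n ^ 4 * b (2 * n) ^ 2 *
        ∑ k, ∑ l, S k i * S l i * ‖green (mat x) z {i} k l‖ ^ 2)
      < ‖quadForm z {i} i i (mat x) - ∑ k, S k i * green (mat x) z {i} k k‖ ^ 2}
      ≤ Real.exp (-(2 * n)) := by
  have hb := h.one_le (2 * n)
  refine measureReal_lt_norm_sq_le (S := incident {i})
    (F := fun x => quadForm z {i} i i (mat x) - ∑ k, S k i * green (mat x) z {i} k k)
    (W := fun x => 2304 * n ^ 4 * b (2 * n) ^ 2 *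
      ∑ k, ∑ l, S k i * S l i * ‖green (mat x) z {i} k l‖ ^ 2)
    ((tame_quadForm hz {i} i i).sub (Tame.sum _ fun k _ => (tame_green hz {i} k k).const_mul _))
    ?_ ?_ ?_ hn ?_
  · have := fun k l => (tame_green hz {i} k l).1
    fun_prop
  · intro x
    have := fun k => h.nonneg k i
    have : 0 ≤ ∑ k, ∑ l, S k i * S l i * ‖green (mat x) z {i} k l‖ ^ 2 :=
      Finset.sum_nonneg fun k _ => Finset.sum_nonneg fun l _ =>
        mul_nonneg (mul_nonneg (this k) (this l)) (by positivity)
    positivity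
  · intro x y hxy
    have := fun k l => dependsOn_green z {i} k l hxy
    simp only at this
    simp only [this]
  · intro x
    have h1 := integral_norm_quadratic_pow_le (μ := μ)
      (ξ := fun k x => mat x k i) (fun k => tame_mat k i)
      (edge_injective i) (fun k => dependsOn_mat k i) hn hb
      (v := fun k => S k i) (fun k => h.nonneg k i) Finset.univ
      (fun k _ => h.centred k i) (fun k _ => h.var k i)
      (fun k _ => h.moment' k i hn (by omega))
      (fun k _ => by
        have := h.moment k i (2 * n) (by omega)
        rwa [← mul_assoc] at this) (fun k l => green (mat x) z {i} k l)
    simp only [quadForm_eq, mat_piecewise_col, green_piecewise]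
    refine le_trans (le_of_eq ?_) (h1.trans (le_of_eq ?_))
    · congr 1
      funext y
      congr 3
      · exact Finset.sum_congr rfl fun k _ => Finset.sum_congr rfl fun l _ => by ring
      · exact Finset.sum_congr rfl fun k _ => by ring
    · congr 2
      exact Finset.sum_congr rfl fun k _ => Finset.sum_congr rfl fun l _ => by ring

/-- The event that one of the large deviation estimates fails. -/
def badEvent (S : Matrix (Fin N) (Fin N) ℝ) (b : ℕ → ℝ) (n m : ℕ) (z : ℂ) :
    Set (Edge N → ℂ) :=
  ((⋃ i : Fin N, {x | Real.exp 2 * (b (2 * n) * S i i) < ‖mat x i i‖ ^ 2}) ∪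
    ⋃ q : Fin N × Fin N, {x | Real.exp 2 * (16 * n ^ 2 * b (2 * n) *
        ∑ k, S k q.1 * ‖green (mat x) z {q.1} k q.2‖ ^ 2)
      < ‖∑ k, (starRingEnd ℂ) (mat x k q.1) * green (mat x) z {q.1} k q.2‖ ^ 2}) ∪
    ⋃ q : Fin (m + 1) × Fin N, {x | Real.exp 2 * (2304 * n ^ 4 * b (2 * n) ^ 2 *
        ∑ k, ∑ l, S k q.2 * S l q.2 * ‖green (mat x) (gridPoint z m q.1) {q.2} k l‖ ^ 2)
      < ‖quadForm (gridPoint z m q.1) {q.2} q.2 q.2 (mat x)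
        - ∑ k, S k q.2 * green (mat x) (gridPoint z m q.1) {q.2} k k‖ ^ 2}

lemma gridPoint_im_pos {z : ℂ} (hz : 0 < z.im) (hz' : z.im ≤ 10) {m k : ℕ} (hm : 0 < m)
    (hk : k ≤ m) : 0 < (gridPoint z m k).im := by
  have h1 : (k : ℝ) / m ≤ 1 := by
    rw [div_le_one (by exact_mod_cast hm)]; exact_mod_cast hk
  simp only [gridPoint]
  nlinarith

lemma measurableSet_badEvent {z : ℂ} (hz : 0 < z.im) (hz' : z.im ≤ 10) {n m : ℕ} (hm : 0 < m) :
    MeasurableSet (badEvent S b n m z) := by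
  refine MeasurableSet.union (MeasurableSet.union ?_ ?_) ?_
  · refine MeasurableSet.iUnion fun i => measurableSet_lt measurable_const ?_
    have := measurable_mat i i
    fun_prop
  · refine MeasurableSet.iUnion fun q => measurableSet_lt ?_ ?_
    · have := fun k => (tame_green hz {q.1} k q.2).1
      fun_prop
    · have := fun k => (tame_green hz {q.1} k q.2).1
      have := fun k => (tame_mat k q.1).conj.1
      fun_prop
  · refine MeasurableSet.iUnion fun q => ?_
    have hw := gridPoint_im_pos hz hz' hm (k := q.1) (by have := q.1.2; omega)
    refine measurableSet_lt ?_ ?_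
    · have := fun k l => (tame_green hw {q.2} k l).1
      fun_prop
    · have := fun k l => (tame_green hw {q.2} k l).1
      have := (tame_quadForm hw {q.2} q.2 q.2).1
      fun_prop

lemma HasMoments.measureReal_badEvent_le (h : HasMoments μ S b) {n : ℕ} (hn : 1 ≤ n) {z : ℂ}
    (hz : 0 < z.im) (hz' : z.im ≤ 10) {m : ℕ} (hm : 0 < m) :
    μ.real (badEvent S b n m z) ≤ (N + N * N + (m + 1) * N) * Real.exp (-(2 * n)) := by
  refine (measureReal_union_le _ _).trans ?_
  rw [add_mul, add_mul]
  refine add_le_add ((measureReal_union_le _ _).trans (add_le_add ?_ ?_)) ?_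
  · refine (measureReal_iUnion_fintype_le _).trans ?_
    refine (Finset.sum_le_sum fun i _ => h.measureReal_diag_le hn i).trans ?_
    simp
  · refine (measureReal_iUnion_fintype_le _).trans ?_
    refine (Finset.sum_le_sum fun q _ => h.measureReal_linear_le hn hz q.1 q.2).trans ?_
    simp
  · refine (measureReal_iUnion_fintype_le _).trans ?_
    refine (Finset.sum_le_sum fun q _ => h.measureReal_quad_le hn
      (gridPoint_im_pos hz hz' hm (by have := q.1.2; omega)) q.2).trans ?_
    simp

lemma largeDeviation_of_notMem_badEvent (hb : ∀ n, 1 ≤ b n) (hS : ∀ i j, 0 ≤ S i j) {n m : ℕ}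
    (hn : 1 ≤ n) {z : ℂ} {x : Edge N → ℂ} (hx : x ∉ badEvent S b n m z) :
    (∀ k ≤ m, LargeDeviation S (deviationConst b n) (mat x) (gridPoint z m k)) ∧
      ∀ i j, i ≠ j → ‖∑ k, (starRingEnd ℂ) (mat x k i) * green (mat x) z {i} k j‖
        ≤ deviationConst b n * √(∑ k, S k i * ‖green (mat x) z {i} k j‖ ^ 2) := by
  simp only [badEvent, Set.mem_union, Set.mem_iUnion, Set.mem_ofPred_eq, not_or, not_exists] at hx
  obtain ⟨⟨h1, h2⟩, h3⟩ := hx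
  have hb' := hb (2 * n)
  have hn' : (1 : ℝ) ≤ n := by exact_mod_cast hn
  have e2 : (1 : ℝ) ≤ (n : ℝ) ^ 2 := one_le_pow₀ hn'
  have hbb : b (2 * n) ≤ b (2 * n) ^ 2 := by nlinarith
  have c1 : b (2 * n) ≤ 2304 * n ^ 4 * b (2 * n) ^ 2 := by
    have : (1 : ℝ) ≤ 2304 * (n : ℝ) ^ 4 := by nlinarith [one_le_pow₀ (n := 4) hn']
    nlinarith
  have c2 : 16 * n ^ 2 * b (2 * n) ≤ 2304 * n ^ 4 * b (2 * n) ^ 2 := by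
    have : (16 : ℝ) * (n : ℝ) ^ 2 ≤ 2304 * (n : ℝ) ^ 4 := by nlinarith
    exact mul_le_mul this hbb (by linarith) (by positivity)
  refine ⟨fun k hk => ⟨fun i => ?_, fun i => ?_⟩, fun i j _ => ?_⟩
  · exact le_deviationConst_mul_sqrt hb' c1 (hS i i) (norm_nonneg _) (h1 i)
  · refine le_deviationConst_mul_sqrt hb' le_rfl ?_ (norm_nonneg _) (h3 (⟨k, by omega⟩, i))
    exact Finset.sum_nonneg fun k _ => Finset.sum_nonneg fun l _ =>
      mul_nonneg (mul_nonneg (hS k i) (hS l i)) (by positivity)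
  · refine le_deviationConst_mul_sqrt hb' c2 ?_ (norm_nonneg _) (h2 (i, j))
    exact Finset.sum_nonneg fun k _ => mul_nonneg (hS k i) (by positivity)

end LargeDeviations

/-! ### Moments of fluctuating parts and splitting by a rare event -/

section FluctPart

variable {ι : Type*} [Fintype ι] [DecidableEq ι] {V : Type*} [DecidableEq V]
variable {μ : Measure (ι → ℂ)} [IsProbabilityMeasure μ] [ResamplingMeasure μ]
variable {E : Finset V → Finset ι}

lemma avg_sum_mul {κ : Type*} (s : Finset κ) (c : κ → ℂ) {F : κ → (ι → ℂ) → ℂ}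
    (hF : ∀ k, Tame (F k)) (S : Finset ι) (x : ι → ℂ) :
    avg μ S (fun x => ∑ k ∈ s, c k * F k x) x = ∑ k ∈ s, c k * avg μ S (F k) x := by
  simp only [avg]
  rw [integral_finsetSum _ fun k _ => (((hF k).piecewise S x).integrable (μ := μ)).const_mul (c k)]
  exact Finset.sum_congr rfl fun k _ => integral_const_mul _ _

lemma avg_sub {F G : (ι → ℂ) → ℂ} (hF : Tame F) (hG : Tame G) (S : Finset ι) (x : ι → ℂ) :
    avg μ S (fun x => F x - G x) x = avg μ S F x - avg μ S G x :=
  integral_sub ((hF.piecewise S x).integrable (μ := μ)) ((hG.piecewise S x).integrable (μ := μ))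

lemma fluctPart_sum_mul {κ : Type*} (s : Finset κ) (c : κ → ℂ) {F : κ → (ι → ℂ) → ℂ}
    (hF : ∀ k, Tame (F k)) (A : Finset V) (x : ι → ℂ) :
    fluctPart μ E A (fun x => ∑ k ∈ s, c k * F k x) x
      = ∑ k ∈ s, c k * fluctPart μ E A (F k) x := by
  simp only [fluctPart, avg_sum_mul s c hF, Finset.mul_sum]
  rw [Finset.sum_comm]
  exact Finset.sum_congr rfl fun k _ => Finset.sum_congr rfl fun B _ => by ring

lemma fluctPart_sub {F G : (ι → ℂ) → ℂ} (hF : Tame F) (hG : Tame G) (A : Finset V) (x : ι → ℂ) :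
    fluctPart μ E A (fun x => F x - G x) x = fluctPart μ E A F x - fluctPart μ E A G x := by
  simp only [fluctPart, avg_sub hF hG, mul_sub, Finset.sum_sub_distrib]

/-- The factor `1 - 𝔼_v` annihilates what does not depend on `v`; in the sum `B` cancels `insert v
B`. -/
lemma fluctPart_eq_zero (hE : IsIncidence E) {F : (ι → ℂ) → ℂ} (hF : Tame F) {v : V}
    (hd : DependsOn F (E {v} : Set ι)ᶜ) {A : Finset V} (hv : v ∈ A) (x : ι → ℂ) :
    fluctPart μ E A F x = 0 := by
  rw [← Finset.insert_erase hv, fluctPart, Finset.sum_powerset_insert (Finset.notMem_erase v A),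
    ← Finset.sum_add_distrib]
  refine Finset.sum_eq_zero fun B hB => ?_
  have hvB : v ∉ B := fun h => Finset.notMem_erase v A (Finset.mem_powerset.1 hB h)
  have h1 : E (insert v B) = E B ∪ E {v} := by
    rw [← hE.union, Finset.union_comm]; rfl
  rw [Finset.card_insert_of_notMem hvB, h1, ← avg_avg hF, avg_of_dependsOn hd]
  ring

lemma fluctPart_avg_comm (hE : IsIncidence E) {F : (ι → ℂ) → ℂ} (hF : Tame F) (A C : Finset V)
    (x : ι → ℂ) :
    fluctPart μ E A (avg μ (E C) F) x = avg μ (E C) (fluctPart μ E A F) x := by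
  rw [avg_fluctPart hE hF, fluctPart]
  refine Finset.sum_congr rfl fun B _ => ?_
  rw [avg_avg hF, hE.union, Finset.union_comm]

lemma integral_norm_sum_mul_pow_le {κ : Type*} (s : Finset κ) {c : κ → ℂ} (hc : ∀ k, ‖c k‖ ≤ 1)
    {F : κ → (ι → ℂ) → ℂ} (hF : ∀ k, Tame (F k)) {p : ℕ} (hp : 0 < p) {u : ℝ}
    (h : ∀ k ∈ s, ∫ x, ‖F k x‖ ^ p ∂μ ≤ u) :
    ∫ x, ‖∑ k ∈ s, c k * F k x‖ ^ p ∂μ ≤ (s.card : ℝ) ^ p * u := by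
  rcases s.eq_empty_or_nonempty with rfl | hs
  · simp [hp.ne']
  obtain ⟨n, rfl⟩ : ∃ n, p = n + 1 := ⟨p - 1, by omega⟩
  have hcard : (0 : ℝ) < s.card := by exact_mod_cast hs.card_pos
  have hpt : ∀ x, ‖∑ k ∈ s, c k * F k x‖ ^ (n + 1)
      ≤ (s.card : ℝ) ^ n * ∑ k ∈ s, ‖F k x‖ ^ (n + 1) := fun x => by
    have h1 : ‖∑ k ∈ s, c k * F k x‖ ≤ ∑ k ∈ s, ‖F k x‖ := by
      refine (norm_sum_le _ _).trans (Finset.sum_le_sum fun k _ => ?_)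
      rw [norm_mul]
      exact mul_le_of_le_one_left (norm_nonneg _) (hc k)
    have h2 := pow_sum_div_card_le_sum_pow (s := s) (f := fun k => ‖F k x‖)
      (fun k _ => norm_nonneg _) n
    rw [div_le_iff₀ (by positivity)] at h2
    calc _ ≤ (∑ k ∈ s, ‖F k x‖) ^ (n + 1) := pow_le_pow_left₀ (norm_nonneg _) h1 _
      _ ≤ _ := by linarith
  have hi : ∀ k, Integrable (fun x => ‖F k x‖ ^ (n + 1)) μ := fun k => (hF k).integrable_norm_pow _
  calc _ ≤ ∫ x, (s.card : ℝ) ^ n * ∑ k ∈ s, ‖F k x‖ ^ (n + 1) ∂μ := by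
        refine integral_mono ?_ ?_ hpt
        · exact (Tame.sum s fun k _ => (hF k).const_mul (c k)).integrable_norm_pow _
        · exact (integrable_finsetSum s fun k _ => hi k).const_mul _
    _ = (s.card : ℝ) ^ n * ∑ k ∈ s, ∫ x, ‖F k x‖ ^ (n + 1) ∂μ := by
        rw [integral_const_mul, integral_finsetSum s fun k _ => hi k]
    _ ≤ (s.card : ℝ) ^ n * ∑ _k ∈ s, u := by
        gcongr with k hk
        exact h k hk
    _ = _ := by
        rw [Finset.sum_const, nsmul_eq_mul]; ring

lemma integral_norm_fluctPart_pow_le {F : (ι → ℂ) → ℂ} (hF : Tame F) (A : Finset V) {p : ℕ}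
    (hp : 0 < p) :
    ∫ x, ‖fluctPart μ E A F x‖ ^ p ∂μ ≤ ((2 : ℝ) ^ A.card) ^ p * ∫ x, ‖F x‖ ^ p ∂μ := by
  have := integral_norm_sum_mul_pow_le (μ := μ) A.powerset (c := fun B => (-1) ^ B.card)
    (fun B => by simp) (F := fun B => avg μ (E B) F) (fun B => hF.avg _) hp
    (fun B _ => integral_norm_avg_pow_le hF (E B) p)
  rw [Finset.card_powerset, Nat.cast_pow, Nat.cast_ofNat] at this
  exact this

lemma integral_norm_sub_avg_pow_le {F : (ι → ℂ) → ℂ} (hF : Tame F) (S : Finset ι) {p : ℕ}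
    (hp : 0 < p) :
    ∫ x, ‖F x - avg μ S F x‖ ^ p ∂μ ≤ 2 ^ p * ∫ x, ‖F x‖ ^ p ∂μ := by
  have := integral_norm_sum_mul_pow_le (μ := μ) (Finset.univ : Finset Bool)
    (c := fun t => if t then 1 else -1)
    (fun t => by cases t <;> simp) (F := fun t => if t then F else avg μ S F)
    (fun t => by cases t <;> simp [hF, hF.avg]) hp
    (u := ∫ x, ‖F x‖ ^ p ∂μ)
    (fun t _ => by
      cases t
      · simpa using integral_norm_avg_pow_le hF S p
      · simp)
  simpa [sub_eq_add_neg] using this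

/-- Splitting a moment according to a rare event. -/
lemma integral_norm_pow_le_add {F : (ι → ℂ) → ℂ} (hF : Tame F) {G : Set (ι → ℂ)}
    (hG : MeasurableSet G) {u ε Q : ℝ} {p : ℕ} (hu : ∀ x ∉ G, ‖F x‖ ≤ u) (hu0 : 0 ≤ u)
    (hε : 0 < ε) (hQ : 0 < Q) (hFQ : ∫ x, ‖F x‖ ^ (2 * p) ∂μ ≤ Q ^ 2) (hGε : μ.real G ≤ ε ^ 2) :
    ∫ x, ‖F x‖ ^ p ∂μ ≤ u ^ p + ε * Q := by
  -- On `G` the inequality `y ≤ Q / (2ε) + ε y² / (2Q)` replaces Cauchy–Schwarz; after integration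
  -- both terms are at most `ε Q / 2`.
  have hpt : ∀ x, ‖F x‖ ^ p ≤ u ^ p + (G.indicator (fun _ => Q / ε / 2) x
      + ε / Q / 2 * ‖F x‖ ^ (2 * p)) := fun x => by
    by_cases hx : x ∈ G
    · rw [Set.indicator_of_mem hx]
      have h1 : ‖F x‖ ^ (2 * p) = (‖F x‖ ^ p) ^ 2 := by rw [← pow_mul, mul_comm]
      rw [h1]
      set y := ‖F x‖ ^ p
      have h2 : 0 ≤ (Q - ε * y) ^ 2 / (2 * (ε * Q)) := by positivity
      have h3 : (Q - ε * y) ^ 2 / (2 * (ε * Q)) = Q / ε / 2 + ε / Q / 2 * y ^ 2 - y := by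
        field_simp; ring
      have : 0 ≤ u ^ p := by positivity
      linarith
    · rw [Set.indicator_of_notMem hx]
      have := pow_le_pow_left₀ (norm_nonneg _) (hu x hx) p
      have : 0 ≤ ε / Q / 2 * ‖F x‖ ^ (2 * p) := by positivity
      linarith
  have i1 : Integrable (fun x => G.indicator (fun _ => Q / ε / 2) x) μ :=
    (integrable_const _).indicator hG
  have i2 : Integrable (fun x => ε / Q / 2 * ‖F x‖ ^ (2 * p)) μ :=
    (hF.integrable_norm_pow _).const_mul _
  calc _ ≤ ∫ x, (u ^ p + (G.indicator (fun _ => Q / ε / 2) x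
      + ε / Q / 2 * ‖F x‖ ^ (2 * p))) ∂μ :=
        integral_mono (hF.integrable_norm_pow _) ((integrable_const _).add (i1.add i2)) hpt
    _ = u ^ p + (μ.real G * (Q / ε / 2) + ε / Q / 2 * ∫ x, ‖F x‖ ^ (2 * p) ∂μ) := by
        have e1 := integral_add (μ := μ) (integrable_const (u ^ p)) (i1.add i2)
        have e2 := integral_add i1 i2
        have e3 := integral_indicator_const (μ := μ) (Q / ε / 2) hG
        simp only [Pi.add_apply] at e1
        rw [e1, e2, e3, integral_const_mul]
        simp
    _ ≤ u ^ p + (ε ^ 2 * (Q / ε / 2) + ε / Q / 2 * Q ^ 2) := by gcongr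
    _ = _ := by field_simp; ring

end FluctPart

/-! ### Conditional mean and crude moments of the quadratic forms -/

section Model

variable {N : ℕ} {μ : Measure (Edge N → ℂ)} [IsProbabilityMeasure μ] [ResamplingMeasure μ]
variable {S : Matrix (Fin N) (Fin N) ℝ} {b : ℕ → ℝ}

/-- Distinct entries of the column are independent and centred, so only the diagonal terms survive.
-/
lemma HasMoments.avg_quadForm (h : HasMoments μ S b) (z : ℂ) (i : Fin N)
    (x : Edge N → ℂ) :
    avg μ (incident {i}) (fun x => quadForm z {i} i i (mat x)) x
      = ∑ k, S k i * green (mat x) z {i} k k := by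
  simp only [avg, quadForm_eq, mat_piecewise_col, green_piecewise]
  have ht : ∀ k l, Tame fun y : Edge N → ℂ =>
      (starRingEnd ℂ) (mat y k i) * green (mat x) z {i} k l * mat y l i := fun k l =>
    ((tame_mat k i).conj.mul (Tame.const _)).mul (tame_mat l i)
  rw [integral_finsetSum _ fun k _ => (Tame.sum _ fun l _ => ht k l).integrable]
  refine Finset.sum_congr rfl fun k _ => ?_
  rw [integral_finsetSum _ fun l _ => (ht k l).integrable, Finset.sum_eq_single k]
  · have : ∀ y : Edge N → ℂ, (starRingEnd ℂ) (mat y k i) * green (mat x) z {i} k k * mat y k i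
        = ((‖mat y k i‖ ^ 2 : ℝ) : ℂ) * green (mat x) z {i} k k := fun y => by
      rw [← Complex.normSq_eq_norm_sq, ← Complex.mul_conj]; ring
    simp only [this]
    have e := integral_ofReal (𝕜 := ℂ) (μ := μ) (f := fun y : Edge N → ℂ => ‖mat y k i‖ ^ 2)
    rw [h.var] at e
    rw [integral_mul_const]
    exact congrArg (· * green (mat x) z {i} k k) e
  · intro l _ hl
    have : ∀ y : Edge N → ℂ, (starRingEnd ℂ) (mat y k i) * green (mat x) z {i} k l * mat y l i
        = green (mat x) z {i} k l * ((starRingEnd ℂ) (mat y k i) * mat y l i) := fun y => by ring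
    simp only [this]
    rw [integral_const_mul, integral_mul_of_dependsOn (S := {edge k i}) (tame_mat k i).conj
      (tame_mat l i), h.centred l i, mul_zero, mul_zero]
    · intro y y' hy
      exact congrArg (starRingEnd ℂ) (dependsOn_mat k i (by simpa using hy))
    · intro y y' hy
      refine dependsOn_mat l i fun e he => hy e ?_
      simp only [Set.mem_singleton_iff] at he
      subst he
      simpa using fun h' => hl (edge_injective i h')
  · simp

/-- A crude bound for the exceptional event only: every resolvent entry is at most `N`. Its
polynomial growth is outweighed by the small probability. -/
lemma HasMoments.integral_norm_quadForm_pow_le (h : HasMoments μ S b) (hS1 : ∀ i j, S i j ≤ 1)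
    {z : ℂ} (hz : 0 < z.im) (hz' : 1 / z.im ≤ N) (T : Finset (Fin N)) (i : Fin N) {p : ℕ}
    (hp : 0 < p) :
    ∫ x, ‖quadForm z T i i (mat x)‖ ^ (2 * p) ∂μ ≤ ((N : ℝ) ^ 3 * b (2 * p)) ^ (2 * p) := by
  have hpt : ∀ x : Edge N → ℂ, ‖quadForm z T i i (mat x)‖
      ≤ N * (∑ k, ‖mat x k i‖) ^ 2 := fun x => by
    rw [quadForm_eq]
    refine (norm_sum_le _ _).trans ((Finset.sum_le_sum fun k _ => norm_sum_le _ _).trans ?_)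
    have e : (N : ℝ) * (∑ k, ‖mat x k i‖) ^ 2 = ∑ k, ∑ l, ‖mat x k i‖ * N * ‖mat x l i‖ := by
      rw [pow_two, Finset.sum_mul_sum, Finset.mul_sum]
      refine Finset.sum_congr rfl fun k _ => ?_
      rw [Finset.mul_sum]
      exact Finset.sum_congr rfl fun l _ => by ring
    rw [e]
    refine Finset.sum_le_sum fun k _ => Finset.sum_le_sum fun l _ => ?_
    rw [norm_mul, norm_mul, RCLike.norm_conj]
    gcongr
    exact (norm_green_le (isHermitian_mat x) hz T k l).trans hz'
  have h1 := integral_norm_sum_mul_pow_le (μ := μ) (Finset.univ : Finset (Fin N))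
    (c := fun _ => 1) (fun _ => by simp) (F := fun k x => ((‖mat x k i‖ : ℝ) : ℂ))
    (fun k => (tame_mat k i).ofReal_norm) (p := 4 * p) (by omega) (u := b (2 * p) ^ (2 * p))
    (fun k _ => by
      have := h.moment k i (2 * p) (by omega)
      have h2 : (b (2 * p) * S k i) ^ (2 * p) ≤ b (2 * p) ^ (2 * p) := by
        have a1 := h.one_le (2 * p)
        have a2 := h.nonneg k i
        refine pow_le_pow_left₀ (by positivity) (mul_le_of_le_one_right (by linarith) (hS1 k i)) _
      simp only [Complex.norm_real, norm_norm]
      rw [← mul_assoc] at this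
      exact this.trans h2)
  have hsum : ∀ x : Edge N → ℂ, ‖∑ k, (1 : ℂ) * ((‖mat x k i‖ : ℝ) : ℂ)‖ = ∑ k, ‖mat x k i‖ :=
    fun x => by
      simp only [one_mul]
      rw [← Complex.ofReal_sum, Complex.norm_real, Real.norm_of_nonneg
        (Finset.sum_nonneg fun _ _ => norm_nonneg _)]
  simp only [hsum, Finset.card_univ, Fintype.card_fin] at h1
  have hint : Integrable (fun x : Edge N → ℂ => (∑ k, ‖mat x k i‖) ^ (4 * p)) μ := by
    have := (Tame.sum Finset.univ fun k _ =>
      ((tame_mat k i).ofReal_norm.const_mul 1)).integrable_norm_pow (μ := μ) (4 * p)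
    simpa only [hsum] using this
  calc _ ≤ ∫ x, (N : ℝ) ^ (2 * p) * (∑ k, ‖mat x k i‖) ^ (4 * p) ∂μ := by
        refine integral_mono ((tame_quadForm hz T i i).integrable_norm_pow _)
          (hint.const_mul _) fun x => ?_
        have := pow_le_pow_left₀ (norm_nonneg _) (hpt x) (2 * p)
        rw [mul_pow, ← pow_mul, ← mul_assoc] at this
        exact this
    _ ≤ (N : ℝ) ^ (2 * p) * ((N : ℝ) ^ (4 * p) * b (2 * p) ^ (2 * p)) := by
        rw [integral_const_mul]
        gcongr
    _ = _ := by ring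

end Model

/-! ### Fluctuation averaging for the `Z_i` in coordinates -/

section ModelEstimate

variable {N : ℕ} {μ : Measure (Edge N → ℂ)} [IsProbabilityMeasure μ] [ResamplingMeasure μ]
variable {S : Matrix (Fin N) (Fin N) ℝ} {b : ℕ → ℝ} {z : ℂ}

/-- The fluctuation `Z_i` as a function of the independent entries. -/
noncomputable def fluctCoord (μ : Measure (Edge N → ℂ)) (z : ℂ) (i : Fin N) (x : Edge N → ℂ) : ℂ :=
  quadForm z {i} i i (mat x) - avg μ (incident {i}) (fun x => quadForm z {i} i i (mat x)) x

lemma tame_fluctCoord (hz : 0 < z.im) (i : Fin N) : Tame (fluctCoord μ z i) :=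
  (tame_quadForm hz {i} i i).sub ((tame_quadForm hz {i} i i).avg _)

lemma avg_fluctCoord (hz : 0 < z.im) (i : Fin N) (x : Edge N → ℂ) :
    avg μ (incident {i}) (fluctCoord μ z i) x = 0 := by
  have ht := tame_quadForm hz {i} i i
  have h1 := avg_sub (μ := μ) ht (ht.avg (μ := μ) (incident {i})) (incident {i}) x
  rw [avg_avg (μ := μ) ht, Finset.union_idempotent, sub_self] at h1
  exact h1

/-- The alternating sum over minors of the quadratic forms of the column `i`. -/
noncomputable def quadDiff (z : ℂ) (i : Fin N) (B : Finset (Fin N)) (x : Edge N → ℂ) : ℂ :=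
  altDiff B (fun T => quadForm z (insert i T) i i (mat x)) ∅

lemma quadDiff_eq (z : ℂ) (i : Fin N) (B : Finset (Fin N)) (x : Edge N → ℂ) :
    quadDiff z i B x
      = ∑ C ∈ B.powerset, (-1) ^ C.card * quadForm z (insert i C) i i (mat x) := by
  simp only [quadDiff, altDiff, Finset.empty_union]

lemma tame_quadDiff (hz : 0 < z.im) (i : Fin N) (B : Finset (Fin N)) :
    Tame (quadDiff (N := N) z i B) := by
  have : quadDiff (N := N) z i B
      = fun x => ∑ C ∈ B.powerset, (-1) ^ C.card * quadForm z (insert i C) i i (mat x) :=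
    funext fun x => quadDiff_eq z i B x
  rw [this]
  exact Tame.sum _ fun C _ => (tame_quadForm hz (insert i C) i i).const_mul _

/-- Only the alternating sum over minors contributes to `fluctPart`. -/
lemma fluctPart_quadForm (hz : 0 < z.im) {i : Fin N} {A B : Finset (Fin N)} (hBA : B ⊆ A)
    (hi : i ∉ B) (x : Edge N → ℂ) :
    fluctPart μ incident A (fun x => quadForm z {i} i i (mat x)) x
      = fluctPart μ incident A (quadDiff z i B) x := by
  have e : quadDiff (N := N) z i B
      = fun x => ∑ C ∈ B.powerset, (-1) ^ C.card * quadForm z (insert i C) i i (mat x) :=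
    funext fun x => quadDiff_eq z i B x
  rw [e, fluctPart_sum_mul _ _ fun C => tame_quadForm hz (insert i C) i i,
    Finset.sum_eq_single_of_mem ∅ (Finset.empty_mem_powerset B)]
  · simp
  -- A nonempty `C ⊆ A` contains an index `k` whose column the term does not see, and `1 - 𝔼_k`
  -- kills the term.
  · intro C hC hne
    obtain ⟨k, hk⟩ := Finset.nonempty_iff_ne_empty.2 hne
    have hCB := Finset.mem_powerset.1 hC
    have hd : DependsOn (fun x : Edge N → ℂ => quadForm z (insert i C) i i (mat x))
        (incident {k} : Set (Edge N))ᶜ := fun x y hxy =>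
      dependsOn_quadForm_insert z C (fun h => hi (hCB h)) fun e he => hxy e fun h =>
        he (incident_mono (Finset.singleton_subset_iff.2 hk) h)
    rw [fluctPart_eq_zero isIncidence_incident (tame_quadForm hz (insert i C) i i) hd
      (hBA (hCB hk)), mul_zero]

/-- Averaging over the column `i` commutes with taking fluctuating parts, so the replacement by
alternating sums applies to the centred form as well. -/
lemma fluctPart_fluctCoord (hz : 0 < z.im) {i : Fin N} {A B : Finset (Fin N)} (hBA : B ⊆ A)
    (hi : i ∉ B) (x : Edge N → ℂ) :
    fluctPart μ incident A (fluctCoord μ z i) x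
      = fluctPart μ incident A
        (fun x => quadDiff z i B x - avg μ (incident {i}) (quadDiff z i B) x) x := by
  have h1 := tame_quadForm hz {i} i i
  have h2 := tame_quadDiff hz i B
  have e := fluctPart_sub (μ := μ) (E := incident) h1 (h1.avg (μ := μ) (incident {i})) A x
  have e' := fluctPart_sub (μ := μ) (E := incident) h2 (h2.avg (μ := μ) (incident {i})) A x
  have e2 : fluctPart μ incident A (fun x => quadForm z {i} i i (mat x))
      = fluctPart μ incident A (quadDiff z i B) :=
    funext fun x => fluctPart_quadForm hz hBA hi x
  rw [fluctPart_avg_comm isIncidence_incident h1] at e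
  rw [fluctPart_avg_comm isIncidence_incident h2, ← e2] at e'
  exact e.trans e'.symm

lemma HasMoments.integral_norm_quadDiff_pow_le (h : HasMoments μ S b) (hS1 : ∀ i j, S i j ≤ 1)
    (hz : 0 < z.im) (hz' : 1 / z.im ≤ N) (i : Fin N) (B : Finset (Fin N)) {p : ℕ} (hp : 0 < p) :
    ∫ x, ‖quadDiff z i B x‖ ^ (2 * p) ∂μ
      ≤ ((2 : ℝ) ^ B.card) ^ (2 * p) * ((N : ℝ) ^ 3 * b (2 * p)) ^ (2 * p) := by
  simp only [quadDiff_eq]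
  have := integral_norm_sum_mul_pow_le (μ := μ) B.powerset
    (c := fun C => (-1) ^ C.card) (fun C => by simp)
    (fun C => tame_quadForm hz (insert i C) i i) (p := 2 * p) (by omega)
    (fun C _ => h.integral_norm_quadForm_pow_le hS1 hz hz' (insert i C) i hp)
  rwa [Finset.card_powerset, Nat.cast_pow, Nat.cast_ofNat] at this

/-- The hypotheses on the parameters under which the fluctuations are averaged. -/
structure AveragingData (μ : Measure (Edge N → ℂ)) (S : Matrix (Fin N) (Fin N) ℝ) (b : ℕ → ℝ)
    (δm δp M B : ℝ) (z : ℂ) (n p : ℕ) (ψ ε : ℝ) : Prop where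
  moments : HasMoments μ S b
  scale : ScaleData S δm δp M (deviationConst b n) B z
  one_le_n : 1 ≤ n
  p_pos : 0 < p
  ψ_pos : 0 < ψ
  ψ_eq : ψ = Real.log N * (deviationConst b n * B)
  ψ_small : 1600 * p * (2 ^ p * ψ) ^ 2 ≤ 1
  ψ_small' : 40 * (2 ^ p * ψ) ≤ 1
  ε_pos : 0 < ε
  prob_le : (N + N * N + ((N ^ 9 : ℕ) + 1) * N) * Real.exp (-(2 * n)) ≤ ε ^ 2
  ε_small : ε * ((N : ℝ) ^ 3) ^ p ≤ (ψ ^ p) ^ p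

/-- The constant in the bounds on the fluctuating parts. -/
noncomputable def averagingConst (b : ℕ → ℝ) (p : ℕ) : ℝ :=
  2 ^ p * (2 * (diffConst (40 * 2 ^ p) p + 2 ^ p * b (2 * p)))

variable {δm δp M B ψ ε : ℝ} {n p : ℕ}

namespace AveragingData

lemma ψ_le_one (h : AveragingData μ S b δm δp M B z n p ψ ε) : ψ ≤ 1 := by
  have h1 := h.ψ_small'
  have h2 : (1 : ℝ) ≤ 2 ^ p := one_le_pow₀ (by norm_num)
  have := h.ψ_pos
  nlinarith

/-- On the good event the diagonal entries are at least `1/20`, hence at least `1/40` in minors with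
at most `p` removed indices, and off-diagonal entries grow at most by `2^p`; the constant `40 * 2^p`
covers both. -/
lemma good_bounds (h : AveragingData μ S b δm δp M B z n p ψ ε) {x : Edge N → ℂ}
    (hx : x ∉ badEvent S b n (N ^ 9) z) (i : Fin N) :
    ‖fluctCoord μ z i x‖ ≤ ψ ∧ ∀ B : Finset (Fin N), i ∉ B → B.Nonempty → B.card ≤ p →
      ‖quadDiff z i B x‖ ≤ diffConst (40 * 2 ^ p) p * ψ ^ (1 + B.card) := by
  have hz := h.scale.im_pos
  obtain ⟨h1, h2⟩ := largeDeviation_of_notMem_badEvent h.moments.one_le h.moments.nonneg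
    h.one_le_n hx
  obtain ⟨hoff, hdiag, hquad⟩ := h.scale.entrywise_bounds (isHermitian_mat x) h1 h2
  rw [← h.ψ_eq] at hoff
  have hψ := h.ψ_pos
  constructor
  · rw [fluctCoord, h.moments.avg_quadForm, h.ψ_eq]
    exact hquad i
  intro B hi hB hBp
  -- For `c = 1/20` one has `2 / c = 40` and `c / 2 = 1/40`, so the two smallness conditions become
  -- `ψ_small` and `ψ_small'`.
  have hminor := fun T hT => green_minor_bounds (isHermitian_mat x) hz (ψ := ψ) (c := 1 / 20)
    (R := p) hψ.le (by norm_num) (by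
      have := h.ψ_small
      nlinarith) (by
      have := h.ψ_small'
      nlinarith) hoff hdiag T hT
  have h2p : (1 : ℝ) ≤ 2 ^ p := one_le_pow₀ (by norm_num)
  have hpow : ∀ T : Finset (Fin N), T.card ≤ p → (2 : ℝ) ^ T.card ≤ 2 ^ p := fun T hT =>
    pow_le_pow_right₀ (by norm_num) hT
  refine norm_altDiff_quadForm_le (isHermitian_mat x) hz (by linarith) hψ.le h.ψ_le_one ?_ ?_ hi hB
    hBp
  · intro T hT k l hkl
    refine ((hminor T hT).1 k l hkl).trans ?_
    gcongr
    have := hpow T hT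
    linarith
  · intro T hT k
    by_cases hk : k ∈ T
    · rw [green_of_mem_left hk]; simp
    · have h3 := (hminor T hT).2 k hk
      have hTp : (T.card : ℝ) ≤ p := by exact_mod_cast hT
      have h4 : (T.card : ℝ) * ((2 ^ p * ψ) ^ 2 * (2 / (1 / 20)))
          ≤ p * ((2 ^ p * ψ) ^ 2 * (2 / (1 / 20))) := by gcongr
      have h5 : 1 / 40 ≤ ‖green (mat x) z T k k‖ := by
        have := h.ψ_small
        nlinarith
      rw [norm_div, norm_one, div_le_iff₀ (by linarith)]
      nlinarith

/-- The contribution of the exceptional event is `ε` times a power of `N`; by `ε_small` it is below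
even `ψ^p` per power, the smallest scale needed. -/
lemma integral_pow_le_of_good (h : AveragingData μ S b δm δp M B z n p ψ ε)
    {F : (Edge N → ℂ) → ℂ} (hF : Tame F) {c : ℝ} {r r' : ℕ} (hr : r' ≤ r) (hr' : r' ≤ p)
    (hc : 0 ≤ c) (hgood : ∀ x ∉ badEvent S b n (N ^ 9) z, ‖F x‖ ≤ c * ψ ^ r)
    (hmom : ∫ x, ‖F x‖ ^ (2 * p) ∂μ
      ≤ ((2 : ℝ) ^ p) ^ (2 * p) * ((N : ℝ) ^ 3 * b (2 * p)) ^ (2 * p)) :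
    ∫ x, ‖F x‖ ^ p ∂μ ≤ ((c + 2 ^ p * b (2 * p)) * ψ ^ r') ^ p := by
  have hN := h.scale.N_pos
  have hb := h.moments.one_le (2 * p)
  have hψ := h.ψ_pos
  have hψ1 := h.ψ_le_one
  have hz := h.scale.im_pos
  have hNp : 0 < N := by exact_mod_cast hN
  have h1 := integral_norm_pow_le_add (μ := μ) (p := p) (Q := (2 ^ p * (N ^ 3 * b (2 * p))) ^ p) hF
    (measurableSet_badEvent hz h.scale.im_le (pow_pos hNp 9)) hgood (by positivity) h.ε_pos
    (by positivity) (hmom.trans (le_of_eq (by ring)))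
    ((h.moments.measureReal_badEvent_le h.one_le_n hz h.scale.im_le (pow_pos hNp 9)).trans
      h.prob_le)
  refine h1.trans ?_
  have h2 : ε * (2 ^ p * (N ^ 3 * b (2 * p))) ^ p ≤ (2 ^ p * b (2 * p) * ψ ^ r') ^ p := by
    calc ε * (2 ^ p * (N ^ 3 * b (2 * p))) ^ p
        = (2 ^ p * b (2 * p)) ^ p * (ε * ((N : ℝ) ^ 3) ^ p) := by ring
      _ ≤ (2 ^ p * b (2 * p)) ^ p * (ψ ^ p) ^ p := by
          gcongr
          exact h.ε_small
      _ ≤ (2 ^ p * b (2 * p)) ^ p * (ψ ^ r') ^ p := by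
          gcongr ?_ * ?_ ^ p
          exact pow_le_pow_of_le_one hψ.le hψ1 hr'
      _ = _ := by ring
  have h3 : (c * ψ ^ r) ^ p ≤ (c * ψ ^ r') ^ p := by
    refine pow_le_pow_left₀ (by positivity) (mul_le_mul_of_nonneg_left ?_ hc) p
    exact pow_le_pow_of_le_one hψ.le hψ1 hr
  have h4 := pow_add_pow_le (x := c * ψ ^ r') (y := 2 ^ p * b (2 * p) * ψ ^ r') (by positivity)
    (by positivity) h.p_pos.ne'
  calc _ ≤ (c * ψ ^ r') ^ p + (2 ^ p * b (2 * p) * ψ ^ r') ^ p := add_le_add h3 h2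
    _ ≤ _ := h4
    _ = _ := by ring

/-- If `A ⊆ {i}` the plain bound `ψ` on `Z_i` suffices. Otherwise the alternating sum over `A \ {i}`
has size `ψ^(1 + |A \ {i}|)`, and the extra `ψ` pays for the possible membership of `i`. -/
lemma integral_norm_fluctPart_le (h : AveragingData μ S b δm δp M B z n p ψ ε) (i : Fin N)
    {A : Finset (Fin N)} (hA : A.card ≤ p) :
    ∫ x, ‖fluctPart μ incident A (fluctCoord μ z i) x‖ ^ p ∂μ
      ≤ (averagingConst b p * ψ ^ A.card) ^ p := by
  have hz := h.scale.im_pos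
  have hp := h.p_pos
  have hN := h.scale.N_pos
  have hψ := h.ψ_pos
  have hinv : 1 / z.im ≤ N := by
    have := one_div_le_one_div_of_le (one_div_pos.2 hN) h.scale.le_im
    simpa using this
  have hS1 : ∀ i j, S i j ≤ 1 := fun i j => by
    rw [← h.scale.gapped.sum_one j]
    exact Finset.single_le_sum (f := fun i => S i j) (fun k _ => h.moments.nonneg k j)
      (Finset.mem_univ i)
  have hb := h.moments.one_le (2 * p)
  have h2p : (1 : ℝ) ≤ 2 ^ p := one_le_pow₀ (by norm_num)
  have hd := one_le_diffConst (a := 40 * 2 ^ p) (by linarith) p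
  have h2A : (2 : ℝ) ^ A.card ≤ 2 ^ p := pow_le_pow_right₀ (by norm_num) hA
  rcases (A.erase i).eq_empty_or_nonempty with hB | hB
  · have hA1 : A.card ≤ 1 := by
      have := Finset.card_le_card_sdiff_add_card (s := A) (t := {i})
      rw [← Finset.erase_eq, hB] at this
      simpa using this
    have h1 := h.integral_pow_le_of_good (tame_fluctCoord hz i) (c := 1) (r := 1) hA1
      (hA1.trans hp) zero_le_one (fun x hx => by simpa using (h.good_bounds hx i).1) (by
        refine (integral_norm_sub_avg_pow_le (tame_quadForm hz {i} i i) _ (by omega)).trans ?_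
        have := h.moments.integral_norm_quadForm_pow_le hS1 hz hinv {i} i hp
        refine mul_le_mul (pow_le_pow_left₀ (by norm_num) (le_self_pow₀ (by norm_num) hp.ne') _)
          this (integral_nonneg fun _ => by positivity) (by positivity))
    refine (integral_norm_fluctPart_pow_le (tame_fluctCoord hz i) A hp).trans ?_
    calc _ ≤ ((2 : ℝ) ^ p) ^ p * ((1 + 2 ^ p * b (2 * p)) * ψ ^ A.card) ^ p := by
          gcongr
      _ = (2 ^ p * (1 + 2 ^ p * b (2 * p)) * ψ ^ A.card) ^ p := by
          rw [← mul_pow, ← mul_assoc]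
      _ ≤ _ := by
          rw [averagingConst]
          gcongr
          nlinarith
  · set C := A.erase i with hC
    have hiC : i ∉ C := Finset.notMem_erase i A
    have hCA : C ⊆ A := Finset.erase_subset i A
    have hCp : C.card ≤ p := (Finset.card_le_card hCA).trans hA
    have hr : A.card ≤ 1 + C.card := by
      have := Finset.pred_card_le_card_erase (s := A) (a := i)
      rw [← hC] at this
      omega
    have h1 := h.integral_pow_le_of_good (tame_quadDiff hz i C)
      (c := diffConst (40 * 2 ^ p) p) (r := 1 + C.card) hr hA (by linarith)
      (fun x hx => (h.good_bounds hx i).2 C hiC hB hCp) (by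
        refine (h.moments.integral_norm_quadDiff_pow_le hS1 hz hinv i C hp).trans ?_
        gcongr
        norm_num)
    simp only [fluctPart_fluctCoord hz hCA hiC]
    have ht := tame_quadDiff hz i C
    refine (integral_norm_fluctPart_pow_le (ht.sub (ht.avg _)) A hp).trans ?_
    calc _ ≤ ((2 : ℝ) ^ p) ^ p * (2 ^ p *
          ((diffConst (40 * 2 ^ p) p + 2 ^ p * b (2 * p)) * ψ ^ A.card) ^ p) := by
          gcongr
          exact (integral_norm_sub_avg_pow_le ht _ hp).trans (by gcongr)
      _ = _ := by
          rw [averagingConst, ← mul_pow, ← mul_pow]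
          congr 1
          ring

theorem integral_norm_sum_le (h : AveragingData μ S b δm δp M B z n p ψ ε) (hpe : Even p)
    (hN : 1 ≤ N * ψ ^ 2) :
    ∫ x, ‖∑ i, fluctCoord μ z i x‖ ^ p ∂μ
      ≤ (p * ((2 ^ p) ^ p * p.factorial) : ℕ) * (averagingConst b p * (N * ψ ^ 2)) ^ p := by
  have hz := h.scale.im_pos
  have hb := h.moments.one_le (2 * p)
  have h2p : (1 : ℝ) ≤ 2 ^ p := one_le_pow₀ (by norm_num)
  have hd := one_le_diffConst (a := 40 * 2 ^ p) (by linarith) p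
  have hK : 0 < averagingConst b p := by unfold averagingConst; positivity
  have := integral_norm_average_pow_le (μ := μ) isIncidence_incident h.p_pos hpe
    (tame_fluctCoord (μ := μ) hz) (avg_fluctCoord hz) hK h.ψ_pos h.ψ_le_one
    (by rw [Fintype.card_fin]; exact hN) (fun i A hA => h.integral_norm_fluctPart_le i hA)
  rwa [Fintype.card_fin] at this

end AveragingData

end ModelEstimate

/-! ### From subexponential tails to moments -/

section TailMoments

variable {Ω : Type*} [MeasurableSpace Ω] {P : Measure Ω} [IsProbabilityMeasure P]

/-- Exponential tails give factorial moments. -/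
lemma integrable_pow_of_tail {Y : Ω → ℝ} (hY : Measurable Y) (hY0 : ∀ ω, 0 ≤ Y ω) {β : ℝ}
    (hβ : 0 ≤ β) (h : ∀ t : ℝ, 0 < t → P.real {ω | t < Y ω} ≤ β * Real.exp (-t)) {q : ℕ}
    (hq : 1 ≤ q) :
    Integrable (fun ω => Y ω ^ q) P ∧ ∫ ω, Y ω ^ q ∂P ≤ β * q.factorial := by
  have hq0 : (0 : ℝ) < q := by exact_mod_cast hq
  have hΓ := Real.GammaIntegral_convergent hq0
  have hval : (q : ℝ) * ∫ x in Set.Ioi (0 : ℝ), Real.exp (-x) * x ^ ((q : ℝ) - 1)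
      = q.factorial := by
    rw [← Real.Gamma_eq_integral hq0, ← Real.Gamma_add_one hq0.ne', Real.Gamma_nat_eq_factorial]
  have hle : ∫⁻ ω, ENNReal.ofReal (Y ω ^ q) ∂P ≤ ENNReal.ofReal (β * q.factorial) := by
    -- Layer-cake formula; inserting the tail bound leaves a Gamma integral.
    have e := lintegral_rpow_eq_lintegral_meas_lt_mul P (Filter.Eventually.of_forall hY0)
      hY.aemeasurable hq0
    simp only [Real.rpow_natCast] at e
    rw [e]
    have h1 : ∫⁻ t in Set.Ioi (0 : ℝ), P {a | t < Y a} * ENNReal.ofReal (t ^ ((q : ℝ) - 1))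
        ≤ ∫⁻ t in Set.Ioi (0 : ℝ), ENNReal.ofReal (β * (Real.exp (-t) * t ^ ((q : ℝ) - 1))) := by
      refine setLIntegral_mono' measurableSet_Ioi fun t ht => ?_
      have ht' : (0 : ℝ) < t := ht
      rw [← mul_assoc, ENNReal.ofReal_mul (mul_nonneg hβ (Real.exp_pos _).le)]
      gcongr
      have := h t ht'
      rw [Measure.real] at this
      exact (ENNReal.le_ofReal_iff_toReal_le (measure_ne_top P _)
        (mul_nonneg hβ (Real.exp_pos _).le)).2 this
    rw [← ofReal_integral_eq_lintegral_ofReal (hΓ.const_mul β)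
      ((ae_restrict_iff' measurableSet_Ioi).2 (Filter.Eventually.of_forall fun t ht => by
        have : (0 : ℝ) < t := ht
        simp only [Pi.zero_apply]
        positivity)), integral_const_mul] at h1
    refine (mul_le_mul_right h1 _).trans ?_
    rw [← ENNReal.ofReal_mul hq0.le, ← hval]
    exact ENNReal.ofReal_le_ofReal (le_of_eq (by ring))
  have hnn : 0 ≤ᵐ[P] fun ω => Y ω ^ q := Filter.Eventually.of_forall fun ω => pow_nonneg (hY0 ω) q
  have hm : Measurable fun ω => Y ω ^ q := hY.pow_const q
  have hint : Integrable (fun ω => Y ω ^ q) P := by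
    refine ⟨hm.aestronglyMeasurable, ?_⟩
    rw [hasFiniteIntegral_iff_ofReal hnn]
    exact hle.trans_lt ENNReal.ofReal_lt_top
  refine ⟨hint, ?_⟩
  rw [← ofReal_integral_eq_lintegral_ofReal hint hnn] at hle
  exact (ENNReal.ofReal_le_ofReal_iff (by positivity)).1 hle

/-- The variable `Y = (X / σ)^(1/α)` has an exponential tail, and `X^n ≤ σ^n (1 + Y^(a n))` for an
integer `a ≥ α`. -/
lemma integrable_pow_of_subexp {X : Ω → ℝ} (hX : Measurable X) (hX0 : ∀ ω, 0 ≤ X ω) {σ α β : ℝ}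
    (hσ : 0 < σ) (hα : 0 < α) (hβ : 0 ≤ β)
    (h : ∀ x : ℝ, 0 < x → P.real {ω | x ^ α * σ < X ω} ≤ β * Real.exp (-x)) {a n : ℕ} (ha : α ≤ a)
    (hn : 1 ≤ n) :
    Integrable (fun ω => X ω ^ n) P ∧
      ∫ ω, X ω ^ n ∂P ≤ (1 + β * (a * n).factorial) * σ ^ n := by
  set Y : Ω → ℝ := fun ω => (X ω / σ) ^ (1 / α) with hYdef
  have hXσ : ∀ ω, 0 ≤ X ω / σ := fun ω => div_nonneg (hX0 ω) hσ.le
  have hY0 : ∀ ω, 0 ≤ Y ω := fun ω => Real.rpow_nonneg (hXσ ω) _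
  have hYα : ∀ ω, Y ω ^ α = X ω / σ := fun ω => by
    rw [hYdef]
    simp only
    rw [← Real.rpow_mul (hXσ ω), one_div_mul_cancel hα.ne', Real.rpow_one]
  have hYm : Measurable Y := (hX.div_const σ).pow_const _
  have ha1 : 1 ≤ a := by
    have : (0 : ℝ) < a := hα.trans_le ha
    exact_mod_cast this
  have hq : 1 ≤ a * n := Nat.one_le_iff_ne_zero.2 (by positivity)
  have htail : ∀ t : ℝ, 0 < t → P.real {ω | t < Y ω} ≤ β * Real.exp (-t) := fun t ht => by
    refine (measureReal_mono fun ω (hω : t < Y ω) => ?_).trans (h t ht)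
    have h1 := Real.rpow_lt_rpow ht.le hω hα
    rw [hYα, lt_div_iff₀ hσ] at h1
    exact h1
  obtain ⟨hi, hle⟩ := integrable_pow_of_tail hYm hY0 hβ htail hq
  have hpt : ∀ ω, X ω ^ n ≤ σ ^ n * (1 + Y ω ^ (a * n)) := fun ω => by
    have e : X ω = σ * Y ω ^ α := by rw [hYα]; field_simp
    have h1 : Y ω ^ α ≤ 1 ∨ Y ω ^ α ≤ Y ω ^ a := by
      rcases le_total (Y ω) 1 with hy | hy
      · exact Or.inl (Real.rpow_le_one (hY0 ω) hy hα.le)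
      · right
        have := Real.rpow_le_rpow_of_exponent_le hy ha
        rwa [Real.rpow_natCast] at this
    have h0 : 0 ≤ Y ω ^ α := Real.rpow_nonneg (hY0 ω) _
    have hy0 := hY0 ω
    rw [e, mul_pow]
    refine mul_le_mul_of_nonneg_left ?_ (by positivity)
    rcases h1 with h1 | h1
    · have := pow_le_pow_left₀ h0 h1 n
      rw [one_pow] at this
      have : 0 ≤ Y ω ^ (a * n) := by positivity
      linarith
    · have := pow_le_pow_left₀ h0 h1 n
      rw [← pow_mul] at this
      linarith
  have hi2 : Integrable (fun ω => σ ^ n * (1 + Y ω ^ (a * n))) P :=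
    ((integrable_const _).add hi).const_mul _
  have hi1 : Integrable (fun ω => X ω ^ n) P := by
    refine hi2.mono' (hX.pow_const n).aestronglyMeasurable (Filter.Eventually.of_forall fun ω => ?_)
    rw [Real.norm_of_nonneg (pow_nonneg (hX0 ω) n)]
    exact hpt ω
  refine ⟨hi1, (integral_mono hi1 hi2 hpt).trans ?_⟩
  rw [integral_const_mul, integral_add (integrable_const _) hi]
  simp only [integral_const, probReal_univ, smul_eq_mul, mul_one]
  rw [mul_comm]
  gcongr

end TailMoments

/-! ### The law of the entries of `H` as a resampling measure -/

section Transfer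

variable {Ω : Type*} [MeasurableSpace Ω] {P : Measure Ω} [IsProbabilityMeasure P] {N : ℕ}
variable {H : Ω → Matrix (Fin N) (Fin N) ℂ} {α β δm δp : ℝ}

/-- The constant in the moment bounds for the entries. -/
noncomputable def momentConst (α β : ℝ) (n : ℕ) : ℝ :=
  (1 + β) * (2 * ⌈α⌉₊ * (n + 1) : ℝ) ^ (2 * ⌈α⌉₊)

lemma one_le_momentConst (hα : 0 < α) (hβ : 0 < β) (n : ℕ) : 1 ≤ momentConst α β n := by
  have h1 : (1 : ℝ) ≤ ⌈α⌉₊ := by exact_mod_cast Nat.one_le_ceil_iff.2 hα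
  have h2 : (0 : ℝ) ≤ n := n.cast_nonneg
  have h3 : (1 : ℝ) ≤ (2 * ⌈α⌉₊ * (n + 1) : ℝ) ^ (2 * ⌈α⌉₊) := one_le_pow₀ (by nlinarith)
  unfold momentConst
  nlinarith

lemma momentConst_mono (hβ : 0 < β) : Monotone (momentConst α β) := by
  intro m n h
  have : (m : ℝ) ≤ n := by exact_mod_cast h
  unfold momentConst
  gcongr

lemma varMatrix_nonneg (i j : Fin N) : 0 ≤ varMatrix P H i j :=
  integral_nonneg fun _ => by positivity

lemma IsUniversalWigner.integrable_norm_pow (hH : IsUniversalWigner P H α β δm δp) (hα : 0 < α)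
    (hβ : 0 < β) (i j : Fin N) {n : ℕ} (hn : 1 ≤ n) :
    Integrable (fun ω => ‖H ω i j‖ ^ n) P ∧ (Even n →
      ∫ ω, ‖H ω i j‖ ^ n ∂P ≤ (1 + β * (⌈α⌉₊ * n).factorial) * varMatrix P H i j ^ (n / 2)) := by
  have hm := (hH.measurable i j).norm
  -- An entry of zero variance vanishes almost surely and has no scale by which to normalise.
  rcases (varMatrix_nonneg (P := P) (H := H) i j).eq_or_lt with h0 | h0
  · have hi2 : Integrable (fun ω => ‖H ω i j‖ ^ 2) P :=
      (hH.memLp_two i j).integrable_norm_pow (by norm_num)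
    have h1 : (fun ω => ‖H ω i j‖ ^ 2) =ᵐ[P] 0 :=
      (integral_eq_zero_iff_of_nonneg (fun ω => by positivity) hi2).1 h0.symm
    have h2 : (fun ω => ‖H ω i j‖ ^ n) =ᵐ[P] 0 := by
      filter_upwards [h1] with ω hω
      have : ‖H ω i j‖ = 0 := by simpa using hω
      simp only [this, Pi.zero_apply]
      exact zero_pow (by omega)
    refine ⟨(integrable_congr h2).2 (integrable_zero _ _ _), fun _ => ?_⟩
    rw [integral_congr_ae h2]
    simp only [Pi.zero_apply, integral_zero]
    have := varMatrix_nonneg (P := P) (H := H) i j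
    positivity
  · have := integrable_pow_of_subexp (P := P) hm (fun ω => norm_nonneg _) (Real.sqrt_pos.2 h0) hα
      hβ.le (hH.subexp i j) (Nat.le_ceil α) hn
    refine ⟨this.1, fun he => this.2.trans (le_of_eq ?_)⟩
    obtain ⟨m, rfl⟩ := he
    rw [show m + m = 2 * m by ring, pow_mul (√_), Real.sq_sqrt h0.le,
      Nat.mul_div_cancel_left m (by norm_num)]

/-- Bounding `(2an)!` by `(2an)^(2an)` makes the constant the `n`-th power of a polynomial in `n`.
Polynomial growth is essential, since `n` will be of order `log N`. -/
lemma IsUniversalWigner.integral_norm_pow_le (hH : IsUniversalWigner P H α β δm δp) (hα : 0 < α)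
    (hβ : 0 < β) (i j : Fin N) {n : ℕ} (hn : 1 ≤ n) :
    ∫ ω, ‖H ω i j‖ ^ (2 * n) ∂P ≤ (momentConst α β n * varMatrix P H i j) ^ n := by
  have h1 := (hH.integrable_norm_pow hα hβ i j (n := 2 * n) (by omega)).2 (even_two_mul n)
  rw [Nat.mul_div_cancel_left n (by norm_num)] at h1
  refine h1.trans ?_
  rw [mul_pow]
  refine mul_le_mul_of_nonneg_right ?_ (pow_nonneg (varMatrix_nonneg i j) n)
  set a := ⌈α⌉₊
  have h2 : ((a * (2 * n)).factorial : ℝ) ≤ ((2 * a * (n + 1) : ℝ) ^ (2 * a)) ^ n := by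
    have e : ((a * (2 * n)).factorial : ℝ) ≤ ((a * (2 * n) : ℕ) : ℝ) ^ (a * (2 * n)) := by
      exact_mod_cast Nat.factorial_le_pow _
    refine e.trans ?_
    rw [← pow_mul, show a * (2 * n) = 2 * a * n by ring]
    refine pow_le_pow_left₀ (by positivity) ?_ _
    push_cast
    have : (0 : ℝ) ≤ a := a.cast_nonneg
    nlinarith
  have h3 : (1 : ℝ) ≤ ((a * (2 * n)).factorial : ℝ) := by
    exact_mod_cast Nat.one_le_iff_ne_zero.2 (Nat.factorial_ne_zero _)
  have h4 : (1 + β) ≤ (1 + β) ^ n := le_self_pow₀ (by linarith) (by omega)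
  rw [momentConst, mul_pow]
  calc 1 + β * ((a * (2 * n)).factorial : ℝ) ≤ (1 + β) * ((a * (2 * n)).factorial : ℝ) := by
        linarith
    _ ≤ _ := mul_le_mul h4 h2 (by positivity) (by positivity)

/-- The independent entries of a random hermitian matrix. -/
def toConf (H : Ω → Matrix (Fin N) (Fin N) ℂ) (ω : Ω) : Edge N → ℂ := fun e => H ω e.1.1 e.1.2

lemma mat_toConf {ω : Ω} (h : (H ω).IsHermitian) : mat (toConf H ω) = H ω := by
  ext i j
  rw [mat_apply, toConf]
  rcases lt_trichotomy i j with hij | hij | hij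
  · simp [hij, edge, min_eq_left hij.le, max_eq_right hij.le]
  · subst hij
    simp only [lt_irrefl, if_false, edge, min_self, max_self]
    have := congrFun (congrFun h i) i
    rw [Matrix.conjTranspose_apply] at this
    exact Complex.conj_eq_iff_re.1 this
  · have := congrFun (congrFun h i) j
    rw [Matrix.conjTranspose_apply] at this
    simp only [hij.not_gt, if_false, hij, if_true, edge, min_eq_right hij.le, max_eq_left hij.le]
    exact this

lemma IsUniversalWigner.measurable_toConf (hH : IsUniversalWigner P H α β δm δp) :
    Measurable (toConf H) :=
  measurable_pi_lambda _ fun e => hH.measurable e.1.1 e.1.2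

lemma IsUniversalWigner.map_toConf_eq_pi (hH : IsUniversalWigner P H α β δm δp) :
    P.map (toConf H) = Measure.pi fun e : Edge N => P.map fun ω => H ω e.1.1 e.1.2 :=
  (iIndepFun_iff_map_fun_eq_pi_map fun e : Edge N =>
    (hH.measurable e.1.1 e.1.2).aemeasurable).1 hH.indep

lemma IsUniversalWigner.integrable_one_add_norm_pow (hH : IsUniversalWigner P H α β δm δp)
    (hα : 0 < α) (hβ : 0 < β) (m : ℕ) :
    Integrable (fun ω => (1 + ‖toConf H ω‖) ^ m) P := by
  rcases Nat.eq_zero_or_pos m with rfl | hm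
  · simp
  have hL : ∀ e : Edge N, MemLp (fun ω => ‖H ω e.1.1 e.1.2‖) m P := fun e => by
    refine (integrable_norm_rpow_iff (hH.measurable e.1.1 e.1.2).norm.aestronglyMeasurable
      (by exact_mod_cast hm.ne') (by simp)).1 ?_
    have := (hH.integrable_norm_pow hα hβ e.1.1 e.1.2 hm).1
    simpa using this
  have hsum0 : MemLp (fun ω => ∑ e : Edge N, ‖H ω e.1.1 e.1.2‖) m P :=
    memLp_finsetSum (p := (m : ENNReal)) (μ := P) Finset.univ
      (f := fun (e : Edge N) ω => ‖H ω e.1.1 e.1.2‖) fun e _ => hL e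
  have hone : MemLp (fun _ : Ω => (1 : ℝ)) m P := memLp_const 1
  have hsum : MemLp (fun ω => 1 + ∑ e : Edge N, ‖H ω e.1.1 e.1.2‖) m P := hone.add hsum0
  refine (hsum.integrable_norm_pow hm.ne').mono' ?_ (Filter.Eventually.of_forall fun ω => ?_)
  · exact ((measurable_const.add hH.measurable_toConf.norm).pow_const m).aestronglyMeasurable
  · have h1 : ‖toConf H ω‖ ≤ ∑ e : Edge N, ‖H ω e.1.1 e.1.2‖ :=
      (pi_norm_le_iff_of_nonneg (Finset.sum_nonneg fun _ _ => norm_nonneg _)).2 fun e =>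
        Finset.single_le_sum (f := fun e : Edge N => ‖H ω e.1.1 e.1.2‖)
          (fun _ _ => norm_nonneg _) (Finset.mem_univ e)
    have h2 : 0 ≤ ∑ e : Edge N, ‖H ω e.1.1 e.1.2‖ := Finset.sum_nonneg fun _ _ => norm_nonneg _
    rw [Real.norm_of_nonneg (by positivity), Real.norm_of_nonneg (by linarith)]
    gcongr

lemma IsUniversalWigner.resamplingMeasure (hH : IsUniversalWigner P H α β δm δp) (hα : 0 < α)
    (hβ : 0 < β) : ResamplingMeasure (P.map (toConf H)) := by
  refine ⟨fun S => ?_, fun m => ?_⟩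
  · have : ∀ e : Edge N, IsProbabilityMeasure (P.map fun ω => H ω e.1.1 e.1.2) := fun e =>
      Measure.isProbabilityMeasure_map (hH.measurable e.1.1 e.1.2).aemeasurable
    rw [hH.map_toConf_eq_pi]
    exact measurePreserving_piecewise_pi _ S
  · have hm : Measurable fun x : Edge N → ℂ => (1 + ‖x‖) ^ m :=
      (measurable_const.add measurable_norm).pow_const m
    exact (integrable_map_measure hm.aestronglyMeasurable hH.measurable_toConf.aemeasurable).2
      (hH.integrable_one_add_norm_pow hα hβ m)

lemma IsUniversalWigner.hasMoments (hH : IsUniversalWigner P H α β δm δp) (hα : 0 < α)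
    (hβ : 0 < β) :
    HasMoments (P.map (toConf H)) (varMatrix P H) (momentConst α β) where
  centred i j := by
    rw [integral_map hH.measurable_toConf.aemeasurable (measurable_mat i j).aestronglyMeasurable]
    simp only [mat_toConf (hH.hermitian _)]
    exact hH.centred i j
  var i j := by
    rw [integral_map hH.measurable_toConf.aemeasurable
      ((measurable_mat i j).norm.pow_const 2).aestronglyMeasurable]
    simp only [mat_toConf (hH.hermitian _)]
    rfl
  moment i j n hn := by
    rw [integral_map hH.measurable_toConf.aemeasurable
      ((measurable_mat i j).norm.pow_const _).aestronglyMeasurable]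
    simp only [mat_toConf (hH.hermitian _)]
    exact hH.integral_norm_pow_le hα hβ i j hn
  one_le := one_le_momentConst hα hβ
  mono := momentConst_mono hβ

lemma IsUniversalWigner.fluct_eq (hH : IsUniversalWigner P H α β δm δp) {z : ℂ} (hz : 0 < z.im)
    (i : Fin N) (ω : Ω) :
    fluct P H z i ω = fluctCoord (P.map (toConf H)) z i (toConf H ω) := by
  rw [fluct, fluctCoord, mat_toConf (hH.hermitian ω)]
  congr 1
  have hm := ((tame_quadForm hz {i} i i).piecewise (incident {i}) (toConf H ω)).1
  rw [colExp, avg, integral_map hH.measurable_toConf.aemeasurable hm.aestronglyMeasurable]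
  refine integral_congr_ae (Filter.Eventually.of_forall fun ω' => ?_)
  simp only
  rw [← replaceCol_mat, mat_toConf (hH.hermitian ω), mat_toConf (hH.hermitian ω')]

lemma IsUniversalWigner.isGappedStochastic (hH : IsUniversalWigner P H α β δm δp) :
    IsGappedStochastic (varMatrix P H) δm δp where
  symm i j := by
    simp only [varMatrix, Matrix.of_apply]
    refine integral_congr_ae (Filter.Eventually.of_forall fun ω => ?_)
    have := congrFun (congrFun (hH.hermitian ω) i) j
    rw [Matrix.conjTranspose_apply] at this
    simp only
    rw [← this]
    simp
  nonneg := varMatrix_nonneg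
  sum_one := hH.sum_var
  simple_one := hH.simple_one
  spectrum_subset := hH.spectrum_subset

end Transfer

/-! ### Choice of parameters and powers of `log N` -/

section Parameters

/-- If `δ₊ > 2` the interval is empty, all eigenvalues are `1`, and all eigenvectors are constant,
which is impossible in dimension at least two. The stability estimate uses this bound. -/
lemma IsGappedStochastic.le_two {N : ℕ} {S : Matrix (Fin N) (Fin N) ℝ} {δm δp : ℝ}
    (hS : IsGappedStochastic S δm δp) (hδm : 0 < δm) (hN : 2 ≤ N) : δp ≤ 2 := by
  have hH := hS.isHermitian
  by_contra hcon
  have h1 : ∀ k, hH.eigenvalues k = 1 := fun k => by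
    rcases hS.spectrum_subset (hH.eigenvalues_mem_spectrum_real k) with h | h
    · linarith [h.1, h.2]
    · exact h
  have hconst : ∀ k, ∃ c : ℝ, ∀ i, hH.eigenvectorBasis k i = c := fun k => by
    have hmul := hH.mulVec_eigenvectorBasis k
    rw [h1, one_smul] at hmul
    exact hS.eigenvector_of_one hmul
  set i₀ : Fin N := ⟨0, by omega⟩
  set i₁ : Fin N := ⟨1, by omega⟩
  have hne : i₁ ≠ i₀ := by simp [i₀, i₁]
  have h2 := sum_sq_eq_sum_sq_dotProduct hH (Pi.single i₀ 1 - Pi.single i₁ 1)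
  have h3 : ∀ k, ∑ i, hH.eigenvectorBasis k i
      * (Pi.single i₀ 1 - Pi.single i₁ 1 : Fin N → ℝ) i = 0 := fun k => by
    obtain ⟨c, hc⟩ := hconst k
    simp only [hc, Pi.sub_apply]
    rw [← Finset.mul_sum, Finset.sum_sub_distrib]
    simp
  simp only [h3] at h2
  have h4 : (Pi.single i₀ 1 - Pi.single i₁ 1 : Fin N → ℝ) i₀ ^ 2
      ≤ ∑ i, (Pi.single i₀ 1 - Pi.single i₁ 1 : Fin N → ℝ) i ^ 2 :=
    Finset.single_le_sum (f := fun i => (Pi.single i₀ 1 - Pi.single i₁ 1 : Fin N → ℝ) i ^ 2)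
      (fun _ _ => sq_nonneg _) (Finset.mem_univ i₀)
  rw [h2] at h4
  simp only [Pi.sub_apply, Pi.single_eq_same, Pi.single_eq_of_ne hne.symm] at h4
  norm_num at h4

variable {Ω : Type*} [MeasurableSpace Ω] {P : Measure Ω} [IsProbabilityMeasure P] {N : ℕ}
variable {H : Ω → Matrix (Fin N) (Fin N) ℂ} {α β δm δp : ℝ} {z : ℂ}

lemma IsUniversalWigner.bandParam_pos_and (hH : IsUniversalWigner P H α β δm δp) (hN : 0 < N) :
    0 < bandParam P H ∧ ∀ i j, varMatrix P H i j ≤ 1 / bandParam P H := by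
  have hbdd : BddAbove (Set.range fun q : Fin N × Fin N => varMatrix P H q.1 q.2) :=
    Set.Finite.bddAbove (Set.finite_range _)
  have hle : ∀ i j, varMatrix P H i j ≤ ⨆ q : Fin N × Fin N, varMatrix P H q.1 q.2 := fun i j =>
    le_ciSup hbdd (i, j)
  have hpos : 0 < ⨆ q : Fin N × Fin N, varMatrix P H q.1 q.2 := by
    by_contra hcon
    have h1 := hH.sum_var ⟨0, hN⟩
    have h2 : ∑ i, varMatrix P H i ⟨0, hN⟩ ≤ 0 :=
      Finset.sum_nonpos fun i _ => (hle i _).trans (not_lt.1 hcon)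
    linarith
  refine ⟨one_div_pos.2 hpos, fun i j => ?_⟩
  rw [bandParam, one_div_one_div]
  exact hle i j

/-- `(κ + η)^(1/4) (M η)^(-1/2)`. -/
noncomputable def scaleB (P : Measure Ω) (H : Ω → Matrix (Fin N) (Fin N) ℂ) (z : ℂ) : ℝ :=
  √(√(kappa z + z.im) / (bandParam P H * z.im))

lemma IsUniversalWigner.scaleData (hH : IsUniversalWigner P H α β δm δp) (hα : 0 < α)
    (hδm : 0 < δm) (hδp : 0 ≤ δp) (hN : 4 ≤ N)
    (hL : 10000 * stabilityConst δm ≤ Real.log N) (hz : z ∈ domainDStar P H α δp) {K : ℝ}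
    (hK1 : 1 ≤ K) (hK : K ≤ Real.log N ^ (5 + 2 * α)) :
    ScaleData (varMatrix P H) δm δp (bandParam P H) K (scaleB P H z) z := by
  obtain ⟨hre, him1, him2, hdom⟩ := hz
  have hNpos : (0 : ℝ) < N := by exact_mod_cast (by omega : 0 < N)
  have hzp : 0 < z.im := (one_div_pos.2 hNpos).trans_le him1
  obtain ⟨hM, hSM⟩ := hH.bandParam_pos_and (by omega : 0 < N)
  have hL1 : 1 ≤ Real.log N := by linarith [one_le_stabilityConst hδm]
  have hL0 : 0 < Real.log N := by linarith
  have hB2 : scaleB P H z ^ 2 = √(kappa z + z.im) / (bandParam P H * z.im) := by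
    rw [scaleB, Real.sq_sqrt (by positivity)]
  have hB0 : 0 ≤ scaleB P H z := Real.sqrt_nonneg _
  have hθ : 0 < theta δp z := by linarith [half_le_theta hδp hzp]
  refine ⟨hH.isGappedStochastic, hδm, hδp, hH.isGappedStochastic.le_two hδm (by omega), hN, hL, hre,
    him1, him2, hM, hSM, hK1, hB0, hB2, ?_⟩
  rw [← Real.sqrt_eq_rpow] at hdom
  have h1 : Real.log N ^ (24 + 6 * α) * theta δp z ^ 4 * scaleB P H z ^ 2 ≤ 1 := by
    rw [hB2, mul_div_assoc', div_le_one (by positivity)]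
    exact hdom
  -- Squaring turns the smallness condition into the one defining `D*`: `(L⁷ K)² ≤ L^(24 + 4α)`,
  -- within the exponent `24 + 6α`.
  have h2 : (Real.log N ^ 7 * (K * scaleB P H z) * theta δp z ^ 2) ^ 2 ≤ 1 := by
    have e : (Real.log N ^ 7 * (K * scaleB P H z) * theta δp z ^ 2) ^ 2
        = (Real.log N ^ 7 * K) ^ 2 * theta δp z ^ 4 * scaleB P H z ^ 2 := by ring
    rw [e]
    refine le_trans ?_ h1
    have h3 : (Real.log N ^ 7 * K) ^ 2 ≤ Real.log N ^ (24 + 6 * α) := by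
      calc (Real.log N ^ 7 * K) ^ 2 ≤ (Real.log N ^ 7 * Real.log N ^ (5 + 2 * α)) ^ 2 := by gcongr
        _ = Real.log N ^ (24 + 4 * α) := by
            rw [← Real.rpow_natCast (Real.log N) 7, ← Real.rpow_add hL0, ← Real.rpow_mul_natCast hL0.le]
            congr 1
            push_cast; ring
        _ ≤ _ := Real.rpow_le_rpow_of_exponent_le hL1 (by linarith)
    gcongr
  refine (sq_le_sq₀ (by positivity) zero_le_one).1 ?_
  rwa [one_pow]

/-- From `M ≤ N` and `η ≤ 4 √(κ + η)` one gets `4 N B² ≥ 1`. This is the condition `N ψ² ≥ 1` of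
fluctuation averaging. -/
lemma ScaleData.one_le_mul_sq {S : Matrix (Fin N) (Fin N) ℝ} {M K B : ℝ}
    (h : ScaleData S δm δp M K B z) : 1 ≤ N * (Real.log N * (K * B)) ^ 2 := by
  have hz := h.im_pos
  have hs := h.sqrt_pos'
  have hs2 : √(kappa z + z.im) ^ 2 = kappa z + z.im := Real.sq_sqrt (kappa_add_im_pos hz).le
  have hk : 0 ≤ kappa z := abs_nonneg _
  have him := h.im_le
  have h4 : z.im ≤ 4 * √(kappa z + z.im) := by
    refine (sq_le_sq₀ hz.le (by positivity)).1 ?_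
    nlinarith
  have hM := h.M_pos
  have hB : 1 ≤ 4 * N * B ^ 2 := by
    rw [h.B_sq, mul_div_assoc', le_div_iff₀ (by positivity)]
    have := mul_le_mul h.M_le h4 hz.le h.N_pos.le
    linarith
  have hL := h.one_le_log
  have hK := h.one_le_K
  have hLK : 2 ≤ Real.log N * K := by nlinarith
  have e : N * (Real.log N * (K * B)) ^ 2 = (Real.log N * K) ^ 2 * (N * B ^ 2) := by ring
  rw [e]
  have : 0 ≤ N * B ^ 2 := mul_nonneg h.N_pos.le (sq_nonneg _)
  nlinarith

/-- The number of moments used in the large deviation estimates. -/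
noncomputable def momentOrder (p N : ℕ) : ℕ := ⌈((p ^ 2 + 3 * p + 20 : ℕ) : ℝ) * Real.log N⌉₊

/-- In the exponent, `p²` compensates for `ψ^(p²) ≥ N^(-p²)`, `3p` for the crude moments of order
`N^(3p)`, and `20` leaves room for the union bound over the grid. -/
lemma exp_neg_momentOrder_le {p : ℕ} (hN : 0 < N) :
    Real.exp (-momentOrder p N) ≤ 1 / (N : ℝ) ^ (p ^ 2 + 3 * p + 20) := by
  have hNpos : (0 : ℝ) < N := by exact_mod_cast hN
  have h1 : ((p ^ 2 + 3 * p + 20 : ℕ) : ℝ) * Real.log N ≤ momentOrder p N := Nat.le_ceil _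
  have h2 : 1 / (N : ℝ) ^ (p ^ 2 + 3 * p + 20)
      = Real.exp (-(((p ^ 2 + 3 * p + 20 : ℕ) : ℝ) * Real.log N)) := by
    rw [Real.exp_neg, Real.exp_nat_mul, Real.exp_log hNpos, one_div]
  rw [h2]
  exact Real.exp_le_exp.2 (by linarith)

/-- The constant in the logarithmic bound on `deviationConst`. -/
noncomputable def deviationBound (α β : ℝ) (p : ℕ) : ℝ :=
  576 * ((p ^ 2 + 3 * p + 20 : ℕ) : ℝ) ^ 2 *
    ((1 + β) * (12 * ⌈α⌉₊ * ((p ^ 2 + 3 * p + 20 : ℕ) : ℝ)) ^ (2 * ⌈α⌉₊))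

lemma one_le_deviationConst {b : ℕ → ℝ} (hb : ∀ n, 1 ≤ b n) {n : ℕ} (hn : 1 ≤ n) :
    1 ≤ deviationConst b n := by
  have h1 : (1 : ℝ) ≤ n := by exact_mod_cast hn
  have h2 := hb (2 * n)
  have h3 : 1 ≤ Real.exp 1 := Real.one_le_exp zero_le_one
  have h4 : (1 : ℝ) ≤ n ^ 2 := one_le_pow₀ h1
  have h5 : 1 ≤ 48 * (n : ℝ) ^ 2 * b (2 * n) := by nlinarith
  unfold deviationConst
  nlinarith

/-- With `n` at most a multiple of `log N`, the factor `n²` and the moment constant give `(log N)^(2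
+ 2⌈α⌉₊)`. One more logarithm absorbs the constant, and `⌈α⌉₊ ≤ α + 1`. -/
lemma deviationConst_le (hα : 0 < α) (hβ : 0 < β) {p : ℕ} (hL : 1 ≤ Real.log N)
    (hL2 : deviationBound α β p ≤ Real.log N) :
    deviationConst (momentConst α β) (momentOrder p N) ≤ Real.log N ^ (5 + 2 * α) := by
  set D : ℝ := ((p ^ 2 + 3 * p + 20 : ℕ) : ℝ) with hD
  set L := Real.log N
  set a := ⌈α⌉₊ with ha
  have hD1 : 1 ≤ D := by
    rw [hD]
    exact_mod_cast (by omega : 1 ≤ p ^ 2 + 3 * p + 20)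
  have ha1 : (a : ℝ) ≤ α + 1 := (Nat.ceil_lt_add_one hα.le).le
  have hDL : 1 ≤ D * L := by nlinarith
  have hn : (momentOrder p N : ℝ) ≤ 2 * (D * L) := by
    have := Nat.ceil_lt_add_one (a := D * L) (by positivity)
    rw [momentOrder, ← hD]
    linarith
  have he : Real.exp 1 ≤ 3 := by linarith [Real.exp_one_lt_d9]
  have hn2 : 2 * (a : ℝ) * (((2 * momentOrder p N : ℕ) : ℝ) + 1) ≤ 12 * a * D * L := by
    have : ((2 * momentOrder p N : ℕ) : ℝ) + 1 ≤ 6 * (D * L) := by push_cast; linarith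
    calc _ ≤ 2 * (a : ℝ) * (6 * (D * L)) := by gcongr
      _ = _ := by ring
  calc deviationConst (momentConst α β) (momentOrder p N)
      ≤ 3 * (48 * (2 * (D * L)) ^ 2 * ((1 + β) * (12 * a * D * L) ^ (2 * a))) := by
        unfold deviationConst momentConst
        gcongr
    _ = deviationBound α β p * (L ^ 2 * L ^ (2 * a)) := by
        rw [deviationBound, ← hD, ← ha, mul_pow (12 * (a : ℝ) * D)]
        ring
    _ ≤ L * (L ^ 2 * L ^ (2 * a)) := by gcongr
    _ = L ^ ((3 + 2 * a : ℕ) : ℝ) := by rw [Real.rpow_natCast]; ring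
    _ ≤ L ^ (5 + 2 * α) := by
        refine Real.rpow_le_rpow_of_exponent_le hL ?_
        push_cast
        linarith

/-- A lower bound on `log N` that suffices for the moment estimate. -/
noncomputable def logThreshold (α β δm : ℝ) (p : ℕ) : ℝ :=
  10000 * stabilityConst δm + deviationBound α β p + 160 * p * 2 ^ p +
    (p * ((2 ^ p) ^ p * p.factorial) : ℕ) * averagingConst (momentConst α β) p

lemma IsUniversalWigner.averagingData (hH : IsUniversalWigner P H α β δm δp) (hα : 0 < α)
    (hβ : 0 < β) (hδm : 0 < δm) (hδp : 0 ≤ δp) {p : ℕ} (hp : 0 < p) (hN : 4 ≤ N)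
    (hL1 : 10000 * stabilityConst δm ≤ Real.log N) (hL2 : deviationBound α β p ≤ Real.log N)
    (hL3 : 160 * p * 2 ^ p ≤ Real.log N) (hz : z ∈ domainDStar P H α δp)
    [IsProbabilityMeasure (P.map (toConf H))] [ResamplingMeasure (P.map (toConf H))] :
    AveragingData (P.map (toConf H)) (varMatrix P H) (momentConst α β) δm δp (bandParam P H)
      (scaleB P H z) z (momentOrder p N) p
      (Real.log N * (deviationConst (momentConst α β) (momentOrder p N) * scaleB P H z))
      (3 * N ^ 5 * Real.exp (-momentOrder p N)) := by
  have hL : 1 ≤ Real.log N := by linarith [one_le_stabilityConst hδm]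
  have hNpos : (0 : ℝ) < N := by exact_mod_cast (by omega : 0 < N)
  have hN4 : (4 : ℝ) ≤ N := by exact_mod_cast hN
  have hn : 1 ≤ momentOrder p N := by
    refine Nat.one_le_ceil_iff.2 (mul_pos ?_ (by linarith))
    exact_mod_cast (by omega : 0 < p ^ 2 + 3 * p + 20)
  have hsc := hH.scaleData hα hδm hδp hN hL1 hz
    (one_le_deviationConst (one_le_momentConst hα hβ) hn) (deviationConst_le hα hβ hL hL2)
  set K := deviationConst (momentConst α β) (momentOrder p N)
  set B := scaleB P H z
  set ψ := Real.log N * (K * B) with hψ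
  have hNψ := hsc.one_le_mul_sq
  rw [← hψ] at hNψ
  have hψ0 : 0 ≤ ψ := mul_nonneg (by linarith)
    (mul_nonneg (by linarith [hsc.one_le_K]) hsc.B_nonneg)
  have hψpos : 0 < ψ := by
    rcases hψ0.eq_or_lt with h | h
    · rw [← h] at hNψ; norm_num at hNψ
    · exact h
  have hψle : ψ * (40 * p * 2 ^ p) ≤ 1 := by
    have h1 := half_le_theta hδp hsc.im_pos
    have h2 := hsc.small
    have h3 : ψ * Real.log N * (1 / 4) ≤ 1 := by
      calc ψ * Real.log N * (1 / 4) ≤ ψ * Real.log N ^ 6 * theta δp z ^ 2 := by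
            gcongr
            · exact le_self_pow₀ hL (by norm_num)
            · nlinarith
        _ = Real.log N ^ 7 * (K * B) * theta δp z ^ 2 := by rw [hψ]; ring
        _ ≤ 1 := h2
    have h4 : ψ * (160 * p * 2 ^ p) ≤ ψ * Real.log N := by gcongr
    linarith
  have hp1 : (1 : ℝ) ≤ p := by exact_mod_cast hp
  set x := 2 ^ p * ψ with hx
  have hx0 : 0 ≤ x := by positivity
  have hpx : 40 * (p * x) ≤ 1 := by rw [hx]; linarith
  have hxpx : x ≤ p * x := le_mul_of_one_le_left hx0 hp1
  refine ⟨hH.hasMoments hα hβ, hsc, hn, hp, hψpos, rfl, ?_, by linarith, by positivity, ?_, ?_⟩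
  · nlinarith
  -- The union bound has at most `9 N^10` events, and `9 N^10 exp (-2n)` is the square of the chosen
  -- `ε`.
  · have e : Real.exp (-(2 * (momentOrder p N : ℝ))) = Real.exp (-momentOrder p N) ^ 2 := by
      rw [← Real.exp_nat_mul]; congr 1; push_cast; ring
    rw [e, mul_pow]
    refine mul_le_mul_of_nonneg_right ?_ (by positivity)
    push_cast
    have h1 : (1 : ℝ) ≤ N := by linarith
    have h2 : (N : ℝ) ≤ N ^ 10 := le_self_pow₀ h1 (by norm_num)
    have h3 : (N : ℝ) ^ 2 ≤ N ^ 10 := pow_le_pow_right₀ h1 (by norm_num)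
    calc (N : ℝ) + N * N + ((N : ℝ) ^ 9 + 1) * N = 2 * N + (N : ℝ) ^ 2 + (N : ℝ) ^ 10 := by ring
      _ ≤ 9 * (N : ℝ) ^ 10 := by linarith
      _ = _ := by ring
  · have h1 := exp_neg_momentOrder_le (p := p) (by omega : 0 < N)
    have h2 : 1 / (N : ℝ) ≤ ψ := by
      refine (sq_le_sq₀ (by positivity) hψ0).1 ?_
      rw [div_pow, one_pow, div_le_iff₀ (by positivity)]
      nlinarith
    have h3 : (1 / (N : ℝ)) ^ (p * p) ≤ (ψ ^ p) ^ p := by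
      rw [← pow_mul]
      exact pow_le_pow_left₀ (by positivity) h2 _
    refine le_trans ?_ h3
    calc 3 * (N : ℝ) ^ 5 * Real.exp (-momentOrder p N) * ((N : ℝ) ^ 3) ^ p
        ≤ N * (N : ℝ) ^ 5 * (1 / (N : ℝ) ^ (p ^ 2 + 3 * p + 20)) * ((N : ℝ) ^ 3) ^ p := by
          gcongr
          linarith
      _ = 1 / (N : ℝ) ^ (p * p) * (1 / (N : ℝ) ^ 14) := by
          rw [← pow_mul]
          field_simp
          ring
      _ ≤ 1 / (N : ℝ) ^ (p * p) * 1 := by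
          gcongr
          rw [div_le_one (by positivity)]
          exact one_le_pow₀ (by linarith)
      _ = _ := by rw [mul_one, div_pow, one_pow]

theorem IsUniversalWigner.integral_norm_average_fluct_pow_le
    (hH : IsUniversalWigner P H α β δm δp) (hα : 0 < α)
    (hβ : 0 < β) (hδm : 0 < δm) (hδp : 0 ≤ δp) {p : ℕ} (hp : 0 < p) (hpe : Even p) (hN : 4 ≤ N)
    (hL : logThreshold α β δm p ≤ Real.log N) (hz : z ∈ domainDStar P H α δp) :
    Integrable (fun ω => ‖(1 / (N : ℂ)) * ∑ i, fluct P H z i ω‖ ^ p) P ∧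
      ∫ ω, ‖(1 / (N : ℂ)) * ∑ i, fluct P H z i ω‖ ^ p ∂P
        ≤ (Real.log N ^ (3 + 2 * α) * controlX P H α z ^ 2) ^ p := by
  have := hH.resamplingMeasure hα hβ
  have : IsProbabilityMeasure (P.map (toConf H)) :=
    Measure.isProbabilityMeasure_map hH.measurable_toConf.aemeasurable
  have hNpos : (0 : ℝ) < N := by exact_mod_cast (by omega : 0 < N)
  have hd : (1 : ℝ) ≤ diffConst (40 * 2 ^ p) p := one_le_diffConst (by
    have : (1 : ℝ) ≤ 2 ^ p := one_le_pow₀ (by norm_num)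
    linarith) p
  have hb := one_le_momentConst hα hβ (2 * p)
  have hA0 : 0 < averagingConst (momentConst α β) p := by unfold averagingConst; positivity
  have hst := one_le_stabilityConst hδm
  have hdev : 0 ≤ deviationBound α β p := by unfold deviationBound; positivity
  set c : ℕ := p * ((2 ^ p) ^ p * p.factorial) with hc
  have hc1 : 1 ≤ c := Nat.one_le_iff_ne_zero.2 (by positivity)
  have hc1' : (1 : ℝ) ≤ c := by exact_mod_cast hc1
  have h160 : (0 : ℝ) ≤ 160 * p * 2 ^ p := by positivity
  have hcA : 0 ≤ c * averagingConst (momentConst α β) p := by positivity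
  unfold logThreshold at hL
  rw [← hc] at hL
  have hdata := hH.averagingData hα hβ hδm hδp hp hN (by linarith) (by linarith) (by linarith) hz
  have hzp := hdata.scale.im_pos
  have hLK := deviationConst_le (N := N) hα hβ (p := p) (by linarith) (by linarith)
  have hmain := hdata.integral_norm_sum_le hpe hdata.scale.one_le_mul_sq
  set K := deviationConst (momentConst α β) (momentOrder p N)
  have hB2 := hdata.scale.B_sq
  have hB0 := hdata.scale.B_nonneg
  have hK1 := hdata.scale.one_le_K
  have hM := hdata.scale.M_pos
  set B := scaleB P H z
  set L := Real.log N with hLdef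
  have hL1 : 1 ≤ L := by linarith
  have hL0 : 0 < L := by linarith
  set F : (Edge N → ℂ) → ℂ := fun x =>
    (1 / (N : ℂ)) * ∑ i, fluctCoord (P.map (toConf H)) z i x with hF
  have hsum : Tame fun x : Edge N → ℂ => ∑ i, fluctCoord (P.map (toConf H)) z i x :=
    Tame.sum _ fun i _ => tame_fluctCoord hzp i
  have htF : Tame F := hsum.const_mul _
  have hFω : ∀ ω, ‖(1 / (N : ℂ)) * ∑ i, fluct P H z i ω‖ ^ p = ‖F (toConf H ω)‖ ^ p := fun ω => by
    simp only [hF, hH.fluct_eq hzp]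
  have hms := (htF.1.norm.pow_const p).aestronglyMeasurable (μ := P.map (toConf H))
  simp only [hFω]
  refine ⟨(integrable_map_measure hms hH.measurable_toConf.aemeasurable).1
    (htF.integrable_norm_pow p), ?_⟩
  rw [← integral_map hH.measurable_toConf.aemeasurable hms]
  have hscale : ∀ x, ‖F x‖ ^ p
      = (1 / (N : ℝ)) ^ p * ‖∑ i, fluctCoord (P.map (toConf H)) z i x‖ ^ p := fun x => by
    simp only [hF]
    rw [norm_mul, mul_pow, norm_div, norm_one, Complex.norm_natCast]
  simp only [hscale]
  rw [integral_const_mul]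
  have hX : controlX P H α z ^ 2 = (L ^ (10 + 2 * α)) ^ 2 * B ^ 2 := by
    have h1 : ((kappa z + z.im) ^ (1 / 4 : ℝ)) ^ 2 = √(kappa z + z.im) := by
      rw [← Real.rpow_mul_natCast (kappa_add_im_pos hzp).le, Real.sqrt_eq_rpow]
      norm_num
    rw [controlX, mul_pow, div_pow, h1, Real.sq_sqrt (by positivity), hB2]
  -- The available exponent `23 + 6α` exceeds the required `13 + 4α`, which already includes one
  -- logarithm spent on the constants.
  have hLX : L * L ^ 2 * (L ^ (5 + 2 * α)) ^ 2 ≤ L ^ (3 + 2 * α) * (L ^ (10 + 2 * α)) ^ 2 := by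
    have e1 : L * L ^ 2 * (L ^ (5 + 2 * α)) ^ 2 = L ^ (13 + 4 * α) := by
      rw [← Real.rpow_mul_natCast hL0.le, ← pow_succ', ← Real.rpow_natCast, ← Real.rpow_add hL0]
      congr 1
      push_cast; ring
    have e2 : L ^ (3 + 2 * α) * (L ^ (10 + 2 * α)) ^ 2 = L ^ (23 + 6 * α) := by
      rw [← Real.rpow_mul_natCast hL0.le, ← Real.rpow_add hL0]
      congr 1
      push_cast; ring
    rw [e1, e2]
    exact Real.rpow_le_rpow_of_exponent_le hL1 (by linarith)
  have hcp : (c : ℝ) ≤ (c : ℝ) ^ p := le_self_pow₀ hc1' hp.ne'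
  calc (1 / (N : ℝ)) ^ p * ∫ x, ‖∑ i, fluctCoord (P.map (toConf H)) z i x‖ ^ p ∂P.map (toConf H)
      ≤ (1 / (N : ℝ)) ^ p *
        ((c : ℝ) ^ p * (averagingConst (momentConst α β) p * (N * (L * (K * B)) ^ 2)) ^ p) := by
        gcongr
        exact hmain.trans (by gcongr)
    _ = (c * averagingConst (momentConst α β) p * (L ^ 2 * K ^ 2) * B ^ 2) ^ p := by
        rw [← mul_pow, ← mul_pow]
        congr 1
        field_simp
    _ ≤ (L * (L ^ 2 * (L ^ (5 + 2 * α)) ^ 2) * B ^ 2) ^ p := by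
        gcongr
        linarith
    _ ≤ _ := by
        rw [hX]
        refine pow_le_pow_left₀ (by positivity) ?_ p
        calc _ = L * L ^ 2 * (L ^ (5 + 2 * α)) ^ 2 * B ^ 2 := by ring
          _ ≤ L ^ (3 + 2 * α) * (L ^ (10 + 2 * α)) ^ 2 * B ^ 2 := by gcongr
          _ = _ := by ring

end Parameters

end UniversalWigner

theorem lemma5p2 (p : ℕ) (hp : Even p) :
    ∃ C : ℝ, 0 < C ∧
      ∀ α β δm : ℝ, 0 < α → 0 < β → 0 < δm →
        ∃ N₀ : ℕ, ∀ N : ℕ, N₀ ≤ N →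
          ∀ (Ω : Type*) [MeasurableSpace Ω] (P : Measure Ω) [IsProbabilityMeasure P]
            (H : Ω → Matrix (Fin N) (Fin N) ℂ) (δp : ℝ), 0 ≤ δp →
            UniversalWigner.IsUniversalWigner P H α β δm δp →
            ∀ z ∈ UniversalWigner.domainDStar P H α δp,
              Integrable
                (fun ω => ‖(1 / (N : ℂ)) * ∑ i, UniversalWigner.fluct P H z i ω‖ ^ p) P ∧
              ∫ ω, ‖(1 / (N : ℂ)) * ∑ i, UniversalWigner.fluct P H z i ω‖ ^ p ∂P ≤
                C * (Real.log N ^ (3 + 2 * α) * UniversalWigner.controlX P H α z ^ 2) ^ p := by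
  rcases Nat.eq_zero_or_pos p with rfl | hp0
  -- For `p = 0` both sides equal `1`.
  · refine ⟨1, one_pos, fun α β δm _ _ _ => ⟨0, fun N _ Ω _ P _ H δp _ _ z _ => ?_⟩⟩
    simp
  -- The constants depending on `α`, `β`, `δ₋` and `p` go into the threshold on `log N`, so `C = 1`
  -- is admissible.
  · refine ⟨1, one_pos, fun α β δm hα hβ hδm =>
      ⟨max 4 ⌈Real.exp (UniversalWigner.logThreshold α β δm p)⌉₊,
        fun N hN Ω _ P _ H δp hδp hH z hz => ?_⟩⟩
    have hN4 : 4 ≤ N := (le_max_left _ _).trans hN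
    have hL : UniversalWigner.logThreshold α β δm p ≤ Real.log N := by
      have h1 : Real.exp (UniversalWigner.logThreshold α β δm p) ≤ N :=
        (Nat.le_ceil _).trans (by exact_mod_cast (le_max_right _ _).trans hN)
      have h2 := Real.log_le_log (Real.exp_pos _) h1
      rwa [Real.log_exp] at h2
    rw [one_mul]
    exact hH.integral_norm_average_fluct_pow_le hα hβ hδm hδp hp0 hp hN4 hL hz
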